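/- Let $k\ge 1$ be an integer, let $\alpha<\beta$ be real with $\beta-\alpha>\pi/k$, and let $\rho,R,c,K>0$, $\gamma\ge 0$. For $0\le\epsilon<(\beta-\alpha)/2$ and $r>0$ let $$S_\epsilon(r)=\{z : \alpha+\epsilon\le\arg z\le\beta-\epsilon,\ 0<|z|\le r\},$$ a closed sector without its vertex (on the Riemann surface of the logarithm, so that its opening may exceed $2\pi$), and let $P_n(0,r)$ and $\overline P_n(0,r)$ be the open and the closed polydisc of radius $r$ about $0$ in $\mathbb C^n$. The $k$-Borel transform of a function $f$ on $S_0(\rho)$ is $$(\mathcal B_kf)(t)=\frac1{2\pi i}\int f(z)\,e^{(t/z)^k}\,d(z^{-k}),$$ where, for $\arg t=d$, the path comes from $0$ along the ray $\arg z=d+a$ to $|z|=r_1$, follows the circle $|z|=r_1$ to $\arg z=d-a$, and returns to $0$ along that ray; here $0<r_1<\rho$, $\frac{\pi}{2k}<a<\frac{3\pi}{2k}$ and $\alpha<d-a<d+a<\beta$. A function $g(z,y)$ is called Gevrey of order $s>0$ in $z$ on $S_\epsilon(\rho')$, uniformly in $y\in P_n(0,R')$, if there are holomorphic functions $f_j$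 ($j\ge 0$) on $P_n(0,R')$ and constants $A,C>0$ such that $$\Big|g(z,y)-\sum_{j=0}^{N-1}f_j(y)z^j\Big|\le C A^N\,\Gamma(1+Ns)\,|z|^N\qquad\text{for all } N\in\mathbb N,\ z\in S_\epsilon(\rho'),\ y\in P_n(0,R').$$ For $\kappa>0$, it is called a $\kappa$-sum on $S_\epsilon(\rho')$, uniformly in $y\in P_n(0,R')$, if it is Gevrey of order $1/\kappa$ in this sense and the opening $\beta-\alpha-2\epsilon$ of the sector is greater than $\pi/\kappa$. **Theorem.** Let $g(z,y)=\sum_{Q\in\mathbb N^n}g_Q(z)y^Q$ be a bounded scalar function on $S_0(\rho)\times\overline P_n(0,R)$ that is holomorphic on a neighbourhood of this set. Suppose that for every $Q$ with $m=|Q|\ge 1$ the Borel transform $\mathcal B_kg_Q$ exists and extends to a holomorphic function on (a neighbourhood of) the closed disc $|t|\le c\,m^{-\gamma}$, and that $|(\mathcal B_kg_Q)(t)|\le K^m$ on this disc. Suppose also that $\mathcal B_kg_0$ exists and extends holomorphically to a neighbourhood of $t=0$. Then: 1. For every $\epsilon\in(0,(\beta-\alpha)/2)$ there are $\rho'\in(0,\rho)$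 and $R'\in(0,R)$ such that $g$ is Gevrey of order $\gamma+\frac1k$ in $z$ on $S_\epsilon(\rho')$, uniformly in $y\in P_n(0,R')$. 2. If moreover $\gamma<\frac{\beta-\alpha}{\pi}-\frac1k$, then $g$ is a $\frac{k}{k\gamma+1}$-sum: there are $\epsilon\in(0,(\beta-\alpha)/2)$, $\rho'\in(0,\rho)$ and $R'\in(0,R)$ such that $g$ is a $\frac{k}{k\gamma+1}$-sum on $S_\epsilon(\rho')$, uniformly in $y\in P_n(0,R')$. -/

import Mathlib

open Real Set

/-- The closed sector `θ₁ ≤ arg z ≤ θ₂`, `0 < |z| ≤ ρ` on the Riemann surface of the logarithm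
(the opening `θ₂ - θ₁` may exceed `2 * π`), in the coordinate `w = log z`. Thus `z = exp w`,
`|z| = exp w.re`, `arg z = w.im`, and a function is holomorphic in `z` if and only if it is
holomorphic in `w`. All functions of `z` below are written as functions of `w = log z`. -/
def closedSector (θ₁ θ₂ ρ : ℝ) : Set ℂ :=
  {w : ℂ | θ₁ ≤ w.im ∧ w.im ≤ θ₂ ∧ Real.exp w.re ≤ ρ}

/-- The integrand of the Borel integral of order `k` pulled back to the coordinate `w = log z`,
with `t = exp τ`: the form `f(z) e^{(t/z)^k} d(z^{-k})` is `borelIntegrand k f τ w dw`. -/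
noncomputable def borelIntegrand (k : ℕ) (f : ℂ → ℂ) (τ w : ℂ) : ℂ :=
  f w * Complex.exp (Complex.exp ((k : ℂ) * (τ - w))) * (-(k : ℂ) * Complex.exp (-(k : ℂ) * w))

/-- The Borel transform of order `k` of `f` at the point `t = exp τ`, in the direction
`d = arg t = τ.im`: `(2 π i)⁻¹ ∫ f(z) e^{(t/z)^k} d(z^{-k})`, over the path that comes from `0`
along the ray `arg z = d + a` up to `|z| = r`, follows the circle `|z| = r` to `arg z = d - a`,
and returns to `0` along that ray. With this orientation `z ^ m` is sent to
`t ^ (m - k) / Γ (m / k)`. -/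
noncomputable def borelTransform (k : ℕ) (f : ℂ → ℂ) (a r : ℝ) (τ : ℂ) : ℂ :=
  (2 * (π : ℂ) * Complex.I)⁻¹ *
    ((∫ x in Iic (Real.log r),
        borelIntegrand k f τ ((x : ℂ) + ((τ.im + a : ℝ) : ℂ) * Complex.I))
      + (∫ θ in (τ.im + a)..(τ.im - a),
          borelIntegrand k f τ ((Real.log r : ℂ) + (θ : ℂ) * Complex.I) * Complex.I)
      - ∫ x in Iic (Real.log r),
          borelIntegrand k f τ ((x : ℂ) + ((τ.im - a : ℝ) : ℂ) * Complex.I))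

/-- The two integrals along the rays in `borelTransform k f a r τ` converge absolutely. -/
def BorelConverges (k : ℕ) (f : ℂ → ℂ) (a r : ℝ) (τ : ℂ) : Prop :=
  MeasureTheory.IntegrableOn (fun x : ℝ =>
      borelIntegrand k f τ ((x : ℂ) + ((τ.im + a : ℝ) : ℂ) * Complex.I)) (Iic (Real.log r)) ∧
  MeasureTheory.IntegrableOn (fun x : ℝ =>
      borelIntegrand k f τ ((x : ℂ) + ((τ.im - a : ℝ) : ℂ) * Complex.I)) (Iic (Real.log r))

/-- For `f` given on the sector `α ≤ arg z ≤ β`, `0 < |z| ≤ ρ`: its Borel transform of order `k`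
exists and is holomorphic in the closed disc `|t| ≤ δ`, where it is the function `G`. That is, `G`
is holomorphic on a neighbourhood of the disc, and for each direction `d` and each admissible path
(the rays `arg z = d ± a` lie in the sector, `e^{(t/z)^k}` decays along them) the Borel
integral of `f` at the points `t` of the disc with `arg t = d` converges to `G t`. -/
def IsBorelTransformOnDisc (k : ℕ) (f : ℂ → ℂ) (α β ρ δ : ℝ) (G : ℂ → ℂ) : Prop :=
  AnalyticOnNhd ℂ G (Metric.closedBall 0 δ) ∧
  ∀ τ : ℂ, Real.exp τ.re ≤ δ → ∀ a r : ℝ,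
    π / (2 * k) < a → a < 3 * π / (2 * k) → α < τ.im - a → τ.im + a < β → 0 < r → r < ρ →
      BorelConverges k f a r τ ∧ borelTransform k f a r τ = G (Complex.exp τ)

/-- `g(z, y)` is Gevrey of order `s` in `z` on the closed sector `θ₁ ≤ arg z ≤ θ₂`, `0 < |z| ≤ ρ`,
uniformly in `y` in the open polydisc `|y i| < R` (a ball of the sup norm): there are holomorphic
coefficients `f j` on the polydisc with
`|g(z, y) - ∑_{j < N} f_j(y) z^j| ≤ C A^N Γ(1 + N s) |z|^N` for all `N`. -/
def IsGevreyUniformlyOn {n : ℕ} (s : ℝ) (g : ℂ → (Fin n → ℂ) → ℂ) (θ₁ θ₂ ρ R : ℝ) : Prop :=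
  ∃ f : ℕ → (Fin n → ℂ) → ℂ,
    (∀ j, AnalyticOnNhd ℂ (f j) (Metric.ball 0 R)) ∧
    ∃ C A : ℝ, 0 < C ∧ 0 < A ∧
      ∀ N : ℕ, ∀ w ∈ closedSector θ₁ θ₂ ρ, ∀ y ∈ Metric.ball (0 : Fin n → ℂ) R,
        ‖g w y - ∑ j ∈ Finset.range N, f j y * Complex.exp w ^ j‖
          ≤ C * A ^ N * Real.Gamma (1 + N * s) * ‖Complex.exp w‖ ^ N

/-- `g` is a `κ`-sum in `z` on the sector, uniformly in `y`: the opening of the sector is greater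
than `π / κ` and `g` is Gevrey of order `1 / κ` on it, uniformly in `y`. -/
def IsSumUniformlyOn {n : ℕ} (κ : ℝ) (g : ℂ → (Fin n → ℂ) → ℂ) (θ₁ θ₂ ρ R : ℝ) : Prop :=
  0 < κ ∧ π / κ < θ₂ - θ₁ ∧ IsGevreyUniformlyOn (1 / κ) g θ₁ θ₂ ρ R

/-! The proof combines a one-variable expansion with fully explicit constants and a summation over
the multi-indices `Q`.

One variable. Put `v = z^(-k)`, `s = t^k`, `u = ζ^(-k)`. The Borel transform of a bounded `f`
becomes, up to a power of `t`-direction factor, `H(s) = ∫ W e^{sV}` along a path `V` going to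
infinity in the left half plane, with `W` of size `V`. The function `Φ_u(s) = ∫ W e^{s(V-u)}/(V-u)`
is a primitive of `e^{-su} H(s)` and is exponentially small in `Re u` for fixed `s`. As `f` is
merely bounded, `Φ_u(s)` need not converge for `s → 0`, but `e^{-su} Φ_0(s) - Φ_u(s)` does, and its
limit is `f(ζ)` by Cauchy's formula (`integral_hankelWeight_eq`). Hence `f(ζ) = C₀ + ∫_0^{s₀}
e^{-su} H(s) ds - Φ_u(s₀)` (`IsHankelPath.eq_truncated_laplace`), which uses the Borel transform
only near `0`. Watson's lemma (`norm_truncated_laplace_sub_le`) expands the integral, and the last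
term is absorbed into the Gevrey bounds. Only the constant term could depend on the direction, and
it is the limit of `f` at `0`; so the directional expansions glue. The error in
`exists_sectorial_expansion` is a multiple of `(M + B) δ^(-2k) (A/δ)^N Γ(1 + N/k) |z|^N`, where `M`
and `B` bound `f` and its Borel transform on the disc of radius `δ`.

Several variables. For degree `m`, `M` and `B` grow geometrically (Cauchy estimates give `M`), and
`δ` may be taken proportional to `(m+1)^(-γ)`. The resulting factor `(m+1)^(γN)` is at most `Γ(1 +
γN) e^(m+1)`, and `Γ(1 + γN) Γ(1 + N/k) ≤ Γ(1 + N(γ + 1/k))`: the two Gevrey orders add, and all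
dependence on `Q` is a factor `Λ^m`. This is summable for `|y| < R'` with `Λ R' < 1`
(`isGevreyUniformlyOn_of_coeff`). The second claim only requires `ε` small enough to keep the
opening above `π (γ + 1/k)`. -/

/-! ### Taylor coefficients in `y`: Cauchy integrals over the torus -/

/-- The Haar probability measure on the torus. -/
noncomputable abbrev torusMeasure (n : ℕ) : MeasureTheory.Measure (Fin n → UnitAddCircle) :=
  MeasureTheory.Measure.pi fun _ => AddCircle.haarAddCircle

/-- The parametrization of the distinguished boundary of the polydisc of radius `R`. -/
noncomputable def torusPoint {n : ℕ} (R : ℝ) (x : Fin n → UnitAddCircle) : Fin n → ℂ :=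
  fun i => (R : ℂ) * fourier 1 (x i)

theorem continuous_torusPoint {n : ℕ} (R : ℝ) :
    Continuous (torusPoint R : (Fin n → UnitAddCircle) → _) := by
  unfold torusPoint
  fun_prop

theorem norm_mFourier_apply {n : ℕ} (Q : Fin n → ℤ) (x : Fin n → UnitAddCircle) :
    ‖UnitAddTorus.mFourier Q x‖ = 1 := by
  simp only [UnitAddTorus.mFourier, ContinuousMap.coe_mk, norm_prod, fourier_apply]
  exact Finset.prod_eq_one fun i _ => Circle.norm_coe _

theorem torusPoint_mem {n : ℕ} {R : ℝ} (hR : 0 ≤ R) (x : Fin n → UnitAddCircle) :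
    torusPoint R x ∈ Metric.closedBall (0 : Fin n → ℂ) R := by
  rw [mem_closedBall_zero_iff, pi_norm_le_iff_of_nonneg hR]
  intro i
  rw [torusPoint, norm_mul, fourier_apply, Circle.norm_coe, Complex.norm_real,
    Real.norm_of_nonneg hR, mul_one]

theorem prod_torusPoint_pow {n : ℕ} (R : ℝ) (x : Fin n → UnitAddCircle) (Q : Fin n → ℕ) :
    ∏ i, torusPoint R x i ^ Q i
      = (R : ℂ) ^ (∑ i, Q i) * UnitAddTorus.mFourier (fun i => (Q i : ℤ)) x := by
  simp only [torusPoint, mul_pow, Finset.prod_mul_distrib, Finset.prod_pow_eq_pow_sum,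
    UnitAddTorus.mFourier, ContinuousMap.coe_mk]
  congr 1
  refine Finset.prod_congr rfl fun i _ => ?_
  simp [fourier_apply, AddCircle.toCircle_nsmul]

theorem integral_mFourier_neg_mul {n : ℕ} (P Q : Fin n → ℤ) :
    ∫ x, UnitAddTorus.mFourier (-P) x * UnitAddTorus.mFourier Q x ∂(torusMeasure n)
      = if P = Q then 1 else 0 := by
  have hint : ∀ m : ℤ, ∫ x : UnitAddCircle, fourier m x ∂AddCircle.haarAddCircle
      = if m = 0 then 1 else 0 := by
    intro m
    have h := (orthonormal_iff_ite.mp (orthonormal_fourier (T := (1 : ℝ)))) 0 m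
    rw [MeasureTheory.ContinuousMap.inner_toLp] at h
    simpa [eq_comm] using h
  simp only [UnitAddTorus.mFourier, ContinuousMap.coe_mk, ← Finset.prod_mul_distrib, ← fourier_add]
  rw [MeasureTheory.integral_fintype_prod_eq_prod]
  simp only [hint]
  split_ifs with h
  · subst h; simp
  · obtain ⟨i, hi⟩ := Function.ne_iff.mp h
    refine Finset.prod_eq_zero (Finset.mem_univ i) ?_
    rw [if_neg]
    simp only [Pi.neg_apply]
    omega

/-- The Cauchy integral formula for the coefficients of a power series on a polydisc. -/
theorem coeff_eq_integral {n : ℕ} {R : ℝ} (hR : 0 ≤ R) (a : (Fin n → ℕ) → ℂ)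
    (F : (Fin n → ℂ) → ℂ)
    (hsum : ∀ y ∈ Metric.closedBall (0 : Fin n → ℂ) R,
      HasSum (fun Q : Fin n → ℕ => a Q * ∏ i, y i ^ Q i) (F y)) (P : Fin n → ℕ) :
    a P * (R : ℂ) ^ (∑ i, P i)
      = ∫ x, UnitAddTorus.mFourier (-fun i => (P i : ℤ)) x * F (torusPoint R x)
          ∂(torusMeasure n) := by
  have hs := (hsum _ (torusPoint_mem hR 0)).summable.norm
  have hnorm := norm_mFourier_apply (n := n)
  simp only [prod_torusPoint_pow, norm_mul, hnorm] at hs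
  have key := MeasureTheory.hasSum_integral_of_summable_integral_norm (μ := torusMeasure n)
    (F := fun (Q : Fin n → ℕ) x => UnitAddTorus.mFourier (-fun i => (P i : ℤ)) x *
      (a Q * ∏ i, torusPoint R x i ^ Q i)) ?_ ?_
  · have h2 : ∀ x, ∑' Q : Fin n → ℕ, UnitAddTorus.mFourier (-fun i => (P i : ℤ)) x *
      (a Q * ∏ i, torusPoint R x i ^ Q i) =
        UnitAddTorus.mFourier (-fun i => (P i : ℤ)) x * F (torusPoint R x) := fun x =>
      ((hsum _ (torusPoint_mem hR x)).mul_left _).tsum_eq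
    simp only [h2] at key
    refine HasSum.unique ?_ key
    have h3 : ∀ Q : Fin n → ℕ, ∫ x, UnitAddTorus.mFourier (-fun i => (P i : ℤ)) x *
      (a Q * ∏ i, torusPoint R x i ^ Q i) ∂(torusMeasure n)
        = if Q = P then a P * (R : ℂ) ^ (∑ i, P i) else 0 := by
      intro Q
      have : ∀ x, UnitAddTorus.mFourier (-fun i => (P i : ℤ)) x *
        (a Q * ∏ i, torusPoint R x i ^ Q i) = (a Q * (R : ℂ) ^ (∑ i, Q i)) *
        (UnitAddTorus.mFourier (-fun i => (P i : ℤ)) x *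
          UnitAddTorus.mFourier (fun i => (Q i : ℤ)) x) := by
        intro x; rw [prod_torusPoint_pow]; ring
      simp only [this]
      rw [MeasureTheory.integral_const_mul, integral_mFourier_neg_mul]
      have e : ((fun i => (P i : ℤ)) = fun i => (Q i : ℤ)) ↔ Q = P := by
        simp only [funext_iff, Nat.cast_inj, eq_comm]
      simp only [e]
      split_ifs with h
      · subst h; simp
      · simp
    simp only [h3]
    exact hasSum_ite_eq P _
  · intro Q
    refine Continuous.integrable_of_hasCompactSupport ?_ (HasCompactSupport.of_compactSpace _)
    have := continuous_torusPoint (n := n) R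
    fun_prop
  · refine hs.congr fun Q => ?_
    simp [prod_torusPoint_pow, hnorm]

theorem norm_coeff_le {n : ℕ} {R M : ℝ} (hR : 0 < R) (a : (Fin n → ℕ) → ℂ)
    (F : (Fin n → ℂ) → ℂ)
    (hsum : ∀ y ∈ Metric.closedBall (0 : Fin n → ℂ) R,
      HasSum (fun Q : Fin n → ℕ => a Q * ∏ i, y i ^ Q i) (F y))
    (hF : ∀ y ∈ Metric.closedBall (0 : Fin n → ℂ) R, ‖F y‖ ≤ M) (P : Fin n → ℕ) :
    ‖a P‖ ≤ M * R⁻¹ ^ (∑ i, P i) := by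
  have h := coeff_eq_integral hR.le a F hsum P
  have h2 : ‖a P * (R : ℂ) ^ (∑ i, P i)‖ ≤ M := by
    rw [h]
    refine (MeasureTheory.norm_integral_le_of_norm_le_const (C := M) (.of_forall fun x => ?_)).trans
      (by simp)
    rw [norm_mul, norm_mFourier_apply, one_mul]
    exact hF _ (torusPoint_mem hR.le x)
  rw [norm_mul, norm_pow, Complex.norm_real, Real.norm_of_nonneg hR.le] at h2
  rw [inv_pow, ← div_eq_mul_inv, le_div_iff₀ (by positivity)]
  exact h2

/-- Each coefficient is a torus integral of `g w`, and `g` is holomorphic in `w`, so one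
differentiates under the integral sign. Holomorphy of the coefficients is thus a consequence of that
of `g` and need not be assumed. -/
theorem differentiableOn_coeff {n : ℕ} {R M : ℝ} (hR : 0 < R) (g : ℂ → (Fin n → ℂ) → ℂ)
    (gQ : (Fin n → ℕ) → ℂ → ℂ) {U : Set ℂ} (hU : IsOpen U)
    (hg : AnalyticOnNhd ℂ (fun p : ℂ × (Fin n → ℂ) => g p.1 p.2) (U ×ˢ Metric.closedBall 0 R))
    (hM : ∀ w ∈ U, ∀ y ∈ Metric.closedBall (0 : Fin n → ℂ) R, ‖g w y‖ ≤ M)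
    (hsum : ∀ w ∈ U, ∀ y ∈ Metric.closedBall (0 : Fin n → ℂ) R,
      HasSum (fun Q : Fin n → ℕ => gQ Q w * ∏ i, y i ^ Q i) (g w y)) (P : Fin n → ℕ) :
    DifferentiableOn ℂ (gQ P) U := by
  intro w₀ hw₀
  obtain ⟨d, hd, hball⟩ := Metric.isOpen_iff.mp hU w₀ hw₀
  set F : ℂ → (Fin n → UnitAddCircle) → ℂ := fun w x =>
    UnitAddTorus.mFourier (-fun i => (P i : ℤ)) x * g w (torusPoint R x) with hF
  have hdiff : ∀ w ∈ U, ∀ y ∈ Metric.closedBall (0 : Fin n → ℂ) R,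
      HasDerivAt (fun w => g w y)
        (fderiv ℂ (fun p : ℂ × (Fin n → ℂ) => g p.1 p.2) (w, y) (1, 0)) w := by
    intro w hw y hy
    have h1 := (hg (w, y) ⟨hw, hy⟩).differentiableAt.hasFDerivAt
    have h2 : HasDerivAt (fun w : ℂ => (w, y)) ((1 : ℂ), (0 : Fin n → ℂ)) w :=
      (hasDerivAt_id w).prodMk (hasDerivAt_const w y)
    exact h1.comp_hasDerivAt w h2
  have hcont : ∀ w ∈ U, Continuous (F w) := by
    intro w hw
    refine Continuous.mul (by fun_prop) ?_
    rw [continuous_iff_continuousAt]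
    intro x
    have h1 := (hg (w, torusPoint R x) ⟨hw, torusPoint_mem hR.le x⟩).continuousAt
    exact ContinuousAt.comp (f := fun x => (w, torusPoint R x)) h1
      (Continuous.continuousAt ((continuous_const).prodMk (continuous_torusPoint R)))
  have hcont' : Continuous (fun x => UnitAddTorus.mFourier (-fun i => (P i : ℤ)) x *
      fderiv ℂ (fun p : ℂ × (Fin n → ℂ) => g p.1 p.2) (w₀, torusPoint R x) (1, 0)) := by
    refine Continuous.mul (by fun_prop) ?_
    rw [continuous_iff_continuousAt]
    intro x
    have h1 := (hg.fderiv (w₀, torusPoint R x) ⟨hw₀, torusPoint_mem hR.le x⟩).continuousAt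
    have h2 := ContinuousAt.comp (f := fun x => (w₀, torusPoint R x)) h1
      (Continuous.continuousAt ((continuous_const).prodMk (continuous_torusPoint R)))
    exact h2.clm_apply continuousAt_const
  -- The dominating constant is Cauchy's estimate on circles of radius `d / 2` about points of the
  -- ball of radius `d / 2`; these circles stay inside `U`.
  have key := hasDerivAt_integral_of_dominated_loc_of_deriv_le (μ := torusMeasure n) (F := F)
    (x₀ := w₀) (s := Metric.ball w₀ (d / 2)) (bound := fun _ => M / (d / 2))
    (F' := fun w x => UnitAddTorus.mFourier (-fun i => (P i : ℤ)) x *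
      fderiv ℂ (fun p : ℂ × (Fin n → ℂ) => g p.1 p.2) (w, torusPoint R x) (1, 0))
    (Metric.ball_mem_nhds _ (by positivity))
    (by filter_upwards [hU.mem_nhds hw₀] with w hw
        exact (hcont w hw).aestronglyMeasurable)
    ((hcont w₀ hw₀).integrable_of_hasCompactSupport (HasCompactSupport.of_compactSpace _))
    hcont'.aestronglyMeasurable
    (.of_forall fun x w hw => ?_) (MeasureTheory.integrable_const _)
    (.of_forall fun x w hw => ?_)
  · have h2 : (fun w => ∫ x, F w x ∂(torusMeasure n)) =ᶠ[nhds w₀]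
        fun w => gQ P w * (R : ℂ) ^ (∑ i, P i) := by
      filter_upwards [hU.mem_nhds hw₀] with w hw
      exact (coeff_eq_integral hR.le (fun Q => gQ Q w) (g w) (hsum w hw) P).symm
    have h3 := (key.2.congr_of_eventuallyEq h2.symm).differentiableAt
    have hRC : (R : ℂ) ^ (∑ i, P i) ≠ 0 := pow_ne_zero _ (by exact_mod_cast hR.ne')
    have h4 := h3.mul_const (((R : ℂ) ^ (∑ i, P i))⁻¹)
    simp only [mul_inv_cancel_right₀ hRC] at h4
    exact h4.differentiableWithinAt
  · have hsub : Metric.closedBall w (d / 2) ⊆ U := fun z hz => hball (by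
      rw [Metric.mem_ball] at hw ⊢
      rw [Metric.mem_closedBall] at hz
      linarith [dist_triangle z w w₀])
    have hwU : w ∈ U := hsub (Metric.mem_closedBall_self (by positivity))
    rw [norm_mul, norm_mFourier_apply, one_mul, ← (hdiff w hwU _ (torusPoint_mem hR.le x)).deriv]
    refine Complex.norm_deriv_le_of_forall_mem_sphere_norm_le (by positivity) ?_ fun z hz =>
      hM z (hsub (Metric.sphere_subset_closedBall hz)) _ (torusPoint_mem hR.le x)
    refine DifferentiableOn.diffContOnCl fun z hz => ?_
    rw [closure_ball w (by positivity)] at hz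
    exact (hdiff z (hsub hz) _ (torusPoint_mem hR.le x)).differentiableAt.differentiableWithinAt
  · have hwU : w ∈ U := hball (Metric.ball_subset_ball (by linarith) hw)
    exact (hdiff w hwU _ (torusPoint_mem hR.le x)).const_mul _

/-! ### Cauchy's formula for rectangles and half strips -/

/-- Rotating the first quadrant by `-I` does not meet the branch cut. This gives the jump of the
logarithm at each corner of a rectangle around `0`. -/
theorem log_neg_I_mul {z : ℂ} (hr : 0 < z.re) (hi : 0 < z.im) :
    Complex.log (-Complex.I * z) = Complex.log z - π / 2 * Complex.I := by
  have hz : z ≠ 0 := fun h => by simp [h] at hr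
  have h1 : 0 ≤ z.arg := Complex.arg_nonneg_iff.mpr hi.le
  have h2 : z.arg ≤ π := Complex.arg_le_pi z
  rw [(Complex.log_mul_eq_add_log_iff (by simp) hz).mpr, Complex.log_neg_I]
  · ring
  · rw [Complex.arg_neg_I]
    constructor <;> linarith [Real.pi_pos]

theorem integral_inv_segment {p q : ℂ} {a b : ℝ} (hab : a ≤ b)
    (h : ∀ x ∈ Icc a b, 0 < (p + x * q).re) :
    ∫ x in a..b, q * (p + x * q)⁻¹ = Complex.log (p + b * q) - Complex.log (p + a * q) := by
  have hd : ∀ x ∈ uIcc a b, HasDerivAt (fun x : ℝ => Complex.log (p + x * q))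
      (q * (p + x * q)⁻¹) x := by
    intro x hx
    rw [uIcc_of_le hab] at hx
    have h1 : HasDerivAt (fun x : ℝ => p + (x : ℂ) * q) q x := by
      have := ((hasDerivAt_id x).ofReal_comp.mul_const q).const_add p
      simpa using this
    have := h1.clog_real (Or.inl (h x hx))
    rwa [div_eq_mul_inv] at this
  refine intervalIntegral.integral_eq_sub_of_hasDerivAt hd ?_
  refine ContinuousOn.intervalIntegrable fun x hx => ?_
  refine ContinuousAt.continuousWithinAt ?_
  have hne : p + x * q ≠ 0 := fun h0 => by
    rw [uIcc_of_le hab] at hx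
    have := h x hx
    simp [h0] at this
  fun_prop (disch := assumption)

/-- The integral of `1 / w` over the boundary of a rectangle around the origin. -/
theorem integral_boundary_rect_inv {a b c d : ℝ} (ha : a < 0) (hb : 0 < b) (hc : c < 0)
    (hd : 0 < d) :
    (∫ x in a..b, ((x : ℂ) + c * Complex.I)⁻¹) - (∫ x in a..b, ((x : ℂ) + d * Complex.I)⁻¹)
      + Complex.I * (∫ y in c..d, ((b : ℂ) + y * Complex.I)⁻¹)
      - Complex.I * (∫ y in c..d, ((a : ℂ) + y * Complex.I)⁻¹) = 2 * π * Complex.I := by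
  have hI : Complex.I * Complex.I = -1 := Complex.I_mul_I
  -- The factor `s` rotates a side into the right half plane, where the principal logarithm is an
  -- antiderivative. The four logarithms disagree by `π / 2 * I` at each corner, which adds up to `2
  -- * π * I`.
  have key : ∀ (s p q : ℂ) (u v : ℝ), s ≠ 0 → u ≤ v → (∀ x ∈ Icc u v, 0 < (s * (p + x * q)).re) →
      q * ∫ x in u..v, (p + x * q)⁻¹ = Complex.log (s * (p + v * q))
        - Complex.log (s * (p + u * q)) := by
    intro s p q u v hs huv h
    have := integral_inv_segment (p := s * p) (q := s * q) huv (fun x hx => by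
      have := h x hx
      convert! this using 2; ring)
    have e : ∀ x : ℝ, s * p + x * (s * q) = s * (p + x * q) := fun x => by ring
    simp only [e] at this
    rw [← this, ← intervalIntegral.integral_const_mul]
    refine intervalIntegral.integral_congr fun x _ => ?_
    rw [mul_inv]
    field_simp
  have hbot := key Complex.I (c * Complex.I) 1 a b (by simp) (by linarith) (by
    intro x _; simpa using hc)
  have htop := key (-Complex.I) (d * Complex.I) 1 a b (by simp) (by linarith) (by
    intro x _; simpa using hd)
  have hright := key 1 b Complex.I c d (by simp) (by linarith) (by
    intro x _; simpa using hb)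
  have hleft := key (-1) a Complex.I c d (by simp) (by linarith) (by
    intro x _; simpa using ha)
  have e1 : ∀ (x e : ℝ), (e : ℂ) * Complex.I + x * 1 = x + e * Complex.I := fun x e => by ring
  simp only [e1, one_mul] at hbot htop hright hleft
  rw [hbot, htop, hright, hleft]
  have c1 := log_neg_I_mul (z := b + d * Complex.I) (by simpa using hb) (by simpa using hd)
  have c2 := log_neg_I_mul (z := -Complex.I * (a + d * Complex.I)) (by simpa using hd)
    (by simpa using ha)
  have c3 := log_neg_I_mul (z := -1 * (a + c * Complex.I)) (by simpa using ha) (by simpa using hc)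
  have c4 := log_neg_I_mul (z := Complex.I * (b + c * Complex.I)) (by simpa using hc)
    (by simpa using hb)
  have e2 : -Complex.I * (-Complex.I * (a + d * Complex.I)) = -1 * (a + d * Complex.I) := by
    linear_combination (a + d * Complex.I) * hI
  have e3 : -Complex.I * (-1 * (a + c * Complex.I)) = Complex.I * (a + c * Complex.I) := by ring
  have e4 : -Complex.I * (Complex.I * (b + c * Complex.I)) = b + c * Complex.I := by
    linear_combination (-(b + c * Complex.I)) * hI
  rw [e2] at c2
  rw [e3] at c3
  rw [e4] at c4
  rw [c1, c2, c3, c4]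
  ring

/-- The Cauchy integral formula for a rectangle. -/
theorem integral_boundary_rect_div_sub {U : Set ℂ} (hU : IsOpen U) {A : ℂ → ℂ}
    (hA : DifferentiableOn ℂ A U) {a b c d : ℝ} {ζ : ℂ} (ha : a < ζ.re) (hb : ζ.re < b)
    (hc : c < ζ.im) (hd : ζ.im < d) (hsub : Icc a b ×ℂ Icc c d ⊆ U) :
    (∫ x in a..b, A (x + c * Complex.I) / (x + c * Complex.I - ζ))
      - (∫ x in a..b, A (x + d * Complex.I) / (x + d * Complex.I - ζ))
      + Complex.I * (∫ y in c..d, A (b + y * Complex.I) / (b + y * Complex.I - ζ))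
      - Complex.I * (∫ y in c..d, A (a + y * Complex.I) / (a + y * Complex.I - ζ))
      = 2 * π * Complex.I * A ζ := by
  have hab : a ≤ b := by linarith
  have hcd : c ≤ d := by linarith
  have hζU : ζ ∈ U := hsub ⟨⟨ha.le, hb.le⟩, ⟨hc.le, hd.le⟩⟩
  -- The difference quotient has a removable singularity at `ζ`, so its boundary integral vanishes;
  -- only `A ζ` times the integral of `1 / (w - ζ)` remains.
  have hds : DifferentiableOn ℂ (dslope A ζ) U :=
    (Complex.differentiableOn_dslope (hU.mem_nhds hζU)).mpr hA
  have hz := Complex.integral_boundary_rect_eq_zero_of_differentiableOn (dslope A ζ)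
    (a + c * Complex.I) (b + d * Complex.I) (hds.mono (by
      simpa [uIcc_of_le hab, uIcc_of_le hcd] using hsub))
  simp only [Complex.add_re, Complex.ofReal_re, Complex.mul_re, Complex.I_re, mul_zero,
    Complex.ofReal_im, Complex.I_im, sub_self, add_zero, Complex.add_im, Complex.mul_im,
    mul_one, zero_add, smul_eq_mul] at hz
  have hinv := integral_boundary_rect_inv (a := a - ζ.re) (b := b - ζ.re) (c := c - ζ.im)
    (d := d - ζ.im) (by linarith) (by linarith) (by linarith) (by linarith)
  have hpt : ∀ w, w ≠ ζ → A w / (w - ζ) = dslope A ζ w + A ζ * (w - ζ)⁻¹ := by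
    intro w hw
    have : w - ζ ≠ 0 := sub_ne_zero.mpr hw
    rw [dslope_of_ne _ hw, slope_def_field]
    field_simp
    ring
  have split : ∀ (p q : ℂ) (u v : ℝ), u ≤ v → (∀ x ∈ Icc u v, p + x * q ≠ ζ) →
      (∀ x ∈ Icc u v, p + x * q ∈ U) →
      ∫ x in u..v, A (p + x * q) / (p + x * q - ζ)
        = (∫ x in u..v, dslope A ζ (p + x * q)) + A ζ * ∫ x in u..v, (p + x * q - ζ)⁻¹ := by
    intro p q u v huv hne hmem
    rw [← intervalIntegral.integral_const_mul, ← intervalIntegral.integral_add]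
    · refine intervalIntegral.integral_congr fun x hx => ?_
      rw [uIcc_of_le huv] at hx
      exact hpt _ (hne x hx)
    · refine ContinuousOn.intervalIntegrable ?_
      rw [uIcc_of_le huv]
      exact hds.continuousOn.comp (by fun_prop) hmem
    · refine ContinuousOn.intervalIntegrable ?_
      rw [uIcc_of_le huv]
      refine continuousOn_const.mul (ContinuousOn.inv₀ (by fun_prop) fun x hx => ?_)
      exact sub_ne_zero.mpr (hne x hx)
  have shift : ∀ (p q : ℂ) (u v s : ℝ),
      ∫ x in u..v, (p + x * q - ζ)⁻¹ = ∫ x in (u - s)..(v - s), (p + s * q - ζ + x * q)⁻¹ := by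
    intro p q u v s
    have := intervalIntegral.integral_comp_sub_right (a := u) (b := v)
      (fun x : ℝ => (p + s * q - ζ + x * q)⁻¹) s
    rw [← this]
    refine intervalIntegral.integral_congr fun x _ => ?_
    congr 1
    push_cast
    ring
  have hζ : ζ = ζ.re + ζ.im * Complex.I := (Complex.re_add_im ζ).symm
  have bot := split (c * Complex.I) 1 a b hab (fun x _ h => by
      have := congrArg Complex.im h; simp at this; linarith) (fun x hx => hsub (by
      simpa [Complex.mem_reProdIm, hcd] using hx))
  have top := split (d * Complex.I) 1 a b hab (fun x _ h => by
      have := congrArg Complex.im h; simp at this; linarith) (fun x hx => hsub (by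
      simpa [Complex.mem_reProdIm, hcd] using hx))
  have right := split b Complex.I c d hcd (fun x _ h => by
      have := congrArg Complex.re h; simp at this; linarith) (fun x hx => hsub (by
      simpa [Complex.mem_reProdIm, hab] using hx))
  have left := split a Complex.I c d hcd (fun x _ h => by
      have := congrArg Complex.re h; simp at this; linarith) (fun x hx => hsub (by
      simpa [Complex.mem_reProdIm, hab] using hx))
  rw [shift _ _ _ _ ζ.re] at bot top
  rw [shift _ _ _ _ ζ.im] at left right
  have e1 : ∀ (x e : ℝ), (e : ℂ) * Complex.I + x * 1 = x + e * Complex.I := fun x e => by ring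
  have e2 : ∀ (x e : ℝ), (ζ.re : ℂ) + e * Complex.I - ζ + x * 1
      = x + (e - ζ.im : ℝ) * Complex.I := fun x e => by
    push_cast
    linear_combination -hζ
  have e3 : ∀ (x e : ℝ), (e : ℂ) + ζ.im * Complex.I - ζ + x * Complex.I
      = (e - ζ.re : ℝ) + x * Complex.I := fun x e => by
    push_cast
    linear_combination -hζ
  simp only [e1, e2, e3] at bot top left right
  rw [bot, top, left, right]
  linear_combination hz + A ζ * hinv

/-- The Cauchy integral formula for the half strip `w.re ≤ X`, `|w.im| ≤ a`. -/
theorem integral_boundary_halfstrip_div_sub {U : Set ℂ} (hU : IsOpen U) {A : ℂ → ℂ}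
    (hA : DifferentiableOn ℂ A U) {a X C X₁ : ℝ} {ζ : ℂ} (hX : ζ.re < X) (ha : |ζ.im| < a)
    (hsub : Iic X ×ℂ Icc (-a) a ⊆ U)
    (hdecay : ∀ w : ℂ, w.re ≤ X₁ → |w.im| ≤ a → ‖A w / (w - ζ)‖ ≤ C * Real.exp w.re)
    (hint₁ : MeasureTheory.IntegrableOn (fun x : ℝ => A (x + (a : ℝ) * Complex.I)
      / (x + (a : ℝ) * Complex.I - ζ)) (Iic X))
    (hint₂ : MeasureTheory.IntegrableOn (fun x : ℝ => A (x + (-a : ℝ) * Complex.I)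
      / (x + (-a : ℝ) * Complex.I - ζ)) (Iic X)) :
    (∫ x in Iic X, A (x + (a : ℝ) * Complex.I) / (x + (a : ℝ) * Complex.I - ζ))
      + (∫ θ in a..(-a), A (X + θ * Complex.I) / (X + θ * Complex.I - ζ) * Complex.I)
      - (∫ x in Iic X, A (x + (-a : ℝ) * Complex.I) / (x + (-a : ℝ) * Complex.I - ζ))
      = -(2 * π * Complex.I * A ζ) := by
  have ha0 : 0 < a := (abs_nonneg _).trans_lt ha
  rw [abs_lt] at ha
  have hvert : Filter.Tendsto (fun T : ℝ => ∫ y in (-a)..a, A (T + y * Complex.I)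
      / (T + y * Complex.I - ζ)) Filter.atBot (nhds 0) := by
    have h0 : Filter.Tendsto (fun T : ℝ => C * Real.exp T * |a - -a|) Filter.atBot (nhds 0) := by
      simpa using (Real.tendsto_exp_atBot.const_mul C).mul_const |a - -a|
    refine squeeze_zero_norm' ?_ h0
    filter_upwards [Filter.eventually_le_atBot X₁] with T hT
    refine intervalIntegral.norm_integral_le_of_norm_le_const fun y hy => ?_
    rw [uIoc_of_le (by linarith)] at hy
    have := hdecay (T + y * Complex.I) (by simpa using hT) (by
      simpa [abs_le] using ⟨hy.1.le, hy.2⟩)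
    simpa using this
  have l1 := MeasureTheory.intervalIntegral_tendsto_integral_Iic X hint₁ Filter.tendsto_id
  have l2 := MeasureTheory.intervalIntegral_tendsto_integral_Iic X hint₂ Filter.tendsto_id
  have hlim := ((l2.sub l1).add_const (Complex.I * ∫ y in (-a)..a, A (X + y * Complex.I)
      / (X + y * Complex.I - ζ))).sub (hvert.const_mul Complex.I)
  -- Rectangles with left side at `T → -∞` exhaust the half strip, and their boundary integrals do
  -- not depend on `T`.
  have h := tendsto_nhds_unique (hlim.congr' (f₂ := fun _ => 2 * π * Complex.I * A ζ) (by
    filter_upwards [Filter.eventually_lt_atBot ζ.re] with T hT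
    exact integral_boundary_rect_div_sub hU hA (a := T) (b := X) (c := -a) (d := a) hT hX
      ha.1 ha.2 fun w hw => hsub ⟨hw.1.2, hw.2⟩)) tendsto_const_nhds
  rw [intervalIntegral.integral_symm, intervalIntegral.integral_mul_const]
  linear_combination -h

/-! ### Inversion of the Borel integral along an abstract Hankel path -/

/-- Antiderivative in `s` of `exp (-s u) ∫ W exp (s V)`. -/
noncomputable def laplaceKernelIntegral (V W : ℝ → ℂ) (u : ℂ) (s : ℝ) : ℂ :=
  ∫ y, W y * Complex.exp (s * (V y - u)) / (V y - u)

/-- Bounds for a path `V` that goes to infinity in the left half plane, with weight `W`. -/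
structure IsHankelPath (V W : ℝ → ℂ) (b c M : ℝ) : Prop where
  measurable_path : MeasureTheory.AEStronglyMeasurable V
  measurable_weight : MeasureTheory.AEStronglyMeasurable W
  integrable_inv : MeasureTheory.Integrable fun y => ‖V y‖⁻¹
  ne_zero : ∀ y, V y ≠ 0
  b_nonneg : 0 ≤ b
  c_pos : 0 < c
  re_le : ∀ y, (V y).re ≤ b - c * ‖V y‖
  norm_weight_le : ∀ y, ‖W y‖ ≤ M * ‖V y‖

namespace IsHankelPath

variable {V W : ℝ → ℂ} {b c M : ℝ}

theorem bound_nonneg (h : IsHankelPath V W b c M) : 0 ≤ M := by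
  have h1 := (norm_nonneg _).trans (h.norm_weight_le 0)
  have h2 := norm_pos_iff.mpr (h.ne_zero 0)
  exact nonneg_of_mul_nonneg_left h1 h2

theorem norm_exp_le (h : IsHankelPath V W b c M) {s : ℝ} (hs : 0 ≤ s) (u : ℂ) (y : ℝ) :
    ‖Complex.exp (s * (V y - u))‖ ≤
      Real.exp (s * b) * Real.exp (-(s * u.re)) * Real.exp (-(s * c * ‖V y‖)) := by
  rw [Complex.norm_exp, ← Real.exp_add, ← Real.exp_add]
  gcongr
  simp only [Complex.mul_re, Complex.ofReal_re, Complex.ofReal_im, zero_mul, sub_zero,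
    Complex.sub_re]
  nlinarith [mul_le_mul_of_nonneg_left (h.re_le y) hs]

theorem sq_mul_exp_neg_le {x : ℝ} (hx : 0 ≤ x) : x ^ 2 * Real.exp (-x) ≤ 2 := by
  rw [Real.exp_neg, ← div_eq_mul_inv, div_le_iff₀ (Real.exp_pos _)]
  linarith [Real.quadratic_le_exp_of_nonneg hx]

/-- The weight may grow like `V`, whereas only `‖V‖⁻¹` is integrable, so the exponential must pay
for two powers of `‖V‖`. The price `s⁻²` becomes the factor `(2 / δ) ^ (2 * k)` in the final bounds.
-/
theorem norm_weight_mul_exp_le (h : IsHankelPath V W b c M) {s : ℝ} (hs : 0 < s) (y : ℝ) :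
    ‖W y‖ * Real.exp (-(s * c * ‖V y‖)) ≤ M * (2 / (s * c) ^ 2) * ‖V y‖⁻¹ := by
  have hV := norm_pos_iff.mpr (h.ne_zero y)
  have hc := h.c_pos
  have h1 := sq_mul_exp_neg_le (x := s * c * ‖V y‖) (by positivity)
  have h2 : ‖V y‖ * Real.exp (-(s * c * ‖V y‖)) ≤ (2 / (s * c) ^ 2) * ‖V y‖⁻¹ := by
    rw [← div_eq_mul_inv, div_div, le_div_iff₀ (by positivity)]
    calc _ = (s * c * ‖V y‖) ^ 2 * Real.exp (-(s * c * ‖V y‖)) := by ring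
      _ ≤ 2 := h1
  calc _ ≤ M * ‖V y‖ * Real.exp (-(s * c * ‖V y‖)) := by
        gcongr; exact h.norm_weight_le y
    _ = M * (‖V y‖ * Real.exp (-(s * c * ‖V y‖))) := by ring
    _ ≤ M * ((2 / (s * c) ^ 2) * ‖V y‖⁻¹) := mul_le_mul_of_nonneg_left h2 h.bound_nonneg
    _ = _ := by ring

theorem norm_integrand_le (h : IsHankelPath V W b c M) {s : ℝ} (hs : 0 < s) (u : ℂ) (y : ℝ) :
    ‖W y * Complex.exp (s * (V y - u))‖ ≤
      Real.exp (s * b) * Real.exp (-(s * u.re)) * (M * (2 / (s * c) ^ 2)) * ‖V y‖⁻¹ := by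
  rw [norm_mul]
  calc _ ≤ ‖W y‖ * (Real.exp (s * b) * Real.exp (-(s * u.re)) * Real.exp (-(s * c * ‖V y‖))) := by
        gcongr; exact h.norm_exp_le hs.le u y
    _ = Real.exp (s * b) * Real.exp (-(s * u.re)) * (‖W y‖ * Real.exp (-(s * c * ‖V y‖))) := by
        ring
    _ ≤ Real.exp (s * b) * Real.exp (-(s * u.re)) * (M * (2 / (s * c) ^ 2) * ‖V y‖⁻¹) := by
        exact mul_le_mul_of_nonneg_left (h.norm_weight_mul_exp_le hs y) (by positivity)
    _ = _ := by ring

theorem aestronglyMeasurable_exp (h : IsHankelPath V W b c M) (s : ℝ) (u : ℂ) :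
    MeasureTheory.AEStronglyMeasurable (fun y => W y * Complex.exp (s * (V y - u))) := by
  have h1 : Continuous fun v : ℂ => Complex.exp (s * (v - u)) := by fun_prop
  exact h.measurable_weight.mul (h1.comp_aestronglyMeasurable h.measurable_path)

theorem aestronglyMeasurable_exp_div (h : IsHankelPath V W b c M) (s : ℝ) (u : ℂ) :
    MeasureTheory.AEStronglyMeasurable
      (fun y => W y * Complex.exp (s * (V y - u)) / (V y - u)) := by
  simp only [div_eq_mul_inv]
  exact (h.aestronglyMeasurable_exp s u).mul
    (h.measurable_path.sub
      MeasureTheory.aestronglyMeasurable_const).aemeasurable.inv.aestronglyMeasurable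

theorem norm_kernel_le (h : IsHankelPath V W b c M) {s κ : ℝ} (hs : 0 < s) {u : ℂ} (hκ : 0 < κ)
    (hu : ∀ y, κ ≤ ‖V y - u‖) (y : ℝ) :
    ‖W y * Complex.exp (s * (V y - u)) / (V y - u)‖ ≤
      κ⁻¹ * (Real.exp (s * b) * Real.exp (-(s * u.re)) * (M * (2 / (s * c) ^ 2))) * ‖V y‖⁻¹ := by
  rw [norm_div, div_eq_inv_mul, mul_assoc κ⁻¹]
  gcongr
  · exact hu y
  · exact h.norm_integrand_le hs u y

theorem integrable_kernel (h : IsHankelPath V W b c M) {s κ : ℝ} (hs : 0 < s) {u : ℂ}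
    (hκ : 0 < κ) (hu : ∀ y, κ ≤ ‖V y - u‖) :
    MeasureTheory.Integrable fun y => W y * Complex.exp (s * (V y - u)) / (V y - u) :=
  (h.integrable_inv.const_mul _).mono' (h.aestronglyMeasurable_exp_div s u)
    (.of_forall (h.norm_kernel_le hs hκ hu))

theorem norm_laplaceKernelIntegral_le (h : IsHankelPath V W b c M) {s κ : ℝ} (hs : 0 < s) {u : ℂ}
    (hκ : 0 < κ) (hu : ∀ y, κ ≤ ‖V y - u‖) :
    ‖laplaceKernelIntegral V W u s‖ ≤
      κ⁻¹ * (Real.exp (s * b) * Real.exp (-(s * u.re)) * (M * (2 / (s * c) ^ 2)))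
        * ∫ y, ‖V y‖⁻¹ := by
  rw [← MeasureTheory.integral_const_mul]
  exact MeasureTheory.norm_integral_le_of_norm_le (h.integrable_inv.const_mul _)
    (.of_forall (h.norm_kernel_le hs hκ hu))

/-- Differentiation in `s` cancels the denominator `V - u`, after which `exp (-s u)` leaves the
integral. -/
theorem hasDerivAt_laplaceKernelIntegral (h : IsHankelPath V W b c M) {s κ : ℝ} (hs : 0 < s)
    {u : ℂ} (hκ : 0 < κ) (hu : ∀ y, κ ≤ ‖V y - u‖) :
    HasDerivAt (laplaceKernelIntegral V W u)
      (Complex.exp (-(s * u)) * ∫ y, W y * Complex.exp (s * V y)) s := by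
  have hne : ∀ y, V y - u ≠ 0 := fun y => norm_pos_iff.mp (hκ.trans_le (hu y))
  have hM := h.bound_nonneg
  have hc := h.c_pos
  have hb := h.b_nonneg
  have key := hasDerivAt_integral_of_dominated_loc_of_deriv_le
    (𝕜 := ℝ) (μ := MeasureTheory.volume) (x₀ := s) (s := Metric.ball s (s / 2))
    (F := fun (s : ℝ) y => W y * Complex.exp (s * (V y - u)) / (V y - u))
    (F' := fun (s : ℝ) y => W y * Complex.exp (s * (V y - u)))
    -- On the ball of radius `s / 2` the parameter lies between `s / 2` and `2 * s`: the upper bound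
    -- serves the exponentials, the lower one the denominator.
    (bound := fun y => Real.exp (2 * s * b) * Real.exp (2 * s * ‖u‖) *
      (M * (2 / (s / 2 * c) ^ 2)) * ‖V y‖⁻¹)
    (Metric.ball_mem_nhds _ (by positivity))
    (.of_forall fun s => h.aestronglyMeasurable_exp_div s u)
    (h.integrable_kernel hs hκ hu) (h.aestronglyMeasurable_exp s u)
    (.of_forall fun y x hx => ?_) (h.integrable_inv.const_mul _) (.of_forall fun y x hx => ?_)
  · convert! key.2 using 1
    rw [← MeasureTheory.integral_const_mul]
    congr 1
    ext y
    rw [mul_left_comm, ← Complex.exp_add]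
    ring_nf
  · rw [Metric.mem_ball, Real.dist_eq, abs_lt] at hx
    have hx0 : 0 < x := by linarith
    refine (h.norm_integrand_le hx0 u y).trans ?_
    have h1 : -(x * u.re) ≤ 2 * s * ‖u‖ := by
      have := (abs_le.mp (Complex.abs_re_le_norm u)).1
      nlinarith [norm_nonneg u]
    gcongr
    · linarith
    · linarith
  · have h1 : HasDerivAt (fun x : ℝ => Complex.exp (x * (V y - u)))
        (Complex.exp (x * (V y - u)) * (V y - u)) x := by
      have := ((hasDerivAt_id x).ofReal_comp.mul_const (V y - u)).cexp
      simpa using this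
    have h2 := (h1.const_mul (W y)).div_const (V y - u)
    convert! h2 using 1
    have := hne y
    field_simp

theorem laplaceKernelIntegral_sub (h : IsHankelPath V W b c M) {s₀ s₁ κ : ℝ} (hs : 0 < s₀)
    (hs₁ : s₀ ≤ s₁) {u : ℂ} (hκ : 0 < κ) (hu : ∀ y, κ ≤ ‖V y - u‖) {H : ℝ → ℂ}
    (hH : ContinuousOn H (Icc s₀ s₁))
    (hφ : ∀ s ∈ Icc s₀ s₁, ∫ y, W y * Complex.exp (s * V y) = H s) :
    laplaceKernelIntegral V W u s₁ - laplaceKernelIntegral V W u s₀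
      = ∫ s in s₀..s₁, Complex.exp (-(s * u)) * H s := by
  symm
  refine intervalIntegral.integral_eq_sub_of_hasDerivAt (fun s hs => ?_) ?_
  · rw [uIcc_of_le hs₁] at hs
    rw [← hφ s hs]
    exact h.hasDerivAt_laplaceKernelIntegral (by linarith [hs.1]) hκ hu
  · refine ContinuousOn.intervalIntegrable ?_
    rw [uIcc_of_le hs₁]
    exact ContinuousOn.mul (by fun_prop) hH

theorem aestronglyMeasurable_difference_kernel (h : IsHankelPath V W b c M) (u : ℂ) :
    MeasureTheory.AEStronglyMeasurable (fun y => -(W y * u / (V y * (V y - u)))) := by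
  simp only [div_eq_mul_inv]
  exact ((h.measurable_weight.mul_const u).mul (h.measurable_path.mul
    (h.measurable_path.sub
      MeasureTheory.aestronglyMeasurable_const)).aemeasurable.inv.aestronglyMeasurable).neg

/-- The kernel is `W (1/V - 1/(V - u))`. Subtracting the kernel with `u = 0` gains one power of `V`,
which is what integrability without an exponential factor requires. -/
theorem norm_difference_kernel_le (h : IsHankelPath V W b c M) {κ : ℝ} {u : ℂ} (hκ : 0 < κ)
    (hu : ∀ y, κ ≤ ‖V y - u‖) (y : ℝ) :
    ‖-(W y * u / (V y * (V y - u)))‖ ≤ M * ‖u‖ * (1 + ‖u‖ / κ) * ‖V y‖⁻¹ := by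
  have hV : 0 < ‖V y‖ := norm_pos_iff.mpr (h.ne_zero y)
  have hVu : 0 < ‖V y - u‖ := hκ.trans_le (hu y)
  have hM := h.bound_nonneg
  have e2 : ‖V y‖ ≤ (1 + ‖u‖ / κ) * ‖V y - u‖ := by
    have h1 : ‖V y‖ ≤ ‖V y - u‖ + ‖u‖ := by simpa using norm_add_le (V y - u) u
    have h2 : ‖u‖ ≤ ‖u‖ / κ * ‖V y - u‖ := by
      rw [div_mul_eq_mul_div, le_div_iff₀ hκ]
      exact mul_le_mul_of_nonneg_left (hu y) (norm_nonneg _)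
    linarith
  rw [norm_neg, norm_div, norm_mul, norm_mul, ← div_eq_mul_inv, div_le_div_iff₀
    (by positivity) hV]
  calc ‖W y‖ * ‖u‖ * ‖V y‖ ≤ (M * ‖V y‖) * ‖u‖ * ((1 + ‖u‖ / κ) * ‖V y - u‖) := by
        gcongr; exact h.norm_weight_le y
    _ = _ := by ring

theorem integrable_difference_kernel (h : IsHankelPath V W b c M) {κ : ℝ} {u : ℂ} (hκ : 0 < κ)
    (hu : ∀ y, κ ≤ ‖V y - u‖) :
    MeasureTheory.Integrable fun y => -(W y * u / (V y * (V y - u))) :=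
  (h.integrable_inv.const_mul _).mono' (h.aestronglyMeasurable_difference_kernel u)
    (.of_forall (h.norm_difference_kernel_le hκ hu))

/-- Neither term need converge by itself as `s → 0`. The factor `exp (-(s * u))` gives both the same
exponential, so that they combine into the integrable difference kernel and dominated convergence
applies. -/
theorem tendsto_laplaceKernelIntegral (h : IsHankelPath V W b c M) {κ v₀ : ℝ}
    {u : ℂ} (hκ : 0 < κ) (hu : ∀ y, κ ≤ ‖V y - u‖) (hv₀ : 0 < v₀) (hv : ∀ y, v₀ ≤ ‖V y‖) :
    Filter.Tendsto (fun s : ℝ => Complex.exp (-(s * u)) * laplaceKernelIntegral V W 0 s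
      - laplaceKernelIntegral V W u s) (nhdsWithin 0 (Ioi 0))
      (nhds (∫ y, -(W y * u / (V y * (V y - u))))) := by
  have hne : ∀ y, V y - u ≠ 0 := fun y => norm_pos_iff.mp (hκ.trans_le (hu y))
  have hM := h.bound_nonneg
  have hb := h.b_nonneg
  have hv' : ∀ y, v₀ ≤ ‖V y - 0‖ := by simpa using hv
  have heq : ∀ s : ℝ, 0 < s → Complex.exp (-(s * u)) * laplaceKernelIntegral V W 0 s
      - laplaceKernelIntegral V W u s
      = ∫ y, -(W y * u / (V y * (V y - u))) * Complex.exp (s * (V y - u)) := by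
    intro s hs
    unfold laplaceKernelIntegral
    rw [← MeasureTheory.integral_const_mul, ← MeasureTheory.integral_sub
      ((h.integrable_kernel hs hv₀ hv').const_mul _) (h.integrable_kernel hs hκ hu)]
    congr 1
    ext y
    have h1 := hne y
    have h2 := h.ne_zero y
    have h3 : Complex.exp (s * (V y - u)) = Complex.exp (-(s * u)) * Complex.exp (s * V y) := by
      rw [← Complex.exp_add]; ring_nf
    rw [h3]
    simp only [sub_zero]
    field_simp
    ring
  have hmeas := h.aestronglyMeasurable_difference_kernel u
  have hlim := MeasureTheory.tendsto_integral_filter_of_dominated_convergence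
    (μ := MeasureTheory.volume) (l := nhdsWithin (0 : ℝ) (Ioi 0))
    (F := fun (s : ℝ) y => -(W y * u / (V y * (V y - u))) * Complex.exp (s * (V y - u)))
    (f := fun y => -(W y * u / (V y * (V y - u))))
    (fun y => M * ‖u‖ * (1 + ‖u‖ / κ) * Real.exp (b + ‖u‖) * ‖V y‖⁻¹) ?_ ?_
    (h.integrable_inv.const_mul _) ?_
  · refine hlim.congr' ?_
    filter_upwards [self_mem_nhdsWithin] with s hs
    exact (heq s hs).symm
  · refine .of_forall fun s => hmeas.mul ?_
    have h1 : Continuous fun v : ℂ => Complex.exp (s * (v - u)) := by fun_prop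
    exact h1.comp_aestronglyMeasurable h.measurable_path
  · have h01 : Ioo (0 : ℝ) 1 ∈ nhdsWithin (0 : ℝ) (Ioi 0) := Ioo_mem_nhdsGT one_pos
    filter_upwards [h01] with s hs
    refine .of_forall fun y => ?_
    have hV : 0 < ‖V y‖ := norm_pos_iff.mpr (h.ne_zero y)
    have hVu : 0 < ‖V y - u‖ := norm_pos_iff.mpr (hne y)
    have e1 : ‖Complex.exp (s * (V y - u))‖ ≤ Real.exp (b + ‖u‖) := by
      rw [Complex.norm_exp]
      gcongr
      simp only [Complex.mul_re, Complex.ofReal_re, Complex.ofReal_im, zero_mul, sub_zero,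
        Complex.sub_re]
      have h1 := h.re_le y
      have h2 := (abs_le.mp (Complex.abs_re_le_norm u)).1
      have h3 : 0 < c * ‖V y‖ := mul_pos h.c_pos hV
      nlinarith [norm_nonneg u, hs.1, hs.2]
    have e3 := h.norm_difference_kernel_le hκ hu y
    rw [norm_mul]
    calc _ ≤ (M * ‖u‖ * (1 + ‖u‖ / κ) * ‖V y‖⁻¹) * Real.exp (b + ‖u‖) := by gcongr
      _ = _ := by ring
  · refine .of_forall fun y => ?_
    have hc : Continuous fun s : ℝ => -(W y * u / (V y * (V y - u)))
      * Complex.exp (s * (V y - u)) := by fun_prop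
    have := hc.tendsto 0
    simp only [Complex.ofReal_zero, zero_mul, Complex.exp_zero, mul_one] at this
    exact this.mono_left nhdsWithin_le_nhds

/-- Inversion of the transform `s ↦ ∫ W exp (s V)` by a truncated Laplace integral. -/
theorem eq_truncated_laplace (h : IsHankelPath V W b c M) {κ v₀ s₀ : ℝ} (hs₀ : 0 < s₀)
    {u : ℂ} (hκ : 0 < κ) (hu : ∀ y, κ ≤ ‖V y - u‖) (hv₀ : 0 < v₀) (hv : ∀ y, v₀ ≤ ‖V y‖)
    {H : ℝ → ℂ} (hH : ContinuousOn H (Icc 0 s₀))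
    (hφ : ∀ s ∈ Ioc 0 s₀, ∫ y, W y * Complex.exp (s * V y) = H s) :
    ∫ y, -(W y * u / (V y * (V y - u)))
      = (laplaceKernelIntegral V W 0 s₀ - ∫ s in (0 : ℝ)..s₀, H s)
        + (∫ s in (0 : ℝ)..s₀, Complex.exp (-(s * u)) * H s) - laplaceKernelIntegral V W u s₀ := by
  have hv' : ∀ y, v₀ ≤ ‖V y - 0‖ := by simpa using hv
  have hcont : ∀ F : ℝ → ℂ, ContinuousOn F (Icc 0 s₀) →
      Filter.Tendsto (fun s => ∫ σ in s..s₀, F σ) (nhdsWithin 0 (Ioi 0))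
        (nhds (∫ σ in (0 : ℝ)..s₀, F σ)) := by
    intro F hF
    have hi : IntervalIntegrable F MeasureTheory.volume 0 s₀ :=
      ContinuousOn.intervalIntegrable (by rwa [uIcc_of_le hs₀.le])
    have h1 : ContinuousOn (fun s => ∫ σ in s..s₀, F σ) (uIcc 0 s₀) :=
      intervalIntegral.continuousOn_primitive_interval_left (by
        rw [uIcc_of_le hs₀.le]; exact hF.integrableOn_Icc)
    rw [uIcc_of_le hs₀.le] at h1
    have h2 := h1 0 (left_mem_Icc.mpr hs₀.le)
    exact h2.mono_left (nhdsWithin_le_of_mem (Icc_mem_nhdsGT hs₀))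
  have hL := h.tendsto_laplaceKernelIntegral hκ hu hv₀ hv
  have hu' : ContinuousOn (fun s : ℝ => Complex.exp (-(s * u)) * H s) (Icc 0 s₀) :=
    ContinuousOn.mul (by fun_prop) hH
  have he : Filter.Tendsto (fun s : ℝ => Complex.exp (-(s * u))) (nhdsWithin 0 (Ioi 0))
      (nhds 1) := by
    have hc : Continuous fun s : ℝ => Complex.exp (-(s * u)) := by fun_prop
    have := hc.tendsto 0
    simp only [Complex.ofReal_zero, zero_mul, neg_zero, Complex.exp_zero] at this
    exact this.mono_left nhdsWithin_le_nhds
  have hR := ((he.mul ((hcont H hH).const_sub (laplaceKernelIntegral V W 0 s₀))).add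
    (hcont _ hu')).sub_const (laplaceKernelIntegral V W u s₀)
  rw [one_mul] at hR
  refine tendsto_nhds_unique (hL.congr' ?_) hR
  filter_upwards [Ioo_mem_nhdsGT hs₀] with s hs
  have hsub : Icc s s₀ ⊆ Icc 0 s₀ := Icc_subset_Icc_left hs.1.le
  have hφ' : ∀ σ ∈ Icc s s₀, ∫ y, W y * Complex.exp (σ * V y) = H σ := fun σ hσ =>
    hφ σ ⟨hs.1.trans_le hσ.1, hσ.2⟩
  have a1 := h.laplaceKernelIntegral_sub hs.1 hs.2.le hκ hu (hH.mono hsub) hφ'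
  have a2 := h.laplaceKernelIntegral_sub hs.1 hs.2.le hv₀ hv' (hH.mono hsub) hφ'
  simp only [mul_zero, neg_zero, Complex.exp_zero, one_mul] at a2
  -- Both primitives at `s` are expressed through their values at `s₀`; the limit `s → 0` of this
  -- identity is the claim.
  linear_combination a1 - Complex.exp (-(s * u)) * a2

end IsHankelPath

/-! ### The Borel path as a Hankel path -/

/-- The boundary of the half strip `w.re ≤ X`, `|w.im| ≤ a`, run through counterclockwise with
unit speed. -/
noncomputable def halfStripPath (a X y : ℝ) : ℂ :=
  ((X - max (|y| - a) 0 : ℝ) : ℂ) + ((max (-a) (min a y) : ℝ) : ℂ) * Complex.I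

/-- The velocity of `halfStripPath`. -/
noncomputable def halfStripVelocity (a y : ℝ) : ℂ :=
  if y ≤ -a then 1 else if y ≤ a then Complex.I else -1

theorem continuous_halfStripPath (a X : ℝ) : Continuous (halfStripPath a X) := by
  unfold halfStripPath
  fun_prop

theorem measurable_halfStripVelocity (a : ℝ) : Measurable (halfStripVelocity a) := by
  unfold halfStripVelocity
  exact Measurable.ite measurableSet_Iic measurable_const
    (Measurable.ite measurableSet_Iic measurable_const measurable_const)

theorem norm_halfStripVelocity (a y : ℝ) : ‖halfStripVelocity a y‖ = 1 := by
  unfold halfStripVelocity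
  split_ifs <;> simp

theorem halfStripPath_re (a X y : ℝ) : (halfStripPath a X y).re = X - max (|y| - a) 0 := by
  simp [halfStripPath]

theorem halfStripPath_im (a X y : ℝ) : (halfStripPath a X y).im = max (-a) (min a y) := by
  simp [halfStripPath]

theorem halfStripPath_of_le {a X y : ℝ} (ha : 0 < a) (hy : y ≤ -a) :
    halfStripPath a X y = ((X + a + y : ℝ) : ℂ) + ((-a : ℝ) : ℂ) * Complex.I := by
  unfold halfStripPath
  rw [abs_of_nonpos (by linarith), max_eq_left (by linarith), min_eq_right (by linarith),
    max_eq_left hy]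
  congr 2
  ring

theorem halfStripPath_of_mem {a X y : ℝ} (hy : y ∈ Icc (-a) a) :
    halfStripPath a X y = (X : ℂ) + (y : ℂ) * Complex.I := by
  unfold halfStripPath
  rw [max_eq_right (by linarith [abs_le.mpr hy]), min_eq_right hy.2, max_eq_right hy.1]
  simp

theorem halfStripPath_of_ge {a X y : ℝ} (ha : 0 < a) (hy : a ≤ y) :
    halfStripPath a X y = ((X + a - y : ℝ) : ℂ) + (a : ℂ) * Complex.I := by
  unfold halfStripPath
  rw [abs_of_nonneg (by linarith), max_eq_left (by linarith), min_eq_left hy,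
    max_eq_right (by linarith)]
  congr 2
  ring

section PathIntegral

open MeasureTheory

/-- The parameter line is cut at `-a` and `a`; a translation and a reflection carry the outer pieces
to the two rays. The minus sign appears because the Borel path runs against `halfStripPath`. -/
theorem integral_halfStrip {a X : ℝ} (ha : 0 < a) {q : ℂ → ℂ}
    (hq : Integrable fun y => q (halfStripPath a X y) * halfStripVelocity a y) :
    IntegrableOn (fun x : ℝ => q (x + (a : ℝ) * Complex.I)) (Iic X) ∧
    IntegrableOn (fun x : ℝ => q (x + (-a : ℝ) * Complex.I)) (Iic X) ∧
    (∫ x in Iic X, q (x + (a : ℝ) * Complex.I))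
      + (∫ θ in a..(-a), q (X + θ * Complex.I) * Complex.I)
      - (∫ x in Iic X, q (x + (-a : ℝ) * Complex.I))
      = -∫ y, q (halfStripPath a X y) * halfStripVelocity a y := by
  have e1 : ∀ y ∈ Iic (-a), q (halfStripPath a X y) * halfStripVelocity a y
      = q ((y + (X + a) : ℝ) + (-a : ℝ) * Complex.I) := fun y hy => by
    rw [halfStripPath_of_le ha hy, halfStripVelocity, if_pos (mem_Iic.mp hy), mul_one,
      add_comm y]
  have e2 : ∀ y ∈ Ioc (-a) a, q (halfStripPath a X y) * halfStripVelocity a y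
      = q (X + y * Complex.I) * Complex.I := fun y hy => by
    rw [halfStripPath_of_mem ⟨hy.1.le, hy.2⟩, halfStripVelocity, if_neg (not_le.mpr hy.1),
      if_pos hy.2]
  have e3 : ∀ y ∈ Ioi a, q (halfStripPath a X y) * halfStripVelocity a y
      = -q ((X + a - y : ℝ) + (a : ℝ) * Complex.I) := fun y hy => by
    rw [halfStripPath_of_ge ha (le_of_lt hy), halfStripVelocity,
      if_neg (not_le.mpr (by linarith [mem_Ioi.mp hy])), if_neg (not_le.mpr hy)]
    ring
  have m1 := measurePreserving_add_right volume (X + a)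
  have b1 : MeasurableEmbedding fun y : ℝ => y + (X + a) := measurableEmbedding_addRight _
  have p1 : (fun y : ℝ => y + (X + a)) ⁻¹' Iic X = Iic (-a) := by
    ext y; simp only [mem_preimage, mem_Iic]; constructor <;> intro h <;> linarith
  have m3 := Measure.measurePreserving_sub_left volume (X + a)
  have b3 : MeasurableEmbedding fun y : ℝ => X + a - y :=
    (Homeomorph.subLeft (X + a)).measurableEmbedding
  have p3 : (fun y : ℝ => X + a - y) ⁻¹' Iic X = Ici a := by
    ext y; simp only [mem_preimage, mem_Iic, mem_Ici]; constructor <;> intro h <;> linarith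
  have i1 : ∫ y in Iic (-a), q (halfStripPath a X y) * halfStripVelocity a y
      = ∫ x in Iic X, q (x + (-a : ℝ) * Complex.I) := by
    rw [setIntegral_congr_fun measurableSet_Iic e1, ← p1]
    exact m1.setIntegral_preimage_emb b1 (fun x : ℝ => q (x + (-a : ℝ) * Complex.I)) _
  have i3 : ∫ y in Ioi a, q (halfStripPath a X y) * halfStripVelocity a y
      = -∫ x in Iic X, q (x + (a : ℝ) * Complex.I) := by
    rw [setIntegral_congr_fun measurableSet_Ioi e3, integral_neg, ← integral_Ici_eq_integral_Ioi,
      ← p3]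
    congr 1
    exact m3.setIntegral_preimage_emb b3 (fun x : ℝ => q (x + (a : ℝ) * Complex.I)) _
  refine ⟨?_, ?_, ?_⟩
  · rw [← m3.integrableOn_comp_preimage b3, p3, integrableOn_Ici_iff_integrableOn_Ioi]
    have := ((integrableOn_congr_fun e3 measurableSet_Ioi).mp hq.integrableOn).neg
    refine this.congr_fun (fun y _ => ?_) measurableSet_Ioi
    simp
  · rw [← m1.integrableOn_comp_preimage b1, p1]
    exact (integrableOn_congr_fun e1 measurableSet_Iic).mp hq.integrableOn
  · rw [← intervalIntegral.integral_Iic_add_Ioi (b := -a) hq.integrableOn hq.integrableOn,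
      ← Ioc_union_Ioi_eq_Ioi (show -a ≤ a by linarith),
      setIntegral_union (Ioc_disjoint_Ioi le_rfl) measurableSet_Ioi hq.integrableOn
        hq.integrableOn, i1, i3, setIntegral_congr_fun measurableSet_Ioc e2,
      intervalIntegral.integral_symm, intervalIntegral.integral_of_le (show -a ≤ a by linarith)]
    ring

end PathIntegral

/-- The path `halfStripPath` in the coordinate `v = exp (-k w)`. -/
noncomputable def hankelPath (k : ℕ) (a X y : ℝ) : ℂ :=
  Complex.exp (-(k : ℂ) * halfStripPath a X y)

/-- The weight of the Borel integral of `f` along `hankelPath`. -/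
noncomputable def hankelWeight (k : ℕ) (f : ℂ → ℂ) (a X y : ℝ) : ℂ :=
  (2 * (π : ℂ) * Complex.I)⁻¹ * (f (halfStripPath a X y) * (k * hankelPath k a X y))
    * halfStripVelocity a y

theorem continuous_hankelPath (k : ℕ) (a X : ℝ) : Continuous (hankelPath k a X) := by
  have := continuous_halfStripPath a X
  unfold hankelPath
  fun_prop

theorem norm_hankelPath (k : ℕ) (a X y : ℝ) :
    ‖hankelPath k a X y‖ = Real.exp (-k * (X - max (|y| - a) 0)) := by
  rw [hankelPath, Complex.norm_exp]
  simp [halfStripPath_re]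

theorem hankelPath_re (k : ℕ) (a X y : ℝ) :
    (hankelPath k a X y).re = ‖hankelPath k a X y‖ * Real.cos (k * max (-a) (min a y)) := by
  rw [norm_hankelPath, hankelPath, Complex.exp_re]
  simp [halfStripPath_re, halfStripPath_im]

theorem le_norm_hankelPath (k : ℕ) (a X y : ℝ) :
    Real.exp (-k * X) ≤ ‖hankelPath k a X y‖ := by
  rw [norm_hankelPath, Real.exp_le_exp]
  have h1 : (0 : ℝ) ≤ k := by positivity
  nlinarith [mul_nonneg h1 (le_max_right (|y| - a) 0)]

theorem integrable_inv_norm_hankelPath {k : ℕ} (hk : 0 < k) (a X : ℝ) :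
    MeasureTheory.Integrable fun y => ‖hankelPath k a X y‖⁻¹ := by
  have hk' : (0 : ℝ) < k := by exact_mod_cast hk
  have h0 : MeasureTheory.Integrable fun y : ℝ => Real.exp (-(k : ℝ) * |y|) := by
    rw [← MeasureTheory.integrableOn_univ, ← Iic_union_Ioi (a := (0 : ℝ))]
    refine MeasureTheory.IntegrableOn.union ?_ ?_
    · refine (MeasureTheory.IntegrableOn.congr_fun (f := fun y : ℝ => Real.exp (k * y)) ?_
        (fun y hy => ?_) measurableSet_Iic)
      · exact integrableOn_exp_mul_Iic hk' 0
      · simp only [abs_of_nonpos (mem_Iic.mp hy)]; ring_nf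
    · refine (MeasureTheory.IntegrableOn.congr_fun (f := fun y : ℝ => Real.exp (-k * y)) ?_
        (fun y hy => ?_) measurableSet_Ioi)
      · exact integrableOn_exp_mul_Ioi (by linarith) 0
      · simp only [abs_of_pos (mem_Ioi.mp hy)]
  refine (h0.const_mul (Real.exp (k * (X + a)))).mono' ?_ (.of_forall fun y => ?_)
  · exact (continuous_hankelPath k a X).norm.measurable.inv.aestronglyMeasurable
  · rw [norm_hankelPath, ← Real.exp_neg, Real.norm_of_nonneg (by positivity), ← Real.exp_add]
    gcongr
    nlinarith [mul_le_mul_of_nonneg_left (le_max_left (|y| - a) 0) hk'.le]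

/-- For `t = s^(1/k)` the exponent `(t/z)^k` is `s * V`, linear in `s`. The sign in `d(z^(-k)) = -k
z^(-k) dw` cancels the one from the reversed orientation. -/
theorem borelTransform_eq_integral_hankel {k : ℕ} {f : ℂ → ℂ} {a X s : ℝ} (ha : 0 < a)
    (hk : 0 < k) (hs : 0 < s)
    (hint : MeasureTheory.Integrable fun y =>
      hankelWeight k f a X y * Complex.exp (s * hankelPath k a X y)) :
    borelTransform k f a (Real.exp X) ((Real.log s / k : ℝ) : ℂ)
      = ∫ y, hankelWeight k f a X y * Complex.exp (s * hankelPath k a X y) := by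
  have hk' : (k : ℂ) ≠ 0 := by exact_mod_cast hk.ne'
  have hpi : (2 * (π : ℂ) * Complex.I) ≠ 0 := by simp [Real.pi_ne_zero]
  have hq : ∀ y, borelIntegrand k f ((Real.log s / k : ℝ) : ℂ) (halfStripPath a X y)
      * halfStripVelocity a y = -(2 * (π : ℂ) * Complex.I) *
        (hankelWeight k f a X y * Complex.exp (s * hankelPath k a X y)) := by
    intro y
    have h1 : Complex.exp (k * (((Real.log s / k : ℝ) : ℂ) - halfStripPath a X y))
        = s * hankelPath k a X y := by
      rw [hankelPath, mul_sub, sub_eq_add_neg, Complex.exp_add, neg_mul]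
      congr 1
      push_cast
      rw [mul_div_cancel₀ _ hk', Complex.ofReal_log hs.le, Complex.exp_log]
      exact_mod_cast hs.ne'
    rw [borelIntegrand, h1, hankelWeight]
    unfold hankelPath
    field_simp
  have h2 := (integral_halfStrip ha (q := borelIntegrand k f ((Real.log s / k : ℝ) : ℂ)) (X := X)
    (by simp only [hq]; exact hint.const_mul _)).2.2
  simp only [hq] at h2
  rw [MeasureTheory.integral_const_mul] at h2
  simp only [borelTransform, Real.log_exp, Complex.ofReal_im, zero_add, zero_sub]
  rw [h2]
  field_simp

/-- On the rays `v` has argument `±(π/2 + k η)`: the excess `η` over `π / (2 * k)` is what pushes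
the path into the left half plane. -/
theorem cos_clamp_le {k : ℕ} {η a y : ℝ} (hk : 0 < k) (ha : a = π / (2 * k) + η)
    (hη : 0 < η) (hy : a ≤ |y|) :
    Real.cos (k * max (-a) (min a y)) = -Real.sin (k * η) := by
  have hk' : (0 : ℝ) < k := by exact_mod_cast hk
  have ha0 : 0 < a := by rw [ha]; positivity
  have hka : Real.cos (k * a) = -Real.sin (k * η) := by
    rw [ha, ← Real.cos_add_pi_div_two]
    congr 1
    field_simp
    ring
  rcases le_total 0 y with h | h
  · rw [abs_of_nonneg h] at hy
    rw [min_eq_left hy, max_eq_right (by linarith), hka]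
  · rw [abs_of_nonpos h] at hy
    rw [min_eq_right (by linarith), max_eq_left (by linarith), mul_neg, Real.cos_neg, hka]

section

variable {k : ℕ} {η a X M : ℝ} {f : ℂ → ℂ}

theorem hankelPath_re_of_le (hk : 0 < k) (ha : a = π / (2 * k) + η) (hη : 0 < η) {y : ℝ}
    (hy : a ≤ |y|) : (hankelPath k a X y).re = -(Real.sin (k * η) * ‖hankelPath k a X y‖) := by
  rw [hankelPath_re, cos_clamp_le hk ha hη hy]
  ring

theorem norm_hankelPath_of_le {y : ℝ} (hy : |y| ≤ a) :
    ‖hankelPath k a X y‖ = Real.exp (-k * X) := by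
  rw [norm_hankelPath, max_eq_right (by linarith), sub_zero]

theorem halfStripPath_mem (ha : 0 < a) (y : ℝ) :
    (halfStripPath a X y).re ≤ X ∧ |(halfStripPath a X y).im| ≤ a := by
  rw [halfStripPath_re, halfStripPath_im]
  refine ⟨by linarith [le_max_right (|y| - a) 0], abs_le.mpr ⟨le_max_left _ _, ?_⟩⟩
  exact max_le (by linarith) (min_le_left _ _)

theorem isHankelPath (hk : 0 < k) (ha : a = π / (2 * k) + η) (hη : 0 < η)
    (hkη : k * η ≤ π / 4) (hf : ContinuousOn f (Iic X ×ℂ Icc (-a) a))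
    (hM : ∀ w ∈ Iic X ×ℂ Icc (-a) a, ‖f w‖ ≤ M) :
    IsHankelPath (hankelPath k a X) (hankelWeight k f a X) (2 * Real.exp (-k * X))
      (Real.sin (k * η)) (k * M) := by
  have hk' : (0 : ℝ) < k := by exact_mod_cast hk
  have ha0 : 0 < a := by rw [ha]; positivity
  have hmem : ∀ y, halfStripPath a X y ∈ Iic X ×ℂ Icc (-a) a := fun y =>
    ⟨(halfStripPath_mem ha0 y).1, abs_le.mp (halfStripPath_mem ha0 y).2⟩
  refine ⟨(continuous_hankelPath k a X).aestronglyMeasurable, ?_,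
    integrable_inv_norm_hankelPath hk a X, fun y => Complex.exp_ne_zero _, by positivity,
    Real.sin_pos_of_pos_of_lt_pi (by positivity) (by linarith [Real.pi_pos]), fun y => ?_,
    fun y => ?_⟩
  · have h1 : Continuous fun y => f (halfStripPath a X y) :=
      hf.comp_continuous (continuous_halfStripPath a X) hmem
    have h2 := continuous_hankelPath k a X
    refine MeasureTheory.AEStronglyMeasurable.mul ?_
      (measurable_halfStripVelocity a).aestronglyMeasurable
    exact (continuous_const.mul (h1.mul (continuous_const.mul h2))).aestronglyMeasurable
  · rcases le_total a |y| with h | h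
    · rw [hankelPath_re_of_le hk ha hη h]
      linarith [Real.exp_pos (-k * X)]
    -- On the arc `‖V‖ = exp (-k X)`. The constant `b` is twice this value, to absorb `c ‖V‖` with
    -- `c = sin (k η) ≤ 1`.
    · have h1 := (abs_le.mp (Complex.abs_re_le_norm (hankelPath k a X y))).2
      have h2 := norm_hankelPath_of_le (k := k) (X := X) h
      have h3 := Real.sin_le_one (k * η)
      nlinarith [Real.exp_pos (-k * X)]
  · rw [hankelWeight, norm_mul, norm_halfStripVelocity, mul_one, norm_mul, norm_mul, norm_mul]
    have h1 : ‖(2 * (π : ℂ) * Complex.I)⁻¹‖ ≤ 1 := by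
      rw [norm_inv]
      refine inv_le_one_of_one_le₀ ?_
      simp only [norm_mul, Complex.norm_I, mul_one, Complex.norm_real, Complex.norm_ofNat]
      rw [Real.norm_of_nonneg Real.pi_pos.le]
      linarith [Real.pi_gt_three]
    have h2 := hM _ (hmem y)
    have h3 := (norm_nonneg _).trans h2
    rw [Complex.norm_natCast]
    calc _ ≤ 1 * (M * (k * ‖hankelPath k a X y‖)) := by gcongr
      _ = _ := by ring

theorem re_exp_ge (hk : 0 < k) {ζ : ℂ} (hη : 0 < η) (hkη : k * η ≤ π / 4)
    (him : |ζ.im| ≤ π / (2 * k) - η) :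
    Real.sin (k * η) * ‖Complex.exp (-(k : ℂ) * ζ)‖ ≤ (Complex.exp (-(k : ℂ) * ζ)).re := by
  have hk' : (0 : ℝ) < k := by exact_mod_cast hk
  rw [Complex.exp_re, Complex.norm_exp, mul_comm]
  gcongr
  have h1 : (-(k : ℂ) * ζ).im = -(k * ζ.im) := by simp
  rw [h1, Real.cos_neg, ← Real.cos_pi_div_two_sub, ← Real.cos_abs (k * ζ.im)]
  have h2 : |k * ζ.im| ≤ π / 2 - k * η := by
    rw [abs_mul, abs_of_pos hk']
    calc k * |ζ.im| ≤ k * (π / (2 * k) - η) := by gcongr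
      _ = _ := by field_simp
  refine Real.cos_le_cos_of_nonneg_of_le_pi (abs_nonneg _) ?_ h2
  have : 0 < k * η := by positivity
  linarith [Real.pi_pos]

theorem norm_exp_ge (hk : 0 < k) {ζ : ℂ} (hre : ζ.re ≤ X - Real.log 2) :
    2 * Real.exp (-k * X) ≤ ‖Complex.exp (-(k : ℂ) * ζ)‖ := by
  have hk' : (1 : ℝ) ≤ k := by exact_mod_cast hk
  have hl := Real.log_pos one_lt_two
  rw [Complex.norm_exp]
  calc 2 * Real.exp (-k * X) = Real.exp (Real.log 2 + -k * X) := by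
        rw [Real.exp_add, Real.exp_log two_pos]
    _ ≤ _ := by
        gcongr
        simp only [Complex.mul_re, Complex.neg_re, Complex.natCast_re, Complex.neg_im,
          Complex.natCast_im, neg_zero, zero_mul, sub_zero]
        nlinarith

/-- The rays lie in the left half plane while `u = exp (-k ζ)` lies well inside the right one. On
the arc, `‖V‖ = exp (-k X)` is at most half of `‖u‖`; this is the purpose of the margin `log 2`. -/
theorem le_norm_hankelPath_sub (hk : 0 < k) (ha : a = π / (2 * k) + η) (hη : 0 < η)
    (hkη : k * η ≤ π / 4) {ζ : ℂ} (him : |ζ.im| ≤ π / (2 * k) - η)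
    (hre : ζ.re ≤ X - Real.log 2) (y : ℝ) :
    Real.sin (k * η) * Real.exp (-k * X) ≤ ‖hankelPath k a X y - Complex.exp (-(k : ℂ) * ζ)‖ := by
  have hk' : (0 : ℝ) < k := by exact_mod_cast hk
  have hn := norm_exp_ge hk hre
  have hE := Real.exp_pos (-k * X)
  have hs0 : 0 < Real.sin (k * η) :=
    Real.sin_pos_of_pos_of_lt_pi (by positivity) (by linarith [Real.pi_pos])
  rcases le_total a |y| with h | h
  · have h1 := hankelPath_re_of_le (X := X) hk ha hη h
    have h2 := re_exp_ge hk hη hkη him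
    have h3 := (abs_le.mp (Complex.abs_re_le_norm
      (hankelPath k a X y - Complex.exp (-(k : ℂ) * ζ)))).1
    rw [Complex.sub_re] at h3
    have h4 : 0 ≤ Real.sin (k * η) * ‖hankelPath k a X y‖ := by positivity
    nlinarith
  · have h1 := norm_hankelPath_of_le (k := k) (X := X) h
    have h2 := norm_sub_norm_le (Complex.exp (-(k : ℂ) * ζ)) (hankelPath k a X y)
    rw [norm_sub_rev] at h2
    nlinarith [Real.sin_le_one (k * η)]

end

section

variable {k : ℕ} {η a X X' M : ℝ} {f : ℂ → ℂ}

theorem exp_neg_mul_sub_ne_one (hk : 0 < k) {w ζ : ℂ} (hne : w ≠ ζ)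
    (him : |w.im - ζ.im| < 2 * π / k) : Complex.exp (-(k : ℂ) * (w - ζ)) ≠ 1 := by
  have hk' : (0 : ℝ) < k := by exact_mod_cast hk
  intro h
  rw [Complex.exp_eq_one_iff] at h
  obtain ⟨m, hm⟩ := h
  have h1 := congrArg Complex.im hm
  have h2 : -(k * (w.im - ζ.im)) = m * (2 * π) := by simpa using h1
  have h3 : |(m : ℝ)| < 1 := by
    have h4 : |(m : ℝ) * (2 * π)| < 2 * π := by
      rw [← h2, abs_neg, abs_mul, abs_of_pos hk']
      rwa [lt_div_iff₀ hk', mul_comm] at him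
    rw [abs_mul, abs_of_pos (show 0 < 2 * π by positivity)] at h4
    exact lt_of_mul_lt_mul_right (by linarith) (show 0 ≤ 2 * π by positivity)
  have h5 : m = 0 := by
    rw [← Int.abs_lt_one_iff]
    exact_mod_cast h3
  rw [h5, Int.cast_zero, zero_mul, mul_eq_zero, neg_eq_zero] at hm
  rcases hm with hm | hm
  · exact hk.ne' (by exact_mod_cast hm)
  · exact hne (sub_eq_zero.mp hm)

/-- The Cauchy integral formula along `hankelPath`. -/
theorem integral_hankelWeight_eq (hk : 0 < k) (ha : a = π / (2 * k) + η) (hη : 0 < η)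
    (hkη : k * η ≤ π / 4) (hX : X < X')
    (hf : DifferentiableOn ℂ f (Iio X' ×ℂ Ioo (-(a + η)) (a + η)))
    (hM : ∀ w ∈ Iic X ×ℂ Icc (-a) a, ‖f w‖ ≤ M) {ζ : ℂ} (him : |ζ.im| ≤ π / (2 * k) - η)
    (hre : ζ.re ≤ X - Real.log 2) :
    ∫ y, -(hankelWeight k f a X y * Complex.exp (-(k : ℂ) * ζ) /
      (hankelPath k a X y * (hankelPath k a X y - Complex.exp (-(k : ℂ) * ζ)))) = f ζ := by
  have hk' : (0 : ℝ) < k := by exact_mod_cast hk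
  have hkC : (k : ℂ) ≠ 0 := by exact_mod_cast hk.ne'
  have ha0 : 0 < a := by rw [ha]; positivity
  have hpi : (2 * (π : ℂ) * Complex.I) ≠ 0 := by simp [Real.pi_ne_zero]
  have hsub : Iic X ×ℂ Icc (-a) a ⊆ Iio X' ×ℂ Ioo (-(a + η)) (a + η) := fun w hw =>
    ⟨lt_of_le_of_lt hw.1 hX, ⟨by linarith [hw.2.1], by linarith [hw.2.2]⟩⟩
  have hU : IsOpen (Iio X' ×ℂ Ioo (-(a + η)) (a + η)) := isOpen_Iio.reProdIm isOpen_Ioo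
  have hs0 : 0 < Real.sin (k * η) :=
    Real.sin_pos_of_pos_of_lt_pi (by positivity) (by linarith [Real.pi_pos])
  have hl := Real.log_pos one_lt_two
  have hη4 : 4 * η ≤ π / k := by
    rw [le_div_iff₀ hk']
    linarith
  have hhalf : π / (2 * k) = π / k / 2 := by field_simp
  have h2pi : 2 * π / k = 2 * (π / k) := by ring
  have hζmem : ζ ∈ Iio X' ×ℂ Ioo (-(a + η)) (a + η) := hsub ⟨by
    show ζ.re ≤ X
    linarith, by
    have := abs_le.mp him
    constructor <;> linarith⟩
  set u := Complex.exp (-(k : ℂ) * ζ) with hu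
  have hu0 : u ≠ 0 := Complex.exp_ne_zero _
  have hpath := isHankelPath hk ha hη hkη (hf.continuousOn.mono hsub) hM
  have hdist := fun y => le_norm_hankelPath_sub hk ha hη hkη him hre y
  have hint := hpath.integrable_difference_kernel (by positivity) hdist
  set E : ℂ → ℂ := fun w => Complex.exp (-(k : ℂ) * (w - ζ)) with hE
  have hEd : ∀ w, HasDerivAt E (Complex.exp (-(k : ℂ) * (w - ζ)) * -(k : ℂ)) w := fun w => by
    have := (((hasDerivAt_id w).sub_const ζ).const_mul (-(k : ℂ))).cexp
    simpa [hE] using this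
  have hEζ : E ζ = 1 := by simp [hE]
  have hds : DifferentiableOn ℂ (dslope E ζ) (Iio X' ×ℂ Ioo (-(a + η)) (a + η)) :=
    (Complex.differentiableOn_dslope (hU.mem_nhds hζmem)).mpr fun w _ =>
      (hEd w).differentiableAt.differentiableWithinAt
  have hdsζ : dslope E ζ ζ = -(k : ℂ) := by
    rw [dslope_same, (hEd ζ).deriv]
    simp
  have hdsne : ∀ w, w ≠ ζ → dslope E ζ w = (E w - 1) / (w - ζ) := fun w hw => by
    rw [dslope_of_ne _ hw, slope_def_field, hEζ]
  have hne1 : ∀ w ∈ Iio X' ×ℂ Ioo (-(a + η)) (a + η), w ≠ ζ → E w - 1 ≠ 0 := fun w hw hne => by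
    refine sub_ne_zero.mpr (exp_neg_mul_sub_ne_one hk hne ?_)
    have h1 := abs_le.mp him
    have h2 := hw.2
    rw [mem_preimage, mem_Ioo] at h2
    rw [abs_lt]
    constructor <;> linarith
  have hds0 : ∀ w ∈ Iio X' ×ℂ Ioo (-(a + η)) (a + η), dslope E ζ w ≠ 0 := by
    intro w hw
    by_cases hne : w = ζ
    · rw [hne, hdsζ]
      exact neg_ne_zero.mpr hkC
    · rw [hdsne w hne]
      exact div_ne_zero (hne1 w hw hne) (sub_ne_zero.mpr hne)
  -- In the coordinate `w` the Cauchy kernel is `k u / (exp (-k w) - u)`. Its only pole in the strip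
  -- is the simple one at `ζ`; dividing by the nonvanishing difference quotient of `E` puts it into
  -- the form `A w / (w - ζ)` with `A ζ = -f ζ`.
  set A : ℂ → ℂ := fun w => k * f w / dslope E ζ w with hA
  have hAd : DifferentiableOn ℂ A (Iio X' ×ℂ Ioo (-(a + η)) (a + η)) :=
    (hf.const_mul _).div hds hds0
  have hAζ : A ζ = -f ζ := by
    simp only [hA, hdsζ]
    field_simp
  have hEu : ∀ w, E w - 1 = (Complex.exp (-(k : ℂ) * w) - u) / u := fun w => by
    rw [sub_div, div_self hu0, hE, hu, ← Complex.exp_sub]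
    ring_nf
  have hq : ∀ w, w ≠ ζ → A w / (w - ζ) = k * f w * u / (Complex.exp (-(k : ℂ) * w) - u) := by
    intro w hne
    have h1 : w - ζ ≠ 0 := sub_ne_zero.mpr hne
    simp only [hA]
    rw [hdsne w hne, hEu]
    field_simp
  have hγne : ∀ y, hankelPath k a X y - u ≠ 0 := fun y =>
    norm_pos_iff.mp ((by positivity : 0 < Real.sin (k * η) * Real.exp (-k * X)).trans_le (hdist y))
  have hqγ : ∀ y, A (halfStripPath a X y) / (halfStripPath a X y - ζ) * halfStripVelocity a y
      = -(2 * (π : ℂ) * Complex.I) * -(hankelWeight k f a X y * u /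
      (hankelPath k a X y * (hankelPath k a X y - u))) := by
    intro y
    have h1 := hγne y
    have h2 : halfStripPath a X y ≠ ζ := fun h => h1 (by rw [hankelPath, h, hu, sub_self])
    have h3 := hpath.ne_zero y
    rw [hq _ h2, hankelWeight]
    change k * f (halfStripPath a X y) * u / (hankelPath k a X y - u) * _ = _
    field_simp
  have hpi2 := integral_halfStrip ha0 (q := fun w => A w / (w - ζ)) (X := X)
    (by simp only [hqγ]; exact hint.const_mul _)
  have hM0 : 0 ≤ M := (norm_nonneg _).trans (hM (halfStripPath a X 0)
    ⟨(halfStripPath_mem ha0 0).1, abs_le.mp (halfStripPath_mem ha0 0).2⟩)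
  -- The three bounds in `X₁` ensure, in turn, `‖exp (-k w)‖ ≥ 2 ‖u‖`, `exp (k w.re) ≤ exp w.re`,
  -- and the bound `M` for `f`.
  have hC := integral_boundary_halfstrip_div_sub hU hAd (a := a) (X := X) (ζ := ζ)
    (C := 2 * k * M * ‖u‖) (X₁ := min (min (ζ.re - Real.log 2) 0) X) (by linarith)
    (by rw [ha]; exact lt_of_le_of_lt him (by linarith)) hsub (fun w hw1 hw2 => ?_)
    hpi2.1 hpi2.2.1
  · rw [hpi2.2.2] at hC
    simp only [hqγ] at hC
    rw [MeasureTheory.integral_const_mul, hAζ] at hC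
    refine mul_left_cancel₀ hpi ?_
    linear_combination hC
  · simp only [le_min_iff] at hw1
    obtain ⟨⟨hw1, hw0⟩, hwX⟩ := hw1
    have hne : w ≠ ζ := fun h => by rw [h] at hw1; linarith
    have hfw := hM w ⟨hwX, abs_le.mp hw2⟩
    have hv := norm_exp_ge (X := ζ.re) hk (ζ := w) hw1
    have hv2 : Real.exp (-k * ζ.re) = ‖u‖ := by
      rw [hu, Complex.norm_exp]; simp
    rw [hv2] at hv
    have hvn : ‖Complex.exp (-(k : ℂ) * w)‖ = Real.exp (-k * w.re) := by
      rw [Complex.norm_exp]; simp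
    have hun : 0 < ‖u‖ := norm_pos_iff.mpr hu0
    have hsubn : Real.exp (-k * w.re) / 2 ≤ ‖Complex.exp (-(k : ℂ) * w) - u‖ := by
      have := norm_sub_norm_le (Complex.exp (-(k : ℂ) * w)) u
      rw [hvn] at this hv
      linarith
    have hexp : Real.exp (k * w.re) ≤ Real.exp w.re := by
      gcongr
      have : (1 : ℝ) ≤ k := by exact_mod_cast hk
      nlinarith
    rw [hq w hne, norm_div, norm_mul, norm_mul, Complex.norm_natCast]
    calc (k : ℝ) * ‖f w‖ * ‖u‖ / ‖Complex.exp (-(k : ℂ) * w) - u‖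
        ≤ (k : ℝ) * M * ‖u‖ / (Real.exp (-k * w.re) / 2) := by gcongr
      _ = 2 * k * M * ‖u‖ * Real.exp (k * w.re) := by
          rw [neg_mul, Real.exp_neg]
          field_simp
      _ ≤ _ := by gcongr

/-- A bounded holomorphic function on a half strip is a constant plus the truncated Laplace
integral of its Borel transform, up to an exponentially small error. -/
theorem exists_truncated_laplace_bound (hk : 0 < k) (ha : a = π / (2 * k) + η) (hη : 0 < η)
    (hkη : k * η ≤ π / 4) (hX : X < X')
    (hf : DifferentiableOn ℂ f (Iio X' ×ℂ Ioo (-(a + η)) (a + η)))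
    (hM : ∀ w ∈ Iic X ×ℂ Icc (-a) a, ‖f w‖ ≤ M) {s₀ : ℝ} (hs₀ : 0 < s₀) {H : ℝ → ℂ}
    (hH : ContinuousOn H (Icc 0 s₀))
    (hB : ∀ s ∈ Ioc 0 s₀,
      borelTransform k f a (Real.exp X) ((Real.log s / k : ℝ) : ℂ) = H s) :
    ∃ C₀ : ℂ, ∀ ζ : ℂ, |ζ.im| ≤ π / (2 * k) - η → ζ.re ≤ X - Real.log 2 →
      ‖f ζ - C₀ - ∫ s in (0 : ℝ)..s₀, Complex.exp (-(s * Complex.exp (-(k : ℂ) * ζ))) * H s‖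
        ≤ (Real.sin (k * η) * Real.exp (-k * X))⁻¹ * (Real.exp (s₀ * (2 * Real.exp (-k * X)))
            * Real.exp (-(s₀ * (Real.sin (k * η) * ‖Complex.exp (-(k : ℂ) * ζ)‖)))
            * (k * M * (2 / (s₀ * Real.sin (k * η)) ^ 2))) * ∫ y, ‖hankelPath k a X y‖⁻¹ := by
  have hk' : (0 : ℝ) < k := by exact_mod_cast hk
  have ha0 : 0 < a := by rw [ha]; positivity
  have hsub : Iic X ×ℂ Icc (-a) a ⊆ Iio X' ×ℂ Ioo (-(a + η)) (a + η) := fun w hw =>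
    ⟨lt_of_le_of_lt hw.1 hX, ⟨by linarith [hw.2.1], by linarith [hw.2.2]⟩⟩
  have hs0 : 0 < Real.sin (k * η) :=
    Real.sin_pos_of_pos_of_lt_pi (by positivity) (by linarith [Real.pi_pos])
  have hpath := isHankelPath hk ha hη hkη (hf.continuousOn.mono hsub) hM
  have hκ : 0 < Real.sin (k * η) * Real.exp (-k * X) := by positivity
  have hφ : ∀ s ∈ Ioc 0 s₀,
      ∫ y, hankelWeight k f a X y * Complex.exp (s * hankelPath k a X y) = H s := by
    intro s hs
    rw [← hB s hs, borelTransform_eq_integral_hankel ha0 hk hs.1]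
    have h1 := fun y => hpath.norm_integrand_le hs.1 0 y
    have h2 := hpath.aestronglyMeasurable_exp s 0
    simp only [sub_zero] at h1 h2
    exact (hpath.integrable_inv.const_mul _).mono' h2 (.of_forall h1)
  -- All terms of the inversion formula that do not depend on `ζ` form the constant.
  refine ⟨laplaceKernelIntegral (hankelPath k a X) (hankelWeight k f a X) 0 s₀
    - ∫ s in (0 : ℝ)..s₀, H s, fun ζ him hre => ?_⟩
  · have hdist := fun y => le_norm_hankelPath_sub hk ha hη hkη him hre y
    have key := hpath.eq_truncated_laplace hs₀ hκ hdist (Real.exp_pos (-k * X))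
      (le_norm_hankelPath k a X) hH hφ
    rw [integral_hankelWeight_eq hk ha hη hkη hX hf hM him hre] at key
    rw [key, add_sub_assoc, add_sub_cancel_left, sub_sub_cancel_left, norm_neg]
    have hre2 := re_exp_ge hk hη hkη him
    have hM0 := hpath.bound_nonneg
    have hI : 0 ≤ ∫ y, ‖hankelPath k a X y‖⁻¹ :=
      MeasureTheory.integral_nonneg fun y => by positivity
    refine (hpath.norm_laplaceKernelIntegral_le hs₀ hκ hdist).trans ?_
    gcongr

end

/-! ### Watson's lemma with explicit constants -/

/-- Since `exp (-x) = ∫_x^∞ exp (-t)`, the left side is at most the part of the Gamma integral over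
`(x, ∞)`. -/
theorem rpow_mul_exp_neg_le_Gamma {p x : ℝ} (hp : 0 ≤ p) (hx : 0 ≤ x) :
    x ^ p * Real.exp (-x) ≤ Real.Gamma (1 + p) := by
  have hint := Real.GammaIntegral_convergent (s := 1 + p) (by linarith)
  have hint2 : MeasureTheory.IntegrableOn (fun t : ℝ => Real.exp (-t)) (Ioi x) := by
    simpa using integrableOn_exp_neg_Ioi x
  rw [Real.Gamma_eq_integral (by linarith), add_sub_cancel_left] at *
  calc x ^ p * Real.exp (-x) = ∫ t in Ioi x, x ^ p * Real.exp (-t) := by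
        rw [MeasureTheory.integral_const_mul, integral_exp_neg_Ioi]
    _ ≤ ∫ t in Ioi x, Real.exp (-t) * t ^ p := by
        refine MeasureTheory.setIntegral_mono_on (hint2.const_mul _)
          (hint.mono_set (Ioi_subset_Ioi hx)) measurableSet_Ioi fun t ht => ?_
        rw [mul_comm]
        gcongr
        exact le_of_lt ht
    _ ≤ _ := by
        refine MeasureTheory.setIntegral_mono_set hint ?_ (Ioi_subset_Ioi hx).eventuallyLE
        filter_upwards [MeasureTheory.ae_restrict_mem measurableSet_Ioi] with t ht
        have : (0 : ℝ) < t := ht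
        positivity

theorem integrableOn_rpow_mul_exp_neg_mul {p r : ℝ} (hp : 0 < p) (hr : 0 < r) :
    MeasureTheory.IntegrableOn (fun s : ℝ => s ^ (p - 1) * Real.exp (-(r * s))) (Ioi 0) := by
  have := integrableOn_rpow_mul_exp_neg_mul_rpow (p := 1) (s := p - 1) (by linarith) one_pos hr
  simpa using this

theorem norm_ofReal_mul_exp (x s : ℝ) (u : ℂ) :
    ‖(x : ℂ) * Complex.exp (-(s * u))‖ = |x| * Real.exp (-(u.re * s)) := by
  rw [norm_mul, Complex.norm_real, Real.norm_eq_abs, Complex.norm_exp]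
  simp [mul_comm]

theorem aestronglyMeasurable_rpow_mul_exp (p : ℝ) (u : ℂ) :
    MeasureTheory.AEStronglyMeasurable
      (fun s : ℝ => ((s ^ p : ℝ) : ℂ) * Complex.exp (-(s * u)))
      (MeasureTheory.volume.restrict (Ioi 0)) := by
  refine ContinuousOn.aestronglyMeasurable (ContinuousOn.mul ?_ (by fun_prop)) measurableSet_Ioi
  refine Complex.continuous_ofReal.comp_continuousOn fun s hs => ?_
  exact (Real.continuousAt_rpow_const s p (Or.inl (ne_of_gt hs))).continuousWithinAt

theorem integrableOn_rpow_mul_cexp {p : ℝ} (hp : 0 < p) {u : ℂ} (hu : 0 < u.re) :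
    MeasureTheory.IntegrableOn
      (fun s : ℝ => ((s ^ (p - 1) : ℝ) : ℂ) * Complex.exp (-(s * u))) (Ioi 0) := by
  refine (integrableOn_rpow_mul_exp_neg_mul hp hu).mono'
    (aestronglyMeasurable_rpow_mul_exp (p - 1) u) ?_
  filter_upwards [MeasureTheory.ae_restrict_mem measurableSet_Ioi] with s hs
  have hs' : (0 : ℝ) < s := hs
  rw [norm_ofReal_mul_exp, abs_of_nonneg (by positivity)]

theorem differentiableAt_laplace_rpow {p : ℝ} (hp : 0 < p) {u : ℂ} (hu : 0 < u.re) :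
    DifferentiableAt ℂ (fun u : ℂ => ∫ s in Ioi (0 : ℝ),
      ((s ^ (p - 1) : ℝ) : ℂ) * Complex.exp (-(s * u))) u := by
  have key := hasDerivAt_integral_of_dominated_loc_of_deriv_le
    (μ := MeasureTheory.volume.restrict (Ioi (0 : ℝ))) (x₀ := u) (s := Metric.ball u (u.re / 2))
    (F := fun (u : ℂ) (s : ℝ) => ((s ^ (p - 1) : ℝ) : ℂ) * Complex.exp (-(s * u)))
    (F' := fun (u : ℂ) (s : ℝ) => -(((s ^ p : ℝ) : ℂ) * Complex.exp (-(s * u))))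
    (bound := fun s => s ^ (p + 1 - 1) * Real.exp (-(u.re / 2 * s)))
    (Metric.ball_mem_nhds _ (by positivity))
    (.of_forall fun u => aestronglyMeasurable_rpow_mul_exp (p - 1) u)
    (integrableOn_rpow_mul_cexp hp hu)
    (aestronglyMeasurable_rpow_mul_exp p u).neg ?_
    (integrableOn_rpow_mul_exp_neg_mul (by linarith) (by positivity)) ?_
  · exact key.2.differentiableAt
  · filter_upwards [MeasureTheory.ae_restrict_mem measurableSet_Ioi] with s hs v hv
    have hs' : (0 : ℝ) < s := hs
    rw [norm_neg, norm_ofReal_mul_exp, abs_of_nonneg (by positivity), add_sub_cancel_right]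
    have h1 : u.re / 2 ≤ v.re := by
      rw [Metric.mem_ball, dist_eq_norm] at hv
      have := (abs_le.mp (Complex.abs_re_le_norm (v - u))).1
      rw [Complex.sub_re] at this
      linarith
    gcongr
  · filter_upwards [MeasureTheory.ae_restrict_mem measurableSet_Ioi] with s hs v hv
    have hs' : (0 : ℝ) < s := hs
    have h1 : HasDerivAt (fun v : ℂ => Complex.exp (-(s * v)))
        (Complex.exp (-(s * v)) * (-s)) v := by
      have := ((hasDerivAt_id v).const_mul (s : ℂ)).neg.cexp
      simpa using this
    have h2 := h1.const_mul (((s ^ (p - 1) : ℝ) : ℂ))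
    convert! h2 using 1
    have h3 : s ^ p = s ^ (p - 1) * s := by
      rw [← Real.rpow_add_one hs'.ne', sub_add_cancel]
    rw [h3]
    push_cast
    ring

/-- The Gamma integral in a complex direction. -/
theorem integral_rpow_mul_cexp_neg {k : ℕ} (hk : 0 < k) {j : ℕ} (hj : 0 < j) {ζ : ℂ}
    (him : |ζ.im| < π / (2 * k)) :
    ∫ s in Ioi (0 : ℝ), ((s ^ ((j : ℝ) / k - 1) : ℝ) : ℂ)
        * Complex.exp (-(s * Complex.exp (-(k : ℂ) * ζ)))
      = Real.Gamma (j / k) * Complex.exp (j * ζ) := by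
  have hk' : (0 : ℝ) < k := by exact_mod_cast hk
  have hp : (0 : ℝ) < (j : ℝ) / k := by positivity
  set S : Set ℂ := univ ×ℂ Ioo (-(π / (2 * k))) (π / (2 * k)) with hS
  have hSo : IsOpen S := isOpen_univ.reProdIm isOpen_Ioo
  have hSc : IsPreconnected S :=
    ((convex_univ.is_linear_preimage Complex.reLm.isLinear).inter
      ((convex_Ioo _ _).is_linear_preimage Complex.imLm.isLinear)).isPreconnected
  have hre : ∀ z ∈ S, 0 < (Complex.exp (-(k : ℂ) * z)).re := by
    intro z hz
    rw [Complex.exp_re]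
    have h1 : (-(k : ℂ) * z).im = -(k * z.im) := by simp
    rw [h1]
    have h2 := hz.2
    rw [mem_preimage, mem_Ioo] at h2
    have h3 : k * (π / (2 * k)) = π / 2 := by field_simp
    refine mul_pos (Real.exp_pos _) (Real.cos_pos_of_mem_Ioo ⟨?_, ?_⟩) <;> nlinarith
  have hd1 : DifferentiableOn ℂ (fun z : ℂ => ∫ s in Ioi (0 : ℝ),
      ((s ^ ((j : ℝ) / k - 1) : ℝ) : ℂ) * Complex.exp (-(s * Complex.exp (-(k : ℂ) * z)))) S := by
    intro z hz
    refine DifferentiableAt.differentiableWithinAt ?_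
    have h1 := differentiableAt_laplace_rpow hp (hre z hz)
    have h2 : DifferentiableAt ℂ (fun z : ℂ => Complex.exp (-(k : ℂ) * z)) z := by fun_prop
    have h3 := h1.comp z h2
    exact h3
  have hd2 : DifferentiableOn ℂ (fun z : ℂ => (Real.Gamma (j / k) : ℂ) * Complex.exp (j * z)) S := by
    fun_prop
  have h0S : (0 : ℂ) ∈ S := ⟨trivial, by
    have : 0 < π / (2 * k) := by positivity
    simpa using this⟩
  have hζS : ζ ∈ S := ⟨trivial, abs_lt.mp him⟩
  -- Both sides are holomorphic on the strip and agree on the real axis by the classical Gamma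
  -- integral; the identity theorem applies at `0`.
  refine (hd1.analyticOnNhd hSo).eqOn_of_preconnected_of_frequently_eq (hd2.analyticOnNhd hSo)
    hSc h0S ?_ hζS
  have htend : Filter.Tendsto (fun x : ℝ => (x : ℂ)) (nhdsWithin 0 {0}ᶜ) (nhdsWithin 0 {0}ᶜ) := by
    refine tendsto_nhdsWithin_iff.mpr ⟨?_, ?_⟩
    · exact (Complex.continuous_ofReal.tendsto' 0 0 (by simp)).mono_left nhdsWithin_le_nhds
    · filter_upwards [self_mem_nhdsWithin] with x hx
      simpa using hx
  refine htend.frequently (Filter.Eventually.frequently (.of_forall fun x => ?_))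
  have hr : 0 < Real.exp (-k * x) := Real.exp_pos _
  have h := Real.integral_rpow_mul_exp_neg_mul_Ioi hp hr
  have h1 : ((1 : ℝ) / Real.exp (-k * x)) ^ ((j : ℝ) / k) = Real.exp (j * x) := by
    rw [one_div, ← Real.exp_neg, ← Real.exp_mul]
    congr 1
    field_simp
  rw [h1] at h
  have h2 := congrArg (fun x : ℝ => (x : ℂ)) h
  simp only [← integral_complex_ofReal] at h2
  push_cast at h2 ⊢
  rw [mul_comm (Real.Gamma _ : ℂ), ← h2]
  refine MeasureTheory.setIntegral_congr_fun measurableSet_Ioi fun s hs => ?_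
  rw [mul_comm (Complex.exp _) (s : ℂ)]

/-- Pointwise Taylor remainder bound for a truncated power series. -/
theorem norm_truncation_sub_le {c : ℕ → ℂ} {B δ p : ℝ} (hδ : 0 < δ) (hp : 0 < p)
    (hc : ∀ j, ‖c j‖ ≤ B * δ⁻¹ ^ j) (N : ℕ) {F : ℂ}
    (hF : p ≤ δ / 2 → HasSum (fun j => c j * (p : ℂ) ^ j) F) (hF0 : δ / 2 < p → F = 0) :
    ‖F - ∑ j ∈ Finset.range N, c j * (p : ℂ) ^ j‖ ≤ B * 2 ^ (N + 1) * (p / δ) ^ N := by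
  have hB : 0 ≤ B := by simpa using (norm_nonneg _).trans (hc 0)
  have hterm : ∀ j, ‖c j * (p : ℂ) ^ j‖ ≤ B * (p / δ) ^ j := by
    intro j
    rw [norm_mul, norm_pow, Complex.norm_real, Real.norm_of_nonneg hp.le]
    calc _ ≤ B * δ⁻¹ ^ j * p ^ j := by gcongr; exact hc j
      _ = _ := by rw [div_eq_mul_inv, mul_pow]; ring
  have hq : 0 < p / δ := by positivity
  rcases le_or_gt p (δ / 2) with h | h
  · have hq2 : p / δ ≤ 1 / 2 := by rw [div_le_iff₀ hδ]; linarith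
    have h1 := (hF h)
    have h2 := (hasSum_nat_add_iff' N).mpr h1
    have hg : HasSum (fun j => B * (p / δ) ^ N * (p / δ) ^ j)
        (B * (p / δ) ^ N * (1 - p / δ)⁻¹) :=
      (hasSum_geometric_of_lt_one hq.le (by linarith)).mul_left _
    have h3 := h2.norm_le_of_bounded hg fun j => (hterm (j + N)).trans_eq (by rw [pow_add]; ring)
    refine h3.trans ?_
    have h4 : (1 - p / δ)⁻¹ ≤ 2 ^ (N + 1) := by
      have : (1 - p / δ)⁻¹ ≤ (1 / 2)⁻¹ := by
        gcongr; linarith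
      refine this.trans ?_
      have h5 : (1 : ℝ) ≤ 2 ^ N := one_le_pow₀ one_le_two
      rw [pow_succ]; norm_num; linarith
    calc _ ≤ B * (p / δ) ^ N * 2 ^ (N + 1) := by gcongr
      _ = _ := by ring
  · rw [hF0 h, zero_sub, norm_neg]
    -- Beyond the truncation point only the partial sum is left. As `2p/δ ≥ 1`, every `(2p/δ)^j` is
    -- at most `(2p/δ)^N`, and the factors `2^(-j)` sum to at most `2`.
    have hq2 : 1 ≤ 2 * (p / δ) := by
      rw [mul_div_assoc', le_div_iff₀ hδ]; linarith
    calc _ ≤ ∑ j ∈ Finset.range N, B * (p / δ) ^ j := norm_sum_le_of_le _ fun j _ => hterm j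
      _ ≤ ∑ j ∈ Finset.range N, B * (2 * (p / δ)) ^ N * (1 / 2) ^ j := by
          refine Finset.sum_le_sum fun j hj => ?_
          have h1 : (p / δ) ^ j = (2 * (p / δ)) ^ j * (1 / 2) ^ j := by
            rw [← mul_pow]; congr 1; ring
          rw [h1, mul_assoc B]
          gcongr
          · exact (Finset.mem_range.mp hj).le
      _ = B * (2 * (p / δ)) ^ N * ∑ j ∈ Finset.range N, (1 / 2 : ℝ) ^ j := by
          rw [Finset.mul_sum]
      _ ≤ B * (2 * (p / δ)) ^ N * 2 := by
          gcongr
          have := (summable_geometric_two).sum_le_tsum (Finset.range N) (fun i _ => by positivity)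
          rwa [tsum_geometric_two] at this
      _ = _ := by rw [mul_pow]; ring

/-- Watson's lemma for a truncated Laplace integral, with explicit constants. -/
theorem norm_truncated_laplace_sub_le {k : ℕ} (hk : 0 < k) {c : ℕ → ℂ} {B δ σ : ℝ} (hδ : 0 < δ)
    (hc : ∀ j, ‖c j‖ ≤ B * δ⁻¹ ^ j) (hc0 : c 0 = 0) {H : ℝ → ℂ}
    (hH : ContinuousOn H (Icc 0 ((δ / 2) ^ k)))
    (hsum : ∀ p ∈ Ioc 0 (δ / 2), HasSum (fun j => c j * (p : ℂ) ^ j) ((p : ℂ) ^ k * H (p ^ k)))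
    (hσ : 0 < σ) (hσ1 : σ ≤ 1) {ζ : ℂ} (him : |ζ.im| < π / (2 * k))
    (hre : σ * ‖Complex.exp (-(k : ℂ) * ζ)‖ ≤ (Complex.exp (-(k : ℂ) * ζ)).re)
    {N : ℕ} (hN : 0 < N) :
    ‖(∫ s in (0 : ℝ)..(δ / 2) ^ k, Complex.exp (-(s * Complex.exp (-(k : ℂ) * ζ))) * H s)
      - ∑ j ∈ Finset.range N, c j * Real.Gamma (j / k) * Complex.exp (j * ζ)‖
      ≤ 2 * k * B * (2 / (σ * δ)) ^ N * Real.Gamma (1 + N / k) * ‖Complex.exp ζ‖ ^ N := by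
  have hk' : (0 : ℝ) < k := by exact_mod_cast hk
  have hN' : (0 : ℝ) < N := by exact_mod_cast hN
  have hB : 0 ≤ B := by simpa using (norm_nonneg _).trans (hc 0)
  set u := Complex.exp (-(k : ℂ) * ζ) with hu
  have hun : 0 < ‖u‖ := norm_pos_iff.mpr (Complex.exp_ne_zero _)
  have hu0 : 0 < u.re := (by positivity : 0 < σ * ‖u‖).trans_le hre
  set s₀ := (δ / 2) ^ k with hs₀
  have hs₀0 : 0 < s₀ := by positivity
  have hterm : ∀ j ∈ Finset.range N,
      MeasureTheory.IntegrableOn (fun s : ℝ => c j *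
        (((s ^ ((j : ℝ) / k - 1) : ℝ) : ℂ) * Complex.exp (-(s * u)))) (Ioi 0) := by
    intro j _
    -- The term `j = 0` would contain the non-integrable `s⁻¹`; it is removed by `c 0 = 0`.
    rcases Nat.eq_zero_or_pos j with rfl | hj
    · simp [hc0]
    · exact (integrableOn_rpow_mul_cexp (by positivity) hu0).const_mul _
  have hHi : MeasureTheory.IntegrableOn (fun s : ℝ => Complex.exp (-(s * u)) * H s)
      (Ioc 0 s₀) :=
    (ContinuousOn.integrableOn_Icc (ContinuousOn.mul (by fun_prop) hH)).mono_set Ioc_subset_Icc_self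
  have hHi2 : MeasureTheory.IntegrableOn
      ((Ioc 0 s₀).indicator fun s : ℝ => Complex.exp (-(s * u)) * H s) (Ioi 0) :=
    (hHi.integrable_indicator measurableSet_Ioc).integrableOn
  have hsub : Ioi (0 : ℝ) ∩ Ioc 0 s₀ = Ioc 0 s₀ :=
    inter_eq_self_of_subset_right Ioc_subset_Ioi_self
  -- The partial sum is a Laplace integral over the whole half line, so the truncated integral is
  -- extended by an indicator. One pointwise estimate then covers both `s ≤ s₀` and `s > s₀`.
  have heq : (∫ s in (0 : ℝ)..s₀, Complex.exp (-(s * u)) * H s)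
      - ∑ j ∈ Finset.range N, c j * Real.Gamma (j / k) * Complex.exp (j * ζ)
      = ∫ s in Ioi (0 : ℝ), ((Ioc 0 s₀).indicator (fun s : ℝ => Complex.exp (-(s * u)) * H s) s
        - ∑ j ∈ Finset.range N, c j *
          (((s ^ ((j : ℝ) / k - 1) : ℝ) : ℂ) * Complex.exp (-(s * u)))) := by
    rw [MeasureTheory.integral_sub hHi2 (MeasureTheory.integrable_finsetSum _ hterm),
      MeasureTheory.integral_finsetSum _ hterm,
      MeasureTheory.setIntegral_indicator measurableSet_Ioc, hsub,
      intervalIntegral.integral_of_le hs₀0.le]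
    congr 1
    refine Finset.sum_congr rfl fun j _ => ?_
    rcases Nat.eq_zero_or_pos j with rfl | hj
    · simp [hc0]
    · rw [MeasureTheory.integral_const_mul, integral_rpow_mul_cexp_neg hk hj him, mul_assoc]
  have hpt : ∀ s ∈ Ioi (0 : ℝ),
      ‖(Ioc 0 s₀).indicator (fun s : ℝ => Complex.exp (-(s * u)) * H s) s
        - ∑ j ∈ Finset.range N, c j *
          (((s ^ ((j : ℝ) / k - 1) : ℝ) : ℂ) * Complex.exp (-(s * u)))‖
      ≤ B * 2 ^ (N + 1) * δ⁻¹ ^ N * (s ^ ((N : ℝ) / k - 1) * Real.exp (-(u.re * s))) := by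
    intro s hs
    have hs' : (0 : ℝ) < s := hs
    have hsC : (s : ℂ) ≠ 0 := by exact_mod_cast hs'.ne'
    set p := s ^ ((1 : ℝ) / k) with hp
    have hp0 : 0 < p := by positivity
    have hpj : ∀ j : ℕ, p ^ j = s ^ ((j : ℝ) / k - 1) * s := by
      intro j
      rw [← Real.rpow_add_one hs'.ne', sub_add_cancel, hp, ← Real.rpow_natCast,
        ← Real.rpow_mul hs'.le]
      congr 1
      ring
    have hpk : p ^ k = s := by
      rw [hpj, div_self hk'.ne', sub_self, Real.rpow_zero, one_mul]
    have hple : p ≤ δ / 2 ↔ s ≤ s₀ := by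
      rw [← hpk, hs₀]
      exact (pow_le_pow_iff_left₀ hp0.le (by positivity) hk.ne').symm
    have htr := norm_truncation_sub_le (c := c) (B := B) (N := N)
      (F := s * (Ioc 0 s₀).indicator H s) hδ hp0 hc (fun h => by
        have h1 := hsum p ⟨hp0, h⟩
        have h2 : ((p : ℂ)) ^ k = s := by exact_mod_cast hpk
        rw [indicator_of_mem (show s ∈ Ioc 0 s₀ from ⟨hs', hple.mp h⟩)]
        rwa [hpk, h2] at h1) (fun h => by
        rw [indicator_of_notMem (fun h2 => (not_le.mpr h) (hple.mpr h2.2)), mul_zero])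
    have hpj' : ∀ j : ℕ, (p : ℂ) ^ j = ((s ^ ((j : ℝ) / k - 1) : ℝ) : ℂ) * s := fun j => by
      exact_mod_cast hpj j
    have hfac : (Ioc 0 s₀).indicator (fun s : ℝ => Complex.exp (-(s * u)) * H s) s
        - ∑ j ∈ Finset.range N, c j *
          (((s ^ ((j : ℝ) / k - 1) : ℝ) : ℂ) * Complex.exp (-(s * u)))
        = (s : ℂ)⁻¹ * (s * (Ioc 0 s₀).indicator H s - ∑ j ∈ Finset.range N, c j * (p : ℂ) ^ j)
          * Complex.exp (-(s * u)) := by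
      rw [mul_sub, inv_mul_cancel_left₀ hsC, sub_mul, Finset.mul_sum, Finset.sum_mul]
      congr 1
      · by_cases h : s ∈ Ioc 0 s₀
        · rw [indicator_of_mem h, indicator_of_mem h, mul_comm]
        · rw [indicator_of_notMem h, indicator_of_notMem h, zero_mul]
      · refine Finset.sum_congr rfl fun j _ => ?_
        rw [hpj']
        field_simp
    have hexp : ‖Complex.exp (-(s * u))‖ = Real.exp (-(u.re * s)) := by
      simpa using norm_ofReal_mul_exp 1 s u
    rw [hfac, norm_mul, norm_mul, hexp, norm_inv, Complex.norm_real, Real.norm_of_nonneg hs'.le]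
    calc _ ≤ s⁻¹ * (B * 2 ^ (N + 1) * (p / δ) ^ N) * Real.exp (-(u.re * s)) := by gcongr
      _ = _ := by
          rw [div_eq_mul_inv, mul_pow, hpj]
          field_simp
  have hmaj := (integrableOn_rpow_mul_exp_neg_mul (p := (N : ℝ) / k) (by positivity) hu0).const_mul
    (B * 2 ^ (N + 1) * δ⁻¹ ^ N)
  rw [heq]
  refine (MeasureTheory.norm_integral_le_of_norm_le hmaj
    ((MeasureTheory.ae_restrict_iff' measurableSet_Ioi).mpr (.of_forall hpt))).trans ?_
  rw [MeasureTheory.integral_const_mul, Real.integral_rpow_mul_exp_neg_mul_Ioi (by positivity) hu0]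
  have h1 : (1 / u.re) ^ ((N : ℝ) / k) ≤ (1 / σ) ^ N * ‖Complex.exp ζ‖ ^ N := by
    have e1 : ‖u‖⁻¹ = ‖Complex.exp ζ‖ ^ (k : ℝ) := by
      rw [hu, Complex.norm_exp, Complex.norm_exp, ← Real.exp_neg, ← Real.exp_mul]
      simp [mul_comm]
    have e2 : (‖Complex.exp ζ‖ ^ (k : ℝ)) ^ ((N : ℝ) / k) = ‖Complex.exp ζ‖ ^ N := by
      rw [← Real.rpow_mul (norm_nonneg _), mul_div_cancel₀ _ hk'.ne', Real.rpow_natCast]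
    calc (1 / u.re) ^ ((N : ℝ) / k) ≤ (1 / σ * ‖u‖⁻¹) ^ ((N : ℝ) / k) := by
          refine Real.rpow_le_rpow (by positivity) ?_ (by positivity)
          rw [one_div_mul_eq_div, inv_eq_one_div, div_div]
          refine one_div_le_one_div_of_le (by positivity) ?_
          rwa [mul_comm]
      _ = (1 / σ) ^ ((N : ℝ) / k) * ‖Complex.exp ζ‖ ^ N := by
          rw [Real.mul_rpow (by positivity) (by positivity), e1, e2]
      _ ≤ (1 / σ) ^ (N : ℝ) * ‖Complex.exp ζ‖ ^ N := by
          gcongr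
          · rwa [le_div_iff₀ hσ, one_mul]
          · exact div_le_self hN'.le (by exact_mod_cast hk)
      _ = _ := by rw [Real.rpow_natCast]
  have hG : Real.Gamma ((N : ℝ) / k) ≤ k * Real.Gamma (1 + N / k) := by
    have h2 : (0 : ℝ) < N / k := by positivity
    rw [add_comm, Real.Gamma_add_one h2.ne', ← mul_assoc, mul_div_cancel₀ _ hk'.ne']
    exact le_mul_of_one_le_left (Real.Gamma_pos_of_pos h2).le (by exact_mod_cast hN)
  have hG0 : 0 ≤ Real.Gamma ((N : ℝ) / k) := (Real.Gamma_pos_of_pos (by positivity)).le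
  calc _ ≤ B * 2 ^ (N + 1) * δ⁻¹ ^ N * (((1 / σ) ^ N * ‖Complex.exp ζ‖ ^ N)
        * (k * Real.Gamma (1 + N / k))) := by gcongr
    _ = _ := by
        rw [div_pow, div_pow, mul_pow, inv_pow, pow_succ, one_pow]
        field_simp

/-! ### The expansion in a single direction -/

theorem borelIntegrand_add_mul_I (k : ℕ) (f : ℂ → ℂ) (d : ℝ) (τ w : ℂ) :
    borelIntegrand k f (τ + d * Complex.I) (w + d * Complex.I)
      = borelIntegrand k (fun w => f (w + d * Complex.I)) τ w
        * Complex.exp (-(k * d * Complex.I)) := by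
  simp only [borelIntegrand]
  rw [add_sub_add_right_eq_sub, show -(k : ℂ) * (w + d * Complex.I)
    = -(k : ℂ) * w + -(k * d * Complex.I) by ring, Complex.exp_add]
  ring

/-- Rotating `z` and `t` together leaves `t/z` fixed; only `d(z^(-k))` acquires a phase. This
reduces every direction to `d = 0`. -/
theorem borelTransform_add_mul_I (k : ℕ) (f : ℂ → ℂ) (a r d x : ℝ) :
    borelTransform k f a r ((x : ℂ) + d * Complex.I)
      = borelTransform k (fun w => f (w + d * Complex.I)) a r x
        * Complex.exp (-(k * d * Complex.I)) := by
  have hd : ((x : ℂ) + d * Complex.I).im = d := by simp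
  have e : ∀ (s t : ℝ), (s : ℂ) + ((d + t : ℝ) : ℂ) * Complex.I
      = s + ((0 + t : ℝ) : ℂ) * Complex.I + d * Complex.I := fun s t => by push_cast; ring
  have e' : ∀ (s t : ℝ), (s : ℂ) + ((d - t : ℝ) : ℂ) * Complex.I
      = s + ((0 - t : ℝ) : ℂ) * Complex.I + d * Complex.I := fun s t => by push_cast; ring
  have harc : ∫ θ in (d + a)..(d - a), borelIntegrand k f ((x : ℂ) + d * Complex.I)
      ((Real.log r : ℂ) + (θ : ℂ) * Complex.I) * Complex.I
      = (∫ θ in (0 + a)..(0 - a), borelIntegrand k (fun w => f (w + d * Complex.I)) x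
      ((Real.log r : ℂ) + (θ : ℂ) * Complex.I) * Complex.I)
        * Complex.exp (-(k * d * Complex.I)) := by
    have := intervalIntegral.integral_comp_add_right (a := 0 + a) (b := 0 - a)
      (fun θ : ℝ => borelIntegrand k f ((x : ℂ) + d * Complex.I)
        ((Real.log r : ℂ) + (θ : ℂ) * Complex.I) * Complex.I) d
    rw [show 0 + a + d = d + a by ring, show 0 - a + d = d - a by ring] at this
    rw [← this, ← intervalIntegral.integral_mul_const]
    refine intervalIntegral.integral_congr fun θ _ => ?_
    have h := borelIntegrand_add_mul_I k f d x (Real.log r + θ * Complex.I)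
    rw [show (Real.log r : ℂ) + θ * Complex.I + d * Complex.I
      = Real.log r + ((θ + d : ℝ) : ℂ) * Complex.I by push_cast; ring] at h
    rw [h]
    ring
  simp only [borelTransform, hd, harc, e, e', borelIntegrand_add_mul_I,
    MeasureTheory.integral_mul_const, Complex.ofReal_im]
  ring

/-- The coefficients of the asymptotic expansion of a function with limit `C₀` and Borel transform
`∑ g i t ^ i`. -/
noncomputable def borelCoeff (k : ℕ) (g : ℕ → ℂ) (C₀ : ℂ) (j : ℕ) : ℂ :=
  if j = 0 then C₀ else if k ≤ j then g (j - k) * Real.Gamma (j / k) else 0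

theorem sum_borelCoeff (k : ℕ) (hk : 0 < k) (g : ℕ → ℂ) (C₀ : ℂ) {N : ℕ} (hN : 0 < N) (z : ℂ) :
    ∑ j ∈ Finset.range N, borelCoeff k g C₀ j * z ^ j
      = C₀ + ∑ j ∈ Finset.range N, (if k ≤ j then g (j - k) else 0) * Real.Gamma (j / k)
        * z ^ j := by
  obtain ⟨m, rfl⟩ := Nat.exists_eq_succ_of_ne_zero hN.ne'
  rw [Finset.sum_range_succ', Finset.sum_range_succ' _ m]
  simp only [borelCoeff, Nat.add_eq_zero_iff, one_ne_zero, and_false, if_false, if_true, pow_zero,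
    mul_one, nonpos_iff_eq_zero, hk.ne', zero_mul, add_zero]
  rw [add_comm]
  congr 1
  refine Finset.sum_congr rfl fun j _ => ?_
  split_ifs <;> simp

/-- The constant in `exists_directional_expansion`. -/
noncomputable def hankelConst (k : ℕ) (η X : ℝ) : ℝ :=
  2 * k + (Real.sin (k * η) * Real.exp (-k * X))⁻¹ * (Real.exp (2 * Real.exp (-k * X))
    * (k * (2 / Real.sin (k * η) ^ 2))) * ∫ y, ‖hankelPath k (π / (2 * k) + η) X y‖⁻¹

theorem hankelConst_nonneg {k : ℕ} {η X : ℝ} (hs : 0 < Real.sin (k * η)) :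
    0 ≤ hankelConst k η X := by
  have : 0 ≤ ∫ y, ‖hankelPath k (π / (2 * k) + η) X y‖⁻¹ :=
    MeasureTheory.integral_nonneg fun y => by positivity
  unfold hankelConst
  positivity

/-- Truncation at `s₀ = (δ/2)^k` leaves an error that fits every Gevrey bound, with the same base `2
/ (σ δ)` as in Watson's lemma: apply `rpow_mul_exp_neg_le_Gamma` with exponent `N / k`. -/
theorem exp_neg_le_Gamma_mul {k N : ℕ} (hk : 0 < k) {σ δ : ℝ} (hσ : 0 < σ) (hσ1 : σ ≤ 1)
    (hδ : 0 < δ) (ζ : ℂ) :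
    Real.exp (-((δ / 2) ^ k * (σ * ‖Complex.exp (-(k : ℂ) * ζ)‖)))
      ≤ (2 / (σ * δ)) ^ N * Real.Gamma (1 + N / k) * ‖Complex.exp ζ‖ ^ N := by
  have hk' : (0 : ℝ) < k := by exact_mod_cast hk
  set x := (δ / 2) ^ k * (σ * ‖Complex.exp (-(k : ℂ) * ζ)‖) with hx
  have hun : 0 < ‖Complex.exp (-(k : ℂ) * ζ)‖ := norm_pos_iff.mpr (Complex.exp_ne_zero _)
  have hx0 : 0 < x := by positivity
  have h := rpow_mul_exp_neg_le_Gamma (p := (N : ℝ) / k) (by positivity) hx0.le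
  have e1 : ‖Complex.exp (-(k : ℂ) * ζ)‖ = ‖Complex.exp ζ‖⁻¹ ^ (k : ℝ) := by
    rw [Complex.norm_exp, Complex.norm_exp, ← Real.exp_neg, ← Real.exp_mul]
    simp [mul_comm]
  have hz : 0 < ‖Complex.exp ζ‖ := norm_pos_iff.mpr (Complex.exp_ne_zero _)
  have h1 : (δ / 2) ^ N * σ ^ N * ‖Complex.exp ζ‖⁻¹ ^ N ≤ x ^ ((N : ℝ) / k) := by
    rw [hx, Real.mul_rpow (by positivity) (by positivity), Real.mul_rpow hσ.le hun.le, e1,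
      ← Real.rpow_natCast (δ / 2) k, ← Real.rpow_mul (by positivity),
      ← Real.rpow_mul (by positivity), mul_div_cancel₀ _ hk'.ne', Real.rpow_natCast,
      Real.rpow_natCast, mul_assoc]
    gcongr
    rw [← Real.rpow_natCast σ N]
    exact Real.rpow_le_rpow_of_exponent_ge hσ hσ1
      (div_le_self (by positivity) (by exact_mod_cast hk))
  have h2 : (δ / 2) ^ N * σ ^ N * ‖Complex.exp ζ‖⁻¹ ^ N * Real.exp (-x)
      ≤ Real.Gamma (1 + N / k) :=
    (mul_le_mul_of_nonneg_right h1 (Real.exp_pos _).le).trans h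
  calc Real.exp (-x) = ((2 / (σ * δ)) ^ N * ‖Complex.exp ζ‖ ^ N)
        * ((δ / 2) ^ N * σ ^ N * ‖Complex.exp ζ‖⁻¹ ^ N * Real.exp (-x)) := by
        simp only [div_pow, mul_pow, inv_pow]
        field_simp
    _ ≤ ((2 / (σ * δ)) ^ N * ‖Complex.exp ζ‖ ^ N) * Real.Gamma (1 + N / k) := by gcongr
    _ = _ := by ring

/-- A bounded function with holomorphic Borel transform near `0` has a Gevrey expansion in each
direction. -/
theorem exists_directional_expansion {k : ℕ} (hk : 0 < k) {η a X X' M B δ d : ℝ} {f G : ℂ → ℂ}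
    {g : ℕ → ℂ} (ha : a = π / (2 * k) + η) (hη : 0 < η) (hkη : k * η ≤ π / 4) (hX : X < X')
    (hf : DifferentiableOn ℂ f (Iio X' ×ℂ Ioo (d - (a + η)) (d + (a + η))))
    (hM : ∀ w ∈ Iic X ×ℂ Icc (d - a) (d + a), ‖f w‖ ≤ M) (hδ : 0 < δ) (hδ1 : δ ≤ 1)
    (hG : ContinuousOn G (Metric.closedBall 0 δ)) (hg : ∀ i, ‖g i‖ ≤ B * δ⁻¹ ^ i)
    (hGs : ∀ t : ℂ, ‖t‖ ≤ δ / 2 → HasSum (fun i => g i * t ^ i) (G t))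
    (hB : ∀ x : ℝ, Real.exp x ≤ δ → borelTransform k f a (Real.exp X) (x + d * Complex.I)
      = G (Complex.exp (x + d * Complex.I))) :
    ∃ C₀ : ℂ, ∀ N : ℕ, 0 < N → ∀ ζ : ℂ, |ζ.im - d| ≤ π / (2 * k) - η →
      ζ.re ≤ X - Real.log 2 →
      ‖f ζ - ∑ j ∈ Finset.range N, borelCoeff k g C₀ j * Complex.exp ζ ^ j‖
        ≤ hankelConst k η X * (M + B) * (2 / δ) ^ (2 * k) * (2 / (Real.sin (k * η) * δ)) ^ N
          * Real.Gamma (1 + N / k) * ‖Complex.exp ζ‖ ^ N := by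
  have hk' : (0 : ℝ) < k := by exact_mod_cast hk
  have hkC : (k : ℂ) ≠ 0 := by exact_mod_cast hk.ne'
  have hs0 : 0 < Real.sin (k * η) :=
    Real.sin_pos_of_pos_of_lt_pi (by positivity) (by linarith [Real.pi_pos])
  have ha0 : 0 < a := by rw [ha]; positivity
  have hB0 : 0 ≤ B := by simpa using (norm_nonneg _).trans (hg 0)
  set E := Complex.exp (d * Complex.I) with hE
  have hE1 : ‖E‖ = 1 := Complex.norm_exp_ofReal_mul_I d
  -- With `p = s^(1/k)`, the function `s H(s)` is `(pE)^k G(pE)`, so its coefficients are those of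
  -- `G` shifted by `k`.
  set c : ℕ → ℂ := fun j => (if k ≤ j then g (j - k) else 0) * E ^ j with hc
  set H : ℝ → ℂ := fun s => E ^ k * G (((s ^ ((1 : ℝ) / k) : ℝ) : ℂ) * E) with hH
  set s₀ := (δ / 2) ^ k with hs₀
  have hs₀0 : 0 < s₀ := by positivity
  have hroot : ∀ p : ℝ, 0 ≤ p → (p ^ k) ^ ((1 : ℝ) / k) = p := fun p hp => by
    rw [one_div]; exact Real.pow_rpow_inv_natCast hp hk.ne'
  have hrle : ∀ s ∈ Icc 0 s₀, s ^ ((1 : ℝ) / k) ≤ δ / 2 := fun s hs => by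
    rw [← hroot (δ / 2) (by positivity)]
    exact Real.rpow_le_rpow hs.1 hs.2 (by positivity)
  have hHc : ContinuousOn H (Icc 0 s₀) := by
    refine continuousOn_const.mul (hG.comp (ContinuousOn.mul ?_ continuousOn_const)
      fun s hs => ?_)
    · refine Complex.continuous_ofReal.comp_continuousOn fun s _ => ?_
      exact (Real.continuousAt_rpow_const s _ (Or.inr (by positivity))).continuousWithinAt
    · have h0 : 0 ≤ s ^ ((1 : ℝ) / k) := Real.rpow_nonneg hs.1 _
      rw [mem_closedBall_zero_iff, norm_mul, hE1, mul_one, Complex.norm_real,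
        Real.norm_of_nonneg h0]
      linarith [hrle s hs]
  have hcb : ∀ j, ‖c j‖ ≤ B * δ ^ k * δ⁻¹ ^ j := by
    intro j
    simp only [hc]
    rw [norm_mul, norm_pow, hE1, one_pow, mul_one]
    split_ifs with h
    · refine (hg _).trans_eq ?_
      obtain ⟨i, rfl⟩ := Nat.exists_eq_add_of_le h
      rw [Nat.add_sub_cancel_left, pow_add, inv_pow, inv_pow]
      field_simp
    · simp only [norm_zero]; positivity
  have hc0 : c 0 = 0 := by simp [hc, hk.ne']
  have hsum : ∀ p ∈ Ioc 0 (δ / 2), HasSum (fun j => c j * (p : ℂ) ^ j)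
      ((p : ℂ) ^ k * H (p ^ k)) := by
    intro p hp
    have h1 := (hGs (p * E) (by
      rw [norm_mul, hE1, mul_one, Complex.norm_real, Real.norm_of_nonneg hp.1.le]
      exact hp.2)).mul_left ((p : ℂ) ^ k * E ^ k)
    rw [← hasSum_nat_add_iff' k, Finset.sum_eq_zero (fun j hj => by
      simp [hc, not_le.mpr (Finset.mem_range.mp hj)]), sub_zero]
    simp only [hH, hroot p hp.1.le]
    rw [← mul_assoc]
    refine h1.congr_fun fun i => ?_
    simp only [hc, Nat.le_add_left, if_true, Nat.add_sub_cancel]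
    ring
  have hshift : ∀ w : ℂ, (w + d * Complex.I).re = w.re ∧ (w + d * Complex.I).im = w.im + d := by
    intro w; simp
  have hf' : DifferentiableOn ℂ (fun w => f (w + d * Complex.I))
      (Iio X' ×ℂ Ioo (-(a + η)) (a + η)) := by
    refine hf.comp (by fun_prop) fun w hw => ?_
    refine ⟨by rw [mem_preimage, (hshift w).1]; exact hw.1, ?_⟩
    rw [mem_preimage, (hshift w).2]
    exact ⟨by linarith [hw.2.1], by linarith [hw.2.2]⟩
  have hM' : ∀ w ∈ Iic X ×ℂ Icc (-a) a, ‖f (w + d * Complex.I)‖ ≤ M := fun w hw => by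
    refine hM _ ⟨by rw [mem_preimage, (hshift w).1]; exact hw.1, ?_⟩
    rw [mem_preimage, (hshift w).2]
    exact ⟨by linarith [hw.2.1], by linarith [hw.2.2]⟩
  have hM0 : 0 ≤ M := (norm_nonneg _).trans (hM' (halfStripPath a X 0)
    ⟨(halfStripPath_mem ha0 0).1, abs_le.mp (halfStripPath_mem ha0 0).2⟩)
  have hB' : ∀ s ∈ Ioc 0 s₀, borelTransform k (fun w => f (w + d * Complex.I)) a (Real.exp X)
      ((Real.log s / k : ℝ) : ℂ) = H s := by
    intro s hs
    have hx : Real.exp (Real.log s / k) = s ^ ((1 : ℝ) / k) := by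
      rw [Real.rpow_def_of_pos hs.1]; ring_nf
    have h1 := hB (Real.log s / k) (by
      rw [hx]; linarith [hrle s ⟨hs.1.le, hs.2⟩])
    rw [borelTransform_add_mul_I, Complex.exp_add, ← Complex.ofReal_exp, hx] at h1
    have h2 : E ^ k * Complex.exp (-(k * d * Complex.I)) = 1 := by
      rw [hE, ← Complex.exp_nat_mul, ← Complex.exp_add]
      ring_nf
      simp
    simp only [hH]
    rw [← h1]
    linear_combination (-(borelTransform k (fun w => f (w + d * Complex.I)) a (Real.exp X)
      ((Real.log s / k : ℝ) : ℂ))) * h2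
  obtain ⟨C₀, hC₀⟩ := exists_truncated_laplace_bound hk ha hη hkη hX hf' hM' hs₀0 hHc hB'
  refine ⟨C₀, fun N hN ζ him hre => ?_⟩
  set ξ : ℂ := ζ - d * Complex.I with hξ
  have hξζ : ξ + d * Complex.I = ζ := by rw [hξ]; ring
  have hξim : ξ.im = ζ.im - d := by simp [hξ]
  have hξre : ξ.re = ζ.re := by simp [hξ]
  have hζn : ‖Complex.exp ξ‖ = ‖Complex.exp ζ‖ := by
    rw [Complex.norm_exp, Complex.norm_exp, hξre]
  rw [← hξim] at him
  rw [← hξre] at hre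
  have b1 := hC₀ ξ him hre
  have b2 := norm_truncated_laplace_sub_le hk hδ hcb hc0 hHc hsum hs0 (Real.sin_le_one _)
    (ζ := ξ) (by linarith) (re_exp_ge hk hη hkη him) hN
  have hsumeq : ∑ j ∈ Finset.range N, c j * Real.Gamma (j / k) * Complex.exp (j * ξ)
      = ∑ j ∈ Finset.range N, (if k ≤ j then g (j - k) else 0) * Real.Gamma (j / k)
        * Complex.exp ζ ^ j := by
    refine Finset.sum_congr rfl fun j _ => ?_
    have : Complex.exp ζ ^ j = E ^ j * Complex.exp (j * ξ) := by
      rw [← hξζ, hE, ← Complex.exp_nat_mul, ← Complex.exp_nat_mul, ← Complex.exp_add]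
      ring_nf
    rw [this]
    simp only [hc]
    ring
  rw [hsumeq] at b2
  simp only [hξζ] at b1
  rw [sum_borelCoeff k hk g C₀ hN, ← sub_sub]
  have hexp := exp_neg_le_Gamma_mul (N := N) hk hs0 (Real.sin_le_one _) hδ ξ
  have htri := norm_sub_le_norm_sub_add_norm_sub (f ζ - C₀)
    (∫ s in (0 : ℝ)..s₀, Complex.exp (-(s * Complex.exp (-(k : ℂ) * ξ))) * H s)
    (∑ j ∈ Finset.range N, (if k ≤ j then g (j - k) else 0) * Real.Gamma (j / k)
        * Complex.exp ζ ^ j)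
  refine htri.trans ((add_le_add b1 b2).trans ?_)
  rw [← hζn]
  set Z := (2 / (Real.sin (k * η) * δ)) ^ N * Real.Gamma (1 + N / k) * ‖Complex.exp ξ‖ ^ N with hZ
  have hG0 : 0 < Real.Gamma (1 + (N : ℝ) / k) := Real.Gamma_pos_of_pos (by positivity)
  have hZ0 : 0 ≤ Z := by positivity
  have hI : 0 ≤ ∫ y, ‖hankelPath k a X y‖⁻¹ :=
    MeasureTheory.integral_nonneg fun y => by positivity
  have hs₀1 : s₀ ≤ 1 := pow_le_one₀ (by positivity) (by linarith)
  have hδk : (1 : ℝ) ≤ (2 / δ) ^ (2 * k) := one_le_pow₀ (by rw [le_div_iff₀ hδ]; linarith)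
  have c1 : (Real.sin (k * η) * Real.exp (-k * X))⁻¹ * (Real.exp (s₀ * (2 * Real.exp (-k * X)))
      * Real.exp (-(s₀ * (Real.sin (k * η) * ‖Complex.exp (-(k : ℂ) * ξ)‖)))
      * (k * M * (2 / (s₀ * Real.sin (k * η)) ^ 2))) * ∫ y, ‖hankelPath k a X y‖⁻¹
      ≤ (Real.sin (k * η) * Real.exp (-k * X))⁻¹ * (Real.exp (2 * Real.exp (-k * X))
      * Z * (k * M * (2 / (s₀ * Real.sin (k * η)) ^ 2))) * ∫ y, ‖hankelPath k a X y‖⁻¹ := by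
    have h1 : Real.exp (s₀ * (2 * Real.exp (-k * X))) ≤ Real.exp (2 * Real.exp (-k * X)) :=
      Real.exp_le_exp.mpr (mul_le_of_le_one_left (by positivity) hs₀1)
    gcongr
  have c2 : (Real.sin (k * η) * Real.exp (-k * X))⁻¹ * (Real.exp (2 * Real.exp (-k * X))
      * Z * (k * M * (2 / (s₀ * Real.sin (k * η)) ^ 2))) * ∫ y, ‖hankelPath k a X y‖⁻¹
      = (hankelConst k η X - 2 * k) * M * (2 / δ) ^ (2 * k) * Z := by
    rw [hankelConst, add_sub_cancel_left, ha]
    have : (2 / δ) ^ (2 * k) = (s₀ ^ 2)⁻¹ := by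
      rw [hs₀, ← pow_mul, mul_comm k 2, ← inv_pow, inv_div]
    rw [this, mul_pow]
    field_simp
  have c3 : 2 * k * (B * δ ^ k) * (2 / (Real.sin (k * η) * δ)) ^ N * Real.Gamma (1 + N / k)
      * ‖Complex.exp ξ‖ ^ N ≤ 2 * k * B * (2 / δ) ^ (2 * k) * Z := by
    have h1 : B * δ ^ k ≤ B * (2 / δ) ^ (2 * k) := by
      gcongr
      exact (pow_le_one₀ hδ.le hδ1).trans hδk
    calc _ = 2 * k * (B * δ ^ k) * Z := by rw [hZ]; ring
      _ ≤ 2 * k * (B * (2 / δ) ^ (2 * k)) * Z := by gcongr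
      _ = _ := by ring
  have hC2 : 2 * k ≤ hankelConst k η X := by
    rw [hankelConst, ← ha]
    have : 0 ≤ (Real.sin (k * η) * Real.exp (-k * X))⁻¹ * (Real.exp (2 * Real.exp (-k * X))
      * (k * (2 / Real.sin (k * η) ^ 2))) * ∫ y, ‖hankelPath k a X y‖⁻¹ := by positivity
    linarith
  have hP : 0 ≤ (2 / δ) ^ (2 * k) * Z := by positivity
  have c4 : 0 ≤ (hankelConst k η X - 2 * k) * B * ((2 / δ) ^ (2 * k) * Z) :=
    mul_nonneg (mul_nonneg (by linarith) hB0) hP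
  have c5 : 0 ≤ 2 * k * M * ((2 / δ) ^ (2 * k) * Z) := by positivity
  calc _ ≤ (hankelConst k η X - 2 * k) * M * (2 / δ) ^ (2 * k) * Z
        + 2 * k * B * (2 / δ) ^ (2 * k) * Z := add_le_add (c1.trans_eq c2) c3
    _ ≤ hankelConst k η X * (M + B) * (2 / δ) ^ (2 * k) * Z := by linarith
    _ = _ := by rw [hZ]; ring

/-! ### From directions to sectors -/

/-- Subdivide the segment from `d` to `d'` into steps of length at most `L`. -/
theorem eq_of_locally_eq {E : Type*} {F : ℝ → E} {u v L : ℝ} (hL : 0 < L)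
    (h : ∀ d ∈ Icc u v, ∀ d' ∈ Icc u v, |d' - d| ≤ L → F d = F d') {d d' : ℝ}
    (hd : d ∈ Icc u v) (hd' : d' ∈ Icc u v) : F d = F d' := by
  have key : ∀ n : ℕ, ∀ d' ∈ Icc u v, |d' - d| ≤ n * L → F d = F d' := by
    intro n
    induction n with
    | zero =>
      intro d' hd' hn
      have : d' - d = 0 := by simpa using hn
      rw [sub_eq_zero.mp this]
    | succ n ih =>
      intro d' hd' hn
      have hn1 : (0 : ℝ) < n + 1 := by positivity
      push_cast at hn
      have hmem : d + n / (n + 1) * (d' - d) ∈ Icc u v :=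
        (convex_Icc u v).add_smul_sub_mem hd hd' (t := (n : ℝ) / (n + 1))
          ⟨by positivity, by rw [div_le_one hn1]; linarith⟩
      have hq : |d' - d| / (n + 1) ≤ L := by
        rw [div_le_iff₀ hn1]; linarith
      rw [ih _ hmem, h _ hmem _ hd']
      · rw [show d' - (d + n / (n + 1) * (d' - d)) = (d' - d) / (n + 1) by field_simp; ring,
          abs_div, abs_of_pos hn1]
        exact hq
      · rw [add_sub_cancel_left, abs_mul, abs_of_nonneg (by positivity), div_mul_eq_mul_div,
          mul_div_assoc]
        gcongr
  obtain ⟨n, hn⟩ := exists_nat_ge (|d' - d| / L)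
  exact key n d' hd' ((div_le_iff₀ hL).mp hn)

theorem eq_of_norm_sub_le_exp {p q : ℂ} {K X : ℝ}
    (h : ∀ x ≤ X, ‖p - q‖ ≤ K * Real.exp x) : p = q := by
  have h1 : Filter.Tendsto (fun x => K * Real.exp x) Filter.atBot (nhds 0) := by
    simpa using Real.tendsto_exp_atBot.const_mul K
  have h2 : ‖p - q‖ ≤ 0 := ge_of_tendsto h1 (by
    filter_upwards [Filter.eventually_le_atBot X] with x hx using h x hx)
  exact sub_eq_zero.mp (norm_le_zero_iff.mp h2)

theorem exists_taylor_coeff {G : ℂ → ℂ} {B δ : ℝ} (hδ : 0 < δ)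
    (hG : AnalyticOnNhd ℂ G (Metric.closedBall 0 δ))
    (hB : ∀ t ∈ Metric.closedBall (0 : ℂ) δ, ‖G t‖ ≤ B) :
    ∃ g : ℕ → ℂ, (∀ i, ‖g i‖ ≤ B * δ⁻¹ ^ i) ∧
      ∀ t : ℂ, ‖t‖ ≤ δ / 2 → HasSum (fun i => g i * t ^ i) (G t) := by
  have hd : DiffContOnCl ℂ G (Metric.ball 0 δ) := by
    refine DifferentiableOn.diffContOnCl ?_
    rw [closure_ball _ hδ.ne']
    exact hG.differentiableOn
  refine ⟨fun i => ((i.factorial : ℂ))⁻¹ * iteratedDeriv i G 0, fun i => ?_, fun t ht => ?_⟩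
  · have h := Complex.norm_iteratedDeriv_le_of_forall_mem_sphere_norm_le i hδ hd fun z hz =>
      hB z (Metric.sphere_subset_closedBall hz)
    have hf : (0 : ℝ) < i.factorial := by exact_mod_cast i.factorial_pos
    rw [norm_mul, norm_inv, Complex.norm_natCast, inv_mul_le_iff₀ hf]
    refine h.trans_eq ?_
    rw [inv_pow]
    ring
  · have h := Complex.hasSum_taylorSeries_on_ball (f := G) (c := 0) (r := δ)
      hd.differentiableOn (z := t)
      (by rw [mem_ball_zero_iff]; linarith)
    refine h.congr_fun fun i => ?_
    simp only [sub_zero, smul_eq_mul]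
    ring

/-- A bounded holomorphic function on a sector whose Borel transform is holomorphic on a disc of
radius `δ` has a Gevrey expansion on smaller sectors, with constants that depend on the function
only through `δ` and the bounds for it and its Borel transform. -/
theorem exists_sectorial_expansion {k : ℕ} (hk : 0 < k) {α β ρ ε : ℝ} (hαβ : π / k < β - α)
    (hρ : 0 < ρ) (hε : 0 < ε) :
    ∃ ρ' C A : ℝ, 0 < ρ' ∧ ρ' < ρ ∧ 0 < C ∧ 0 < A ∧ ∀ (f G : ℂ → ℂ) (M B δ : ℝ),
      DifferentiableOn ℂ f (Iio (Real.log ρ) ×ℂ Ioo α β) →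
      (∀ w ∈ Iio (Real.log ρ) ×ℂ Ioo α β, ‖f w‖ ≤ M) → 0 < δ → δ ≤ 1 →
      IsBorelTransformOnDisc k f α β ρ δ G → (∀ t ∈ Metric.closedBall (0 : ℂ) δ, ‖G t‖ ≤ B) →
      ∃ b : ℕ → ℂ, ∀ N : ℕ, ∀ w ∈ closedSector (α + ε) (β - ε) ρ',
        ‖f w - ∑ j ∈ Finset.range N, b j * Complex.exp w ^ j‖
          ≤ C * (M + B) * (2 / δ) ^ (2 * k) * (A / δ) ^ N * Real.Gamma (1 + N / k)
            * ‖Complex.exp w‖ ^ N := by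
  have hk' : (0 : ℝ) < k := by exact_mod_cast hk
  -- The admissible directions reach arguments down to `α + 3η` and, symmetrically, up to `β - 3η`,
  -- hence `ε / 3`. Their range is nonempty when `4η ≤ β - α - π/k`, and the last bound gives `k η ≤
  -- π / 4`.
  set η : ℝ := min (min (ε / 3) ((β - α - π / k) / 4)) (π / (4 * k)) with hηdef
  have hη : 0 < η := by
    refine lt_min (lt_min (by positivity) ?_) (by positivity)
    linarith
  have hη1 : η ≤ ε / 3 := (min_le_left _ _).trans (min_le_left _ _)
  have hη2 : η ≤ (β - α - π / k) / 4 := (min_le_left _ _).trans (min_le_right _ _)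
  have hη3 : η ≤ π / (4 * k) := min_le_right _ _
  have hkη : k * η ≤ π / 4 := by
    calc k * η ≤ k * (π / (4 * k)) := by gcongr
      _ = _ := by field_simp
  have hs0 : 0 < Real.sin (k * η) :=
    Real.sin_pos_of_pos_of_lt_pi (by positivity) (by linarith [Real.pi_pos])
  set P : ℝ := π / (4 * k) with hP
  have hP0 : 0 < P := by positivity
  have e2 : π / (2 * k) = 2 * P := by rw [hP]; field_simp; norm_num
  have e1 : π / k = 4 * P := by rw [hP]; field_simp
  have e3 : 3 * π / (2 * k) = 6 * P := by rw [hP]; field_simp; norm_num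
  rw [e1] at hη2
  set X : ℝ := Real.log (ρ / 2) with hX
  have hexpX : Real.exp X = ρ / 2 := Real.exp_log (by positivity)
  have hXlt : X < Real.log ρ := Real.log_lt_log (by positivity) (by linarith)
  have hC0 := hankelConst_nonneg (X := X) hs0
  -- The arc has radius `ρ / 2`, and the margin `log 2` halves this again. The summand `1` makes the
  -- constant positive and covers `N = 0`.
  refine ⟨ρ / 4, hankelConst k η X + 1, 2 / Real.sin (k * η), by positivity, by linarith,
    by linarith, by positivity, ?_⟩
  intro f G M B δ hf hM hδ hδ1 hG hB
  obtain ⟨g, hg, hgs⟩ := exists_taylor_coeff hδ hG.1 hB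
  set a : ℝ := π / (2 * k) + η with ha
  have hB0 : 0 ≤ B := (norm_nonneg _).trans (hB 0 (Metric.mem_closedBall_self hδ.le))
  have hdir : ∀ d ∈ Icc (α + a + η) (β - a - η), _ := fun d hd =>
    exists_directional_expansion (f := f) (G := G) (g := g) (d := d) (δ := δ) (M := M) (B := B)
      hk ha hη hkη hXlt
      (hf.mono fun w hw => ⟨hw.1, ⟨by linarith [hd.1, hw.2.1], by linarith [hd.2, hw.2.2]⟩⟩)
      (fun w hw => hM w ⟨lt_of_le_of_lt hw.1 hXlt,
        ⟨by linarith [hd.1, hw.2.1], by linarith [hd.2, hw.2.2]⟩⟩)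
      hδ hδ1 hG.1.continuousOn hg hgs (fun x hx => by
        have him : ((x : ℂ) + d * Complex.I).im = d := by simp
        have hre : ((x : ℂ) + d * Complex.I).re = x := by simp
        refine (hG.2 (x + d * Complex.I) (by rwa [hre]) a (Real.exp X) ?_ ?_ ?_ ?_
          (Real.exp_pos _) ?_).2
        · rw [ha]; linarith
        · rw [ha, e2, e3]; linarith
        · rw [him]; linarith [hd.1]
        · rw [him]; linarith [hd.2]
        · rw [hexpX]; linarith)
  choose! C₀ hC₀ using hdir
  set L : ℝ := π / (2 * k) - η with hL
  have hL0 : 0 < L := by rw [hL, e2]; linarith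
  -- The other coefficients come from `G` and do not involve `d`. For nearby directions, the case `N
  -- = 1` shows that both constants are the limit of `f` along a common ray.
  have hconst : ∀ d ∈ Icc (α + a + η) (β - a - η), ∀ d' ∈ Icc (α + a + η) (β - a - η),
      C₀ d = C₀ d' := by
    intro d hd d' hd'
    refine eq_of_locally_eq hL0 (fun d hd d' hd' hdd => ?_) hd hd'
    refine eq_of_norm_sub_le_exp (X := X - Real.log 2)
      (K := 2 * (hankelConst k η X * (M + B) * (2 / δ) ^ (2 * k)
        * (2 / (Real.sin (k * η) * δ)) ^ 1 * Real.Gamma (1 + (1 : ℕ) / k))) fun x hx => ?_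
    have him : ((x : ℂ) + d * Complex.I).im = d := by simp
    have hre : ((x : ℂ) + d * Complex.I).re = x := by simp
    have h1 := hC₀ d hd 1 one_pos (x + d * Complex.I) (by rw [him, sub_self, abs_zero]; exact hL0.le)
      (by rwa [hre])
    have h2 := hC₀ d' hd' 1 one_pos (x + d * Complex.I) (by rw [him, abs_sub_comm]; exact hdd)
      (by rwa [hre])
    have hn : ‖Complex.exp (x + d * Complex.I)‖ = Real.exp x := by rw [Complex.norm_exp, hre]
    simp only [Finset.sum_range_one, borelCoeff, if_true, pow_zero, mul_one, hn] at h1 h2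
    have h3 := norm_sub_le_norm_sub_add_norm_sub (C₀ d) (f (x + d * Complex.I)) (C₀ d')
    rw [norm_sub_rev (C₀ d) (f _)] at h3
    refine h3.trans ((add_le_add h1 h2).trans_eq ?_)
    ring
  have hne : α + a + η ≤ β - a - η := by rw [ha, e2]; linarith
  refine ⟨borelCoeff k g (C₀ (α + a + η)), fun N w hw => ?_⟩
  obtain ⟨hw1, hw2, hw3⟩ := hw
  have hwre : w.re ≤ X - Real.log 2 := by
    rw [hX, ← Real.log_div (by positivity) two_ne_zero, Real.le_log_iff_exp_le (by positivity)]
    linarith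
  have hM0 : ‖f w‖ ≤ M := hM w ⟨by
    have := Real.log_pos one_lt_two
    show w.re < Real.log ρ
    linarith, ⟨by linarith, by linarith⟩⟩
  have hM1 : 0 ≤ M := (norm_nonneg _).trans hM0
  have hδk : (1 : ℝ) ≤ (2 / δ) ^ (2 * k) := one_le_pow₀ (by rw [le_div_iff₀ hδ]; linarith)
  rcases Nat.eq_zero_or_pos N with rfl | hN
  · simp only [Finset.range_zero, Finset.sum_empty, sub_zero, pow_zero, mul_one, Nat.cast_zero,
      zero_div, add_zero, Real.Gamma_one]
    calc ‖f w‖ ≤ 1 * (M + B) * 1 := by linarith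
      _ ≤ (hankelConst k η X + 1) * (M + B) * (2 / δ) ^ (2 * k) := by
          gcongr
          linarith
  · set d : ℝ := max (α + a + η) (min (β - a - η) w.im) with hd
    have hdmem : d ∈ Icc (α + a + η) (β - a - η) :=
      ⟨le_max_left _ _, max_le hne (min_le_left _ _)⟩
    have hwd : |w.im - d| ≤ π / (2 * k) - η := by
      rw [e2]
      rcases le_total w.im (α + a + η) with h | h
      · have : d = α + a + η := max_eq_left ((min_le_right _ _).trans h)
        rw [this, ha, e2, abs_le]
        rw [ha, e2] at h
        constructor <;> linarith
      · rcases le_total w.im (β - a - η) with h' | h'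
        · have : d = w.im := by rw [hd, min_eq_right h', max_eq_right h]
          rw [this, sub_self, abs_zero]
          linarith
        · have : d = β - a - η := by rw [hd, min_eq_left h', max_eq_right hne]
          rw [this, ha, e2, abs_le]
          rw [ha, e2] at h'
          constructor <;> linarith
    have h := hC₀ d hdmem N hN w hwd hwre
    rw [hconst d hdmem _ (left_mem_Icc.mpr hne)] at h
    refine h.trans ?_
    rw [div_div]
    have hG0 : 0 < Real.Gamma (1 + (N : ℝ) / k) := Real.Gamma_pos_of_pos (by positivity)
    gcongr
    linarith

/-! ### Power series on a polydisc -/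

theorem summable_pow_sum {x : ℝ} (hx0 : 0 ≤ x) (hx1 : x < 1) (n : ℕ) :
    Summable fun Q : Fin n → ℕ => x ^ (∑ i, Q i) := by
  induction n with
  | zero => exact (hasSum_fintype _).summable
  | succ n ih =>
    have h1 := (summable_geometric_of_lt_one hx0 hx1).mul_of_nonneg ih
      (fun m => pow_nonneg hx0 m) (fun Q => pow_nonneg hx0 _)
    have h2 : ((fun Q : Fin (n + 1) → ℕ => x ^ (∑ i, Q i)) ∘ (Fin.consEquiv fun _ => ℕ))
        = fun p : ℕ × (Fin n → ℕ) => x ^ p.1 * x ^ (∑ i, p.2 i) := by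
      ext p
      simp [Fin.consEquiv, Fin.sum_univ_succ, pow_add]
    rw [← (Fin.consEquiv fun _ => ℕ).summable_iff, h2]
    exact h1

theorem norm_prod_pow_le {n : ℕ} {y : Fin n → ℂ} {r : ℝ} (hy : ‖y‖ ≤ r) (Q : Fin n → ℕ) :
    ‖∏ i, y i ^ Q i‖ ≤ r ^ (∑ i, Q i) := by
  rw [norm_prod, ← Finset.prod_pow_eq_pow_sum]
  refine Finset.prod_le_prod (fun i _ => norm_nonneg _) fun i _ => ?_
  rw [norm_pow]
  gcongr
  exact (norm_le_pi_norm y i).trans hy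

/-- A monomial as a continuous multilinear map on the diagonal. -/
theorem exists_multilinear_monomial {n m : ℕ} (Q : Fin n → ℕ) (hQ : ∑ i, Q i = m) :
    ∃ p : ContinuousMultilinearMap ℂ (fun _ : Fin m => Fin n → ℂ) ℂ,
      ‖p‖ ≤ 1 ∧ ∀ y, (p fun _ => y) = ∏ i, y i ^ Q i := by
  subst hQ
  refine ⟨(ContinuousMultilinearMap.mkPiAlgebra ℂ (Fin (∑ i, Q i)) ℂ).compContinuousLinearMap
    fun l => ContinuousLinearMap.proj (finSigmaFinEquiv.symm l).1, ?_, fun y => ?_⟩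
  · refine ContinuousMultilinearMap.opNorm_le_bound zero_le_one fun v => ?_
    simp only [ContinuousMultilinearMap.compContinuousLinearMap_apply,
      ContinuousMultilinearMap.mkPiAlgebra_apply, one_mul, norm_prod]
    exact Finset.prod_le_prod (fun l _ => norm_nonneg _) fun l _ =>
      norm_le_pi_norm (v l) _
  · simp only [ContinuousMultilinearMap.compContinuousLinearMap_apply,
      ContinuousMultilinearMap.mkPiAlgebra_apply, ContinuousLinearMap.proj_apply]
    rw [← finSigmaFinEquiv.prod_comp]
    simp only [Equiv.symm_apply_apply]
    rw [Fintype.prod_sigma]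
    simp

theorem norm_coeff_mul_monomial_le {n : ℕ} {a : (Fin n → ℕ) → ℂ} {c Λ r : ℝ}
    (ha : ∀ Q, ‖a Q‖ ≤ c * Λ ^ (∑ i, Q i)) {y : Fin n → ℂ} (hy : ‖y‖ ≤ r) (Q : Fin n → ℕ) :
    ‖a Q * ∏ i, y i ^ Q i‖ ≤ c * (Λ * r) ^ (∑ i, Q i) := by
  rw [norm_mul, mul_pow, ← mul_assoc]
  have h1 := (norm_nonneg _).trans (ha Q)
  gcongr
  · exact ha Q
  · exact norm_prod_pow_le hy Q

/-- The sum of a power series on a polydisc is analytic. -/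
theorem analyticOnNhd_tsum_monomial {n : ℕ} {a : (Fin n → ℕ) → ℂ} {c Λ r : ℝ} (hΛ : 0 ≤ Λ)
    (hr : 0 < r) (hΛr : Λ * r < 1) (ha : ∀ Q, ‖a Q‖ ≤ c * Λ ^ (∑ i, Q i)) :
    AnalyticOnNhd ℂ (fun y : Fin n → ℂ => ∑' Q : Fin n → ℕ, a Q * ∏ i, y i ^ Q i)
      (Metric.ball 0 r) := by
  have hx0 : 0 ≤ Λ * r := by positivity
  have hgeo := (summable_pow_sum hx0 hΛr n).mul_left c
  have hc : 0 ≤ c := by simpa using (norm_nonneg _).trans (ha 0)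
  have hmono : ∀ (m : ℕ) (Q : Fin n → ℕ),
      ∃ p : ContinuousMultilinearMap ℂ (fun _ : Fin m => Fin n → ℂ) ℂ,
        ∑ i, Q i = m → ‖p‖ ≤ 1 ∧ ∀ y, (p fun _ => y) = ∏ i, y i ^ Q i := by
    intro m Q
    by_cases h : ∑ i, Q i = m
    · obtain ⟨p, hp⟩ := exists_multilinear_monomial Q h
      exact ⟨p, fun _ => hp⟩
    · exact ⟨0, fun h' => absurd h' h⟩
  choose mono hmono using hmono
  -- The homogeneous part of degree `m` is a finite sum over the multi-indices of that degree; the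
  -- default value `0` of `mono` in other degrees never enters.
  set p : FormalMultilinearSeries ℂ (Fin n → ℂ) ℂ := fun m =>
    ∑ Q ∈ Finset.piAntidiag Finset.univ m, a Q • mono m Q with hp
  have hmem : ∀ (m : ℕ) (Q : Fin n → ℕ), Q ∈ Finset.piAntidiag Finset.univ m ↔ ∑ i, Q i = m := by
    intro m Q
    simp [Finset.mem_piAntidiag]
  have hps : HasFPowerSeriesOnBall
      (fun y : Fin n → ℂ => ∑' Q : Fin n → ℕ, a Q * ∏ i, y i ^ Q i) p 0 (ENNReal.ofReal r) := by
    refine ⟨?_, by simpa using hr, fun {y} hy => ?_⟩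
    · refine FormalMultilinearSeries.le_radius_of_bound p (r := NNReal.mk r hr.le)
        (C := ∑' Q : Fin n → ℕ, c * (Λ * r) ^ (∑ i, Q i)) (fun m => ?_) |>.trans' ?_
      · have h1 : ‖p m‖ ≤ ∑ Q ∈ Finset.piAntidiag (Finset.univ : Finset (Fin n)) m, c * Λ ^ (∑ i, Q i) := by
          refine norm_sum_le_of_le _ fun Q hQ => ?_
          rw [norm_smul]
          have h2 := (hmono m Q ((hmem m Q).mp hQ)).1
          calc _ ≤ c * Λ ^ (∑ i, Q i) * 1 :=
                mul_le_mul (ha Q) h2 (norm_nonneg _) ((norm_nonneg _).trans (ha Q))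
            _ = _ := mul_one _
        calc ‖p m‖ * r ^ m
            ≤ (∑ Q ∈ Finset.piAntidiag (Finset.univ : Finset (Fin n)) m, c * Λ ^ (∑ i, Q i)) * r ^ m := by gcongr
          _ = ∑ Q ∈ Finset.piAntidiag (Finset.univ : Finset (Fin n)) m, c * (Λ * r) ^ (∑ i, Q i) := by
              rw [Finset.sum_mul]
              refine Finset.sum_congr rfl fun Q hQ => ?_
              rw [(hmem m Q).mp hQ, mul_pow, mul_assoc]
          _ ≤ _ := hgeo.sum_le_tsum _ fun Q _ => by positivity
      · exact (ENNReal.ofReal_eq_coe_nnreal hr.le).le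
    · have hyr : ‖y‖ ≤ r := by
        rw [Metric.eball_ofReal] at hy
        exact (mem_ball_zero_iff.mp hy).le
      have hs : Summable fun Q : Fin n → ℕ => a Q * ∏ i, y i ^ Q i :=
        Summable.of_norm_bounded hgeo (norm_coeff_mul_monomial_le ha hyr)
      rw [zero_add]
      have h1 := (Equiv.sigmaFiberEquiv fun Q : Fin n → ℕ => ∑ i, Q i).hasSum_iff.mpr hs.hasSum
      refine h1.sigma fun m => ?_
      have h2 : (p m fun _ => y) = ∑ Q ∈ Finset.piAntidiag Finset.univ m,
          ({Q : Fin n → ℕ | ∑ i, Q i = m}.indicator fun Q => a Q * ∏ i, y i ^ Q i) Q := by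
        simp only [hp, _root_.sum_apply, _root_.smul_apply,
          smul_eq_mul]
        refine Finset.sum_congr rfl fun Q hQ => ?_
        rw [(hmono m Q ((hmem m Q).mp hQ)).2,
          indicator_of_mem (show Q ∈ {Q : Fin n → ℕ | ∑ i, Q i = m} from (hmem m Q).mp hQ)]
      rw [h2]
      refine (hasSum_subtype_iff_indicator (s := {Q : Fin n → ℕ | ∑ i, Q i = m})
        (f := fun Q => a Q * ∏ i, y i ^ Q i)).mpr ?_
      refine hasSum_sum_of_ne_finset_zero fun Q hQ => ?_
      exact indicator_of_notMem (s := {Q : Fin n → ℕ | ∑ i, Q i = m})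
        (fun h => hQ ((hmem m Q).mpr h)) _
  have := hps.analyticOnNhd
  rwa [Metric.eball_ofReal] at this

/-! ### Addition of Gevrey orders, summation over `Q`, and the theorem -/

/-- `log Γ` is convex and vanishes at `1`, so on the segment from `1` to `1 + p + q` it lies below
its chord through zero; add the bounds at `1 + p` and `1 + q`. -/
theorem Gamma_mul_Gamma_le {p q : ℝ} (hp : 0 ≤ p) (hq : 0 ≤ q) :
    Real.Gamma (1 + p) * Real.Gamma (1 + q) ≤ Real.Gamma (1 + (p + q)) := by
  rcases eq_or_lt_of_le (add_nonneg hp hq) with h | h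
  · have h1 : p = 0 := by linarith
    have h2 : q = 0 := by linarith
    simp [h1, h2]
  · have hconv := Real.convexOn_log_Gamma
    have hpos : ∀ x : ℝ, 0 ≤ x → 0 < Real.Gamma (1 + x) := fun x hx =>
      Real.Gamma_pos_of_pos (by linarith)
    have key : ∀ x y : ℝ, 0 ≤ x → 0 ≤ y → x + y = p + q → Real.log (Real.Gamma (1 + x))
        ≤ x / (p + q) * Real.log (Real.Gamma (1 + (p + q))) := by
      intro x y hx hy hxy
      have h1 := hconv.2 (show (1 : ℝ) ∈ Ioi 0 from mem_Ioi.mpr one_pos)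
        (show 1 + (p + q) ∈ Ioi (0 : ℝ) by rw [mem_Ioi]; linarith)
        (show 0 ≤ y / (p + q) by positivity) (show 0 ≤ x / (p + q) by positivity)
        (by rw [← add_div, div_eq_one_iff_eq h.ne']; linarith)
      have h2 : y / (p + q) * 1 + x / (p + q) * (1 + (p + q)) = 1 + x := by
        field_simp
        linear_combination hxy
      simp only [smul_eq_mul, h2, Function.comp_apply, Real.Gamma_one, Real.log_one, mul_zero,
        zero_add] at h1
      exact h1
    rw [← Real.log_le_log_iff (mul_pos (hpos p hp) (hpos q hq)) (hpos _ h.le),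
      Real.log_mul (hpos p hp).ne' (hpos q hq).ne']
    have k1 := key p q hp hq rfl
    have k2 := key q p hq hp (add_comm q p)
    have k3 : p / (p + q) + q / (p + q) = 1 := by rw [← add_div, div_self h.ne']
    calc _ ≤ (p / (p + q) + q / (p + q)) * Real.log (Real.Gamma (1 + (p + q))) := by linarith
      _ = _ := by rw [k3, one_mul]

/-- Uniform Gevrey expansions of the coefficients of a power series in `y` give a Gevrey
expansion of its sum. -/
theorem isGevreyUniformlyOn_of_coeff {n : ℕ} {s R R' C A Λ θ₁ θ₂ ρ : ℝ}
    {g : ℂ → (Fin n → ℂ) → ℂ} {gQ : (Fin n → ℕ) → ℂ → ℂ} {b : (Fin n → ℕ) → ℕ → ℂ}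
    (hC : 0 < C) (hA : 0 < A) (hΛ : 0 ≤ Λ) (hs : 0 ≤ s) (hρ : 0 < ρ) (hθ : θ₁ ≤ θ₂) (hR' : 0 < R')
    (hR'R : R' ≤ R) (hΛR : Λ * R' < 1)
    (hsum : ∀ w ∈ closedSector θ₁ θ₂ ρ, ∀ y ∈ Metric.closedBall (0 : Fin n → ℂ) R,
      HasSum (fun Q : Fin n → ℕ => gQ Q w * ∏ i, y i ^ Q i) (g w y))
    (hb : ∀ (Q : Fin n → ℕ) (N : ℕ), ∀ w ∈ closedSector θ₁ θ₂ ρ,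
      ‖gQ Q w - ∑ j ∈ Finset.range N, b Q j * Complex.exp w ^ j‖
        ≤ C * Λ ^ (∑ i, Q i) * A ^ N * Real.Gamma (1 + N * s) * ‖Complex.exp w‖ ^ N) :
    IsGevreyUniformlyOn s g θ₁ θ₂ ρ R' := by
  have hx0 : 0 ≤ Λ * R' := by positivity
  have hgeo := summable_pow_sum hx0 hΛR n
  set T := ∑' Q : Fin n → ℕ, (Λ * R') ^ (∑ i, Q i) with hT
  have hT1 : 0 < T := by
    refine hgeo.tsum_pos (fun Q => by positivity) 0 ?_
    simp
  have hG : ∀ N : ℕ, 0 < Real.Gamma (1 + N * s) := fun N => Real.Gamma_pos_of_pos (by positivity)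
  set w₀ : ℂ := Real.log ρ + θ₁ * Complex.I with hw₀
  have hw₀m : w₀ ∈ closedSector θ₁ θ₂ ρ := by
    simp [hw₀, closedSector, hθ, Real.exp_log hρ]
  -- A single point `w₀` suffices: the term of index `j` is the difference of two consecutive
  -- remainders. The resulting constant depends on `j`, which is harmless, as it is used only for
  -- convergence.
  have hcoef : ∀ j, ∃ c, ∀ Q, ‖b Q j‖ ≤ c * Λ ^ (∑ i, Q i) := by
    intro j
    set e := ‖Complex.exp w₀‖ with he
    have he0 : 0 < e := norm_pos_iff.mpr (Complex.exp_ne_zero _)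
    refine ⟨(C * A ^ j * Real.Gamma (1 + j * s) * e ^ j + C * A ^ (j + 1)
      * Real.Gamma (1 + (j + 1 : ℕ) * s) * e ^ (j + 1)) / e ^ j, fun Q => ?_⟩
    have h1 := hb Q j w₀ hw₀m
    have h2 := hb Q (j + 1) w₀ hw₀m
    rw [Finset.sum_range_succ] at h2
    have h3 : b Q j * Complex.exp w₀ ^ j = (gQ Q w₀ - ∑ i ∈ Finset.range j, b Q i
        * Complex.exp w₀ ^ i) - (gQ Q w₀ - (∑ i ∈ Finset.range j, b Q i * Complex.exp w₀ ^ i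
        + b Q j * Complex.exp w₀ ^ j)) := by ring
    have h4 : ‖b Q j‖ * e ^ j = ‖b Q j * Complex.exp w₀ ^ j‖ := by rw [norm_mul, norm_pow]
    rw [div_mul_eq_mul_div, le_div_iff₀ (by positivity), h4, h3]
    refine (norm_sub_le _ _).trans ((add_le_add h1 h2).trans_eq ?_)
    ring
  choose c hc using hcoef
  refine ⟨fun j y => ∑' Q : Fin n → ℕ, b Q j * ∏ i, y i ^ Q i,
    fun j => analyticOnNhd_tsum_monomial hΛ hR' hΛR (hc j), C * T, A, by positivity, hA,
    fun N w hw y hy => ?_⟩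
  have hyR' : ‖y‖ ≤ R' := (mem_ball_zero_iff.mp hy).le
  have hg := hsum w hw y (mem_closedBall_zero_iff.mpr (hyR'.trans hR'R))
  have hbs : ∀ j, HasSum (fun Q : Fin n → ℕ => b Q j * ∏ i, y i ^ Q i)
      (∑' Q : Fin n → ℕ, b Q j * ∏ i, y i ^ Q i) := fun j =>
    (Summable.of_norm_bounded (hgeo.mul_left (c j))
      (norm_coeff_mul_monomial_le (hc j) hyR')).hasSum
  have h1 := hg.sub (hasSum_sum fun j (_ : j ∈ Finset.range N) =>
    (hbs j).mul_right (Complex.exp w ^ j))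
  have h2 : HasSum (fun Q : Fin n → ℕ => C * A ^ N * Real.Gamma (1 + N * s)
      * ‖Complex.exp w‖ ^ N * (Λ * R') ^ (∑ i, Q i))
      (C * A ^ N * Real.Gamma (1 + N * s) * ‖Complex.exp w‖ ^ N * T) := hgeo.hasSum.mul_left _
  refine (h1.norm_le_of_bounded h2 fun Q => ?_).trans_eq (by ring)
  have h3 : gQ Q w * ∏ i, y i ^ Q i - ∑ j ∈ Finset.range N, b Q j * (∏ i, y i ^ Q i)
      * Complex.exp w ^ j = (gQ Q w - ∑ j ∈ Finset.range N, b Q j * Complex.exp w ^ j)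
      * ∏ i, y i ^ Q i := by
    rw [sub_mul, Finset.sum_mul]
    congr 1
    exact Finset.sum_congr rfl fun j _ => by ring
  rw [h3, norm_mul, mul_pow]
  have := hG N
  calc _ ≤ (C * Λ ^ (∑ i, Q i) * A ^ N * Real.Gamma (1 + N * s) * ‖Complex.exp w‖ ^ N)
        * R' ^ (∑ i, Q i) :=
        mul_le_mul (hb Q N w hw) (norm_prod_pow_le hyR' Q) (norm_nonneg _) (by positivity)
    _ = _ := by ring

theorem IsBorelTransformOnDisc.mono {k : ℕ} {f G : ℂ → ℂ} {α β ρ δ δ' : ℝ} (h : δ' ≤ δ)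
    (hG : IsBorelTransformOnDisc k f α β ρ δ G) : IsBorelTransformOnDisc k f α β ρ δ' G :=
  ⟨hG.1.mono (Metric.closedBall_subset_closedBall h), fun τ hτ => hG.2 τ (hτ.trans h)⟩

/-- Applied to powers of `(m + 1) ^ γ`, this trades the shrinking of the discs for a Gamma factor of
order `γ` and a factor geometric in the degree `m`. -/
theorem rpow_le_Gamma_mul_exp {p x : ℝ} (hp : 0 ≤ p) (hx : 0 ≤ x) :
    x ^ p ≤ Real.Gamma (1 + p) * Real.exp x := by
  have h := rpow_mul_exp_neg_le_Gamma hp hx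
  rwa [Real.exp_neg, ← div_eq_mul_inv, div_le_iff₀ (Real.exp_pos _)] at h

/-- The bounds for the individual coefficients, made uniform in the degree. -/
theorem exists_uniform_coeff_expansion {n k : ℕ} (hk : 0 < k) {α β ρ R γ c K M ε : ℝ}
    (hαβ : π / k < β - α) (hρ : 0 < ρ) (hR : 0 < R) (hγ : 0 ≤ γ) (hc : 0 < c) (hε : 0 < ε)
    {gQ : (Fin n → ℕ) → ℂ → ℂ}
    (hd : ∀ Q, DifferentiableOn ℂ (gQ Q) (Iio (Real.log ρ) ×ℂ Ioo α β))
    (hM : ∀ Q, ∀ w ∈ Iio (Real.log ρ) ×ℂ Ioo α β, ‖gQ Q w‖ ≤ M * R⁻¹ ^ (∑ i, Q i))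
    (hB0 : ∃ δ > 0, ∃ G : ℂ → ℂ, IsBorelTransformOnDisc k (gQ 0) α β ρ δ G)
    (hB : ∀ Q : Fin n → ℕ, 1 ≤ ∑ i, Q i →
      ∃ G : ℂ → ℂ,
        IsBorelTransformOnDisc k (gQ Q) α β ρ (c * ((∑ i, Q i : ℕ) : ℝ) ^ (-γ)) G ∧
        ∀ t ∈ Metric.closedBall (0 : ℂ) (c * ((∑ i, Q i : ℕ) : ℝ) ^ (-γ)),
          ‖G t‖ ≤ K ^ (∑ i, Q i)) :
    ∃ ρ' C A Λ : ℝ, ∃ b : (Fin n → ℕ) → ℕ → ℂ, 0 < ρ' ∧ ρ' < ρ ∧ 0 < C ∧ 0 < A ∧ 0 < Λ ∧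
      ∀ (Q : Fin n → ℕ) (N : ℕ), ∀ w ∈ closedSector (α + ε) (β - ε) ρ',
      ‖gQ Q w - ∑ j ∈ Finset.range N, b Q j * Complex.exp w ^ j‖
        ≤ C * Λ ^ (∑ i, Q i) * A ^ N * Real.Gamma (1 + N * (γ + 1 / k))
          * ‖Complex.exp w‖ ^ N := by
  have hk' : (0 : ℝ) < k := by exact_mod_cast hk
  obtain ⟨δ₀, hδ₀, G₀, hG₀⟩ := hB0
  obtain ⟨ρ', C, A, hρ', hρ'ρ, hC, hA, hexp⟩ := exists_sectorial_expansion hk hαβ hρ hε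
  obtain ⟨B₀, hB₀⟩ := (isCompact_closedBall (0 : ℂ) δ₀).exists_bound_of_continuousOn
    hG₀.1.continuousOn
  set c' := min (min c δ₀) 1 with hc'
  have hc'0 : 0 < c' := lt_min (lt_min hc hδ₀) one_pos
  set L : ℝ := max (max |K| |B₀|) (max R⁻¹ 1) with hL
  have hL1 : 1 ≤ L := (le_max_right _ _).trans (le_max_right _ _)
  have hLK : |K| ≤ L := (le_max_left _ _).trans (le_max_left _ _)
  have hLB : |B₀| ≤ L := (le_max_right _ _).trans (le_max_left _ _)
  have hLR : R⁻¹ ≤ L := (le_max_left _ _).trans (le_max_right _ _)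
  -- Using `m + 1` instead of `m` lets one formula for the radius include `Q = 0`.
  set d : (Fin n → ℕ) → ℝ := fun Q => ((∑ i, Q i : ℕ) : ℝ) + 1 with hdd
  have hd1 : ∀ Q, 1 ≤ d Q := fun Q => by
    simp only [hdd]
    linarith [Nat.cast_nonneg (α := ℝ) (∑ i, Q i)]
  have hδ0 : ∀ Q, 0 < c' * d Q ^ (-γ) := fun Q =>
    mul_pos hc'0 (Real.rpow_pos_of_pos (by linarith [hd1 Q]) _)
  have hδ1 : ∀ Q, d Q ^ (-γ) ≤ 1 := fun Q =>
    Real.rpow_le_one_of_one_le_of_nonpos (hd1 Q) (by linarith)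
  have hex : ∀ Q, ∃ G : ℂ → ℂ, IsBorelTransformOnDisc k (gQ Q) α β ρ (c' * d Q ^ (-γ)) G ∧
      ∀ t ∈ Metric.closedBall (0 : ℂ) (c' * d Q ^ (-γ)), ‖G t‖ ≤ L ^ (∑ i, Q i + 1) := by
    intro Q
    rcases Nat.eq_zero_or_pos (∑ i, Q i) with h0 | h1
    · have hQ : Q = 0 := by
        ext i
        exact (Finset.sum_eq_zero_iff.mp h0) i (Finset.mem_univ i)
      have hle : c' * d Q ^ (-γ) ≤ δ₀ :=
        (mul_le_of_le_one_right hc'0.le (hδ1 Q)).trans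
          ((min_le_left _ _).trans (min_le_right _ _))
      refine ⟨G₀, by rw [hQ] at hle ⊢; exact hG₀.mono hle, fun t ht => ?_⟩
      rw [h0, zero_add, pow_one]
      exact (hB₀ t (Metric.closedBall_subset_closedBall hle ht)).trans ((le_abs_self _).trans hLB)
    · obtain ⟨G, hG, hGb⟩ := hB Q h1
      have hm : (0 : ℝ) < ((∑ i, Q i : ℕ) : ℝ) := by exact_mod_cast h1
      have hle : c' * d Q ^ (-γ) ≤ c * ((∑ i, Q i : ℕ) : ℝ) ^ (-γ) := by
        refine mul_le_mul ((min_le_left _ _).trans (min_le_left _ _)) ?_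
          (Real.rpow_nonneg (by linarith [hd1 Q]) _) hc.le
        exact Real.rpow_le_rpow_of_nonpos hm (by simp only [hdd]; linarith) (by linarith)
      refine ⟨G, hG.mono hle, fun t ht => ?_⟩
      refine (hGb t (Metric.closedBall_subset_closedBall hle ht)).trans ?_
      calc K ^ (∑ i, Q i) ≤ |K| ^ (∑ i, Q i) := by
            rw [← abs_pow]; exact le_abs_self _
        _ ≤ L ^ (∑ i, Q i) := by gcongr
        _ ≤ _ := pow_le_pow_right₀ hL1 (Nat.le_succ _)
  have hbex : ∀ Q, ∃ b : ℕ → ℂ, ∀ N : ℕ, ∀ w ∈ closedSector (α + ε) (β - ε) ρ',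
      ‖gQ Q w - ∑ j ∈ Finset.range N, b j * Complex.exp w ^ j‖
        ≤ C * (M * R⁻¹ ^ (∑ i, Q i) + L ^ (∑ i, Q i + 1)) * (2 / (c' * d Q ^ (-γ))) ^ (2 * k)
          * (A / (c' * d Q ^ (-γ))) ^ N * Real.Gamma (1 + N / k)
          * ‖Complex.exp w‖ ^ N := fun Q => by
    obtain ⟨G, hG, hGb⟩ := hex Q
    exact hexp (gQ Q) G _ _ _ (hd Q) (hM Q) (hδ0 Q)
      (mul_le_one₀ (min_le_right _ _) (Real.rpow_nonneg (by linarith [hd1 Q]) _) (hδ1 Q)) hG hGb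
  choose b hb using hbex
  set e := Real.exp 1 with he
  have he0 : 0 < e := Real.exp_pos 1
  -- `L` carries the bounds for the function and its Borel transform; one factor `e` comes from
  -- `δ^(-2k)`, the other from `δ^(-N)`. All three occur with exponent `m + 1`, hence the extra `Λ`
  -- in `C'`.
  set Λ := L * e * e with hΛ
  have hL0 : 0 < L := by linarith
  have hΛ0 : 0 < Λ := by positivity
  set C' := C * (|M| + 1) * (2 / c') ^ (2 * k) * Real.Gamma (1 + (2 * k : ℕ) * γ) * Λ with hC'
  have hGk : 0 < Real.Gamma (1 + (2 * k : ℕ) * γ) := Real.Gamma_pos_of_pos (by positivity)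
  refine ⟨ρ', C', A / c', Λ, b, hρ', hρ'ρ, by positivity, by positivity, hΛ0,
    fun Q N w hw => (hb Q N w hw).trans ?_⟩
  set m := ∑ i, Q i with hm
  have hdQ : 0 < d Q := by linarith [hd1 Q]
  have hinv : ∀ x : ℝ, x / (c' * d Q ^ (-γ)) = x / c' * d Q ^ γ := fun x => by
    rw [Real.rpow_neg hdQ.le]
    field_simp
  have hpow : ∀ i : ℕ, (d Q ^ γ) ^ i ≤ Real.Gamma (1 + i * γ) * e ^ (m + 1) := by
    intro i
    rw [← Real.rpow_natCast (d Q ^ γ), ← Real.rpow_mul hdQ.le, mul_comm γ]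
    refine (rpow_le_Gamma_mul_exp (by positivity) hdQ.le).trans_eq ?_
    rw [he, ← Real.exp_nat_mul, mul_one]
    push_cast
    simp only [hdd, hm]
  have hMB : M * R⁻¹ ^ m + L ^ (m + 1) ≤ (|M| + 1) * L ^ (m + 1) := by
    have : M * R⁻¹ ^ m ≤ |M| * L ^ (m + 1) := by
      calc M * R⁻¹ ^ m ≤ |M| * R⁻¹ ^ m := by gcongr; exact le_abs_self M
        _ ≤ |M| * L ^ m := by gcongr
        _ ≤ |M| * L ^ (m + 1) := by
            gcongr
            exact Nat.le_succ m
    linarith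
  have hGN : 0 < Real.Gamma (1 + (N : ℝ) / k) := Real.Gamma_pos_of_pos (by positivity)
  have hGNγ : 0 < Real.Gamma (1 + N * γ) := Real.Gamma_pos_of_pos (by positivity)
  have hGG : Real.Gamma (1 + N * γ) * Real.Gamma (1 + (N : ℝ) / k)
      ≤ Real.Gamma (1 + N * (γ + 1 / k)) := by
    have := Gamma_mul_Gamma_le (p := N * γ) (q := (N : ℝ) / k) (by positivity) (by positivity)
    rwa [show (N : ℝ) * (γ + 1 / k) = N * γ + N / k by ring]
  rw [hinv, hinv, mul_pow, mul_pow]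
  calc _ ≤ C * ((|M| + 1) * L ^ (m + 1)) * ((2 / c') ^ (2 * k) * (Real.Gamma (1 + (2 * k : ℕ) * γ)
        * e ^ (m + 1))) * ((A / c') ^ N * (Real.Gamma (1 + N * γ) * e ^ (m + 1)))
        * Real.Gamma (1 + N / k) * ‖Complex.exp w‖ ^ N := by
        gcongr
        · exact hpow (2 * k)
        · exact hpow N
    _ = C' * Λ ^ m * (A / c') ^ N * (Real.Gamma (1 + N * γ) * Real.Gamma (1 + (N : ℝ) / k))
        * ‖Complex.exp w‖ ^ N := by
        rw [hC', hΛ, mul_pow, mul_pow, pow_succ, pow_succ]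
        ring
    _ ≤ _ := by gcongr

theorem theorem1 (n k : ℕ) (hk : 0 < k) (α β ρ R γ c K : ℝ)
    (hαβ : π / k < β - α) (hρ : 0 < ρ) (hR : 0 < R) (hγ : 0 ≤ γ) (hc : 0 < c) (hK : 0 < K)
    (g : ℂ → (Fin n → ℂ) → ℂ) (gQ : (Fin n → ℕ) → ℂ → ℂ)
    (hg : AnalyticOnNhd ℂ (fun p : ℂ × (Fin n → ℂ) => g p.1 p.2)
      (closedSector α β ρ ×ˢ Metric.closedBall 0 R))
    (hbdd : ∃ M : ℝ, ∀ w ∈ closedSector α β ρ, ∀ y ∈ Metric.closedBall (0 : Fin n → ℂ) R,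
      ‖g w y‖ ≤ M)
    (hsum : ∀ w ∈ closedSector α β ρ, ∀ y ∈ Metric.closedBall (0 : Fin n → ℂ) R,
      HasSum (fun Q : Fin n → ℕ => gQ Q w * ∏ i, y i ^ Q i) (g w y))
    (hB0 : ∃ δ > 0, ∃ G : ℂ → ℂ, IsBorelTransformOnDisc k (gQ 0) α β ρ δ G)
    (hB : ∀ Q : Fin n → ℕ, 1 ≤ ∑ i, Q i →
      ∃ G : ℂ → ℂ,
        IsBorelTransformOnDisc k (gQ Q) α β ρ (c * ((∑ i, Q i : ℕ) : ℝ) ^ (-γ)) G ∧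
        ∀ t ∈ Metric.closedBall (0 : ℂ) (c * ((∑ i, Q i : ℕ) : ℝ) ^ (-γ)),
          ‖G t‖ ≤ K ^ (∑ i, Q i)) :
    (∀ ε : ℝ, 0 < ε → ε < (β - α) / 2 →
      ∃ ρ' R' : ℝ, 0 < ρ' ∧ ρ' < ρ ∧ 0 < R' ∧ R' < R ∧
        IsGevreyUniformlyOn (γ + 1 / k) g (α + ε) (β - ε) ρ' R') ∧
    (γ < (β - α) / π - 1 / k →
      ∃ ε ρ' R' : ℝ, 0 < ε ∧ ε < (β - α) / 2 ∧ 0 < ρ' ∧ ρ' < ρ ∧ 0 < R' ∧ R' < R ∧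
        IsSumUniformlyOn (k / (k * γ + 1)) g (α + ε) (β - ε) ρ' R') := by
  have hk' : (0 : ℝ) < k := by exact_mod_cast hk
  have gevrey : ∀ ε : ℝ, 0 < ε → ε < (β - α) / 2 →
      ∃ ρ' R' : ℝ, 0 < ρ' ∧ ρ' < ρ ∧ 0 < R' ∧ R' < R ∧
        IsGevreyUniformlyOn (γ + 1 / k) g (α + ε) (β - ε) ρ' R' := by
    intro ε hε hε2
    obtain ⟨M, hM⟩ := hbdd
    have hsub : Iio (Real.log ρ) ×ℂ Ioo α β ⊆ closedSector α β ρ := fun w hw =>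
      ⟨hw.2.1.le, hw.2.2.le, ((Real.lt_log_iff_exp_lt hρ).mp hw.1).le⟩
    have hopen : IsOpen (Iio (Real.log ρ) ×ℂ Ioo α β) := isOpen_Iio.reProdIm isOpen_Ioo
    have hd : ∀ Q, DifferentiableOn ℂ (gQ Q) (Iio (Real.log ρ) ×ℂ Ioo α β) := fun Q =>
      differentiableOn_coeff hR g gQ hopen (hg.mono (prod_mono_left hsub))
        (fun w hw => hM w (hsub hw)) (fun w hw => hsum w (hsub hw)) Q
    have hMQ : ∀ Q, ∀ w ∈ Iio (Real.log ρ) ×ℂ Ioo α β, ‖gQ Q w‖ ≤ M * R⁻¹ ^ (∑ i, Q i) :=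
      fun Q w hw => norm_coeff_le hR (fun Q => gQ Q w) (g w) (hsum w (hsub hw)) (hM w (hsub hw)) Q
    obtain ⟨ρ', C, A, Λ, b, hρ', hρ'ρ, hC, hA, hΛ, hb⟩ :=
      exists_uniform_coeff_expansion hk hαβ hρ hR hγ hc hε hd hMQ hB0 hB
    have hR' : min (R / 2) (1 / (2 * Λ)) < R := (min_le_left _ _).trans_lt (by linarith)
    refine ⟨ρ', min (R / 2) (1 / (2 * Λ)), hρ', hρ'ρ, by positivity, hR', ?_⟩
    refine isGevreyUniformlyOn_of_coeff hC hA hΛ.le (by positivity) hρ' (by linarith)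
      (by positivity) hR'.le ?_ (fun w hw => hsum w ?_) hb
    · calc Λ * min (R / 2) (1 / (2 * Λ)) ≤ Λ * (1 / (2 * Λ)) := by
            gcongr; exact min_le_right _ _
        _ = 1 / 2 := by field_simp
        _ < 1 := by norm_num
    · exact ⟨by linarith [hw.1], by linarith [hw.2.1], hw.2.2.trans hρ'ρ.le⟩
  refine ⟨gevrey, fun hγlt => ?_⟩
  have hs : 0 < γ + 1 / k := by positivity
  have hopening : π * (γ + 1 / k) < β - α := by
    rw [mul_comm, ← lt_div_iff₀ Real.pi_pos]
    linarith
  have hps : 0 < π * (γ + 1 / k) := by positivity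
  have hκ : 1 / ((k : ℝ) / (k * γ + 1)) = γ + 1 / k := by
    field_simp
  -- Removing a quarter of the excess opening on each side leaves half of the excess over `π (γ +
  -- 1/k)`.
  obtain ⟨ρ', R', h1, h2, h3, h4, h5⟩ := gevrey ((β - α - π * (γ + 1 / k)) / 4) (by linarith)
    (by linarith)
  refine ⟨(β - α - π * (γ + 1 / k)) / 4, ρ', R', by linarith, by linarith, h1, h2, h3, h4,
    by positivity, ?_, by rwa [hκ]⟩
  rw [div_eq_mul_one_div, hκ]
  linarith
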